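/- Let $d\ge 1$ and let $\mathbb{H}^d=\mathbb{C}^d\times\mathbb{R}$ be the Heisenberg group, with points $(z,t)$, $z_j=x_j+iy_j$, Lebesgue (Haar) measure $dz\,dt$, and Koranyi norm $\rho=|(z,t)|_{\mathbb{H}}=(|z|^4+t^2)^{1/4}$. Let $X_j=\partial_{x_j}+2y_j\partial_t$, $Y_j=\partial_{y_j}-2x_j\partial_t$ $(1\le j\le d)$, $\nabla_{\mathbb{H}}=(X_1,\dots,X_d,Y_1,\dots,Y_d)$, $\mathcal{L}=-\sum_j(X_j^2+Y_j^2)$, and let $H^1(\mathbb{H}^d)$ be the space of $u\in L^2(\mathbb{H}^d)$ whose weak horizontal gradient $\nabla_{\mathbb{H}}u$ is in $L^2(\mathbb{H}^d)$. For $\delta>0$ put $$K_d(\delta)=\min_{\gamma>0}\left(\frac{8d+2+\gamma\sqrt\delta}{4d}+\sqrt{\frac{(8d+2+\gamma\sqrt\delta)^2}{16d^2}+\frac{\sqrt\delta}{2\gamma}}\right),\qquad \kappa_d=\min_{\delta>0}\max\left\{\frac{1+1/\delta}{d^2},\frac{K_d(\delta)}{d}\right\}.$$ **Theorem.** Let $V\colon\mathbb{H}^d\to\mathbb{C}$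 be measurable and assume that there is $a<1$ such that $$\int_{\mathbb{H}^d}|V||\psi|^2\le a\int_{\mathbb{H}^d}|\nabla_{\mathbb{H}}\psi|^2\qquad\text{for all }\psi\in H^1(\mathbb{H}^d).$$ Assume moreover that, for some constant $b>0$ with $b<\dfrac{1}{d\,\kappa_d}$, $$\int_{\mathbb{H}^d}\frac{\rho^4}{|z|^2}|V|^2|\psi|^2\le b^2\int_{\mathbb{H}^d}|\nabla_{\mathbb{H}}\psi|^2\qquad\text{for all }\psi\in H^1(\mathbb{H}^d).$$ Let $\mathcal{L}+V$ be the operator in $L^2(\mathbb{H}^d)$ associated with the form $q(u,v)=\int\nabla_{\mathbb{H}}u\cdot\overline{\nabla_{\mathbb{H}}v}+\int Vu\overline v$ on $H^1(\mathbb{H}^d)$: $u\in H^1(\mathbb{H}^d)$ is in its domain and $(\mathcal{L}+V)u=w\in L^2(\mathbb{H}^d)$ if and only if $q(u,v)=\int w\overline v$ for all $v\in H^1(\mathbb{H}^d)$. Then $\mathcal{L}+V$ has no radial eigenfunctions: there are no $\lambda\in\mathbb{C}$ and no $u\in H^1(\mathbb{H}^d)$ with $u\ne0$ and $(\mathcal{L}+V)u=\lambda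 u$ such that $u(z,t)=g_0(|(z,t)|_{\mathbb{H}})$ almost everywhere for some function $g_0\colon[0,\infty)\to\mathbb{C}$. -/

import Mathlib

open MeasureTheory
open scoped ContDiff ComplexConjugate

namespace Heisenberg

/-- The underlying space `ℂ^d × ℝ` of the Heisenberg group; a point is `p = (z, t)` with
`z j = x j + i y j`. Its `volume` is the Lebesgue measure `dz dt`, which is the Haar measure of the
group. (The norm Lean puts on this type is used only for its topology and smooth structure.) -/
abbrev Space (d : ℕ) : Type := (Fin d → ℂ) × ℝ

/-- `|z| = (∑ |z_j|²)^{1/2}`, the Euclidean length of the horizontal component of `p = (z, t)`. -/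
noncomputable def absZ {d : ℕ} (p : Space d) : ℝ := √(∑ j, ‖p.1 j‖ ^ 2)

/-- The Koranyi norm `|(z, t)|_ℍ = (|z|⁴ + t²)^{1/4}`. -/
noncomputable def koranyi {d : ℕ} (p : Space d) : ℝ := (absZ p ^ 4 + p.2 ^ 2) ^ (1 / 4 : ℝ)

/-- The horizontal left-invariant vector fields, as functions giving the direction at each point:
`Sum.inl j` is `X_j = ∂_{x_j} + 2 y_j ∂_t` and `Sum.inr j` is `Y_j = ∂_{y_j} - 2 x_j ∂_t`. -/
noncomputable def horizontalField {d : ℕ} : Fin d ⊕ Fin d → Space d → Space d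
  | Sum.inl j, p => (Pi.single j 1, 2 * (p.1 j).im)
  | Sum.inr j, p => (Pi.single j Complex.I, -(2 * (p.1 j).re))

/-- `g` is the weak (distributional) derivative of `u` along the `k`-th horizontal field: these
fields are divergence free, so integration by parts against a test function carries only a sign. -/
def IsWeakDeriv {d : ℕ} (k : Fin d ⊕ Fin d) (u g : Space d → ℂ) : Prop :=
  ∀ φ : Space d → ℂ, ContDiff ℝ ∞ φ → HasCompactSupport φ →
    ∫ p, u p * fderiv ℝ φ p (horizontalField k p) = -∫ p, g p * φ p

/-- The Sobolev space `H¹(ℍ^d)`: a function `u ∈ L²` together with its weak horizontal gradient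
`∇_ℍ u = (X_1 u, …, X_d u, Y_1 u, …, Y_d u) ∈ L²` (determined by `u` up to null sets). -/
structure H1 (d : ℕ) where
  /-- the function `u` -/
  fn : Space d → ℂ
  /-- the components of `∇_ℍ u` -/
  grad : Fin d ⊕ Fin d → Space d → ℂ
  memLp_fn : MemLp fn 2 volume
  memLp_grad : ∀ k, MemLp (grad k) 2 volume
  isWeakDeriv : ∀ k, IsWeakDeriv k fn (grad k)

/-- The Dirichlet energy `∫ |∇_ℍ ψ|²`. -/
noncomputable def energy {d : ℕ} (ψ : H1 d) : ENNReal := ∫⁻ p, ∑ k, ‖ψ.grad k p‖ₑ ^ 2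

/-- `V` is form-subordinated to the sublaplacian with bound less than one:
`∫ |V| |ψ|² ≤ a ∫ |∇_ℍ ψ|²` for some `a < 1` and all `ψ ∈ H¹(ℍ^d)`. -/
def FormSubordinate {d : ℕ} (V : Space d → ℂ) : Prop :=
  ∃ a : ℝ, a < 1 ∧ ∀ ψ : H1 d,
    ∫⁻ p, ‖V p‖ₑ * ‖ψ.fn p‖ₑ ^ 2 ≤ ENNReal.ofReal a * energy ψ

/-- Membership of `ψ ∈ H¹(ℍ^d)` in the domain of the form `q = q₀ + q_V`, that is
`∫ |V| |ψ|² < ∞`. -/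
def InFormDomain {d : ℕ} (V : Space d → ℂ) (ψ : H1 d) : Prop :=
  ∫⁻ p, ‖V p‖ₑ * ‖ψ.fn p‖ₑ ^ 2 < ⊤

/-- The sesquilinear form of `𝓛 + V`,
`q(u, v) = ∫ ∇_ℍ u · conj (∇_ℍ v) + ∫ V u conj v`; on the diagonal it is
`∫ |∇_ℍ u|² + ∫ V |u|²`. -/
noncomputable def form {d : ℕ} (V : Space d → ℂ) (u v : H1 d) : ℂ :=
  (∫ p, ∑ k, u.grad k p * conj (v.grad k p)) + ∫ p, V p * u.fn p * conj (v.fn p)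

/-- The graph of the operator `𝓛 + V` in `L²(ℍ^d)` associated with the form `q`: `u` is in the
operator domain and `(𝓛 + V) u = w` when `u` is in the form domain, `w ∈ L²` and
`q(u, v) = ⟨w, v⟩_{L²}` for all `v` in the form domain. -/
def OperatorGraph {d : ℕ} (V : Space d → ℂ) (u : H1 d) (w : Space d → ℂ) : Prop :=
  InFormDomain V u ∧ MemLp w 2 volume ∧
    ∀ v : H1 d, InFormDomain V v → form V u v = ∫ p, w p * conj (v.fn p)

/-- `u` is an eigenfunction of `𝓛 + V` with eigenvalue `lam`:
`u ≠ 0` in `L²` and `(𝓛 + V) u = lam u`. -/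
def IsEigenfunction {d : ℕ} (V : Space d → ℂ) (lam : ℂ) (u : H1 d) : Prop :=
  ¬ u.fn =ᵐ[volume] 0 ∧ OperatorGraph V u (fun p => lam * u.fn p)

/-- `g` is radial: `g(z, t) = g₀(|(z, t)|_ℍ)` (almost everywhere, as `g` is an element of `L²`).
Only the values of `g₀` on `[0, ∞)` matter. -/
def IsRadial {d : ℕ} (g : Space d → ℂ) : Prop :=
  ∃ g₀ : ℝ → ℂ, g =ᵐ[volume] fun p => g₀ (koranyi p)

/-- `K_d(δ)`: the minimum over `γ > 0` of
`(8d + 2 + γ√δ)/(4d) + √((8d + 2 + γ√δ)²/(16d²) + √δ/(2γ))`. For `d ≥ 1` and `δ > 0` this function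
of `γ` is positive, continuous and tends to infinity at both ends, so the infimum is attained. -/
noncomputable def constK (d : ℕ) (δ : ℝ) : ℝ :=
  sInf ((fun γ : ℝ => (8 * d + 2 + γ * √δ) / (4 * d)
    + √((8 * d + 2 + γ * √δ) ^ 2 / (16 * (d : ℝ) ^ 2) + √δ / (2 * γ))) '' Set.Ioi 0)

/-- `κ_d`: the minimum over `δ > 0` of `max {(1 + 1/δ)/d², K_d(δ)/d}`. For `d ≥ 1` the first entry
decreases from infinity and the second increases to infinity, so the infimum is attained. -/
noncomputable def kappa (d : ℕ) : ℝ :=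
  sInf ((fun δ : ℝ => max ((1 + 1 / δ) / (d : ℝ) ^ 2) (constK d δ / d)) '' Set.Ioi 0)

end Heisenberg

/-! Write G = |z|⁴ + t² (`gauge`), τ = log G (`logGauge`) and s = |z|²/√G (`slope`); s is invariant
under dilations and lies in [0, 1]. In polar coordinates Lebesgue measure is e^{(d+1)τ/2} dτ times
an angular measure, and the angle enters only through the moments m_j of s. For a radial
eigenfunction u = g(τ) with energy E, put N = ∫ e^{(d+1)τ/2}|g|² and H = ∫ e^{dτ/2}|g|². Then ‖u‖² =
m₀N and ∫ (|z|²/G)|u|² = m₁H.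

The key fact is that the horizontal gradients of s and G are orthogonal. Testing the equation with
s^{j+1}χ(τ) therefore gives a gradient term equal to m_{j+2} times a functional of χ independent of
j (`integral_grad_slope_mul`). The combination m₄s − m₂s³ (`eliminant`) cancels it, and (V − λ)u
times this combination is orthogonal to every function of τ. Pairing with the conjugate of g yields
∫ V|u|²(m₄s − m₂s³) = λcN with c = m₄m₁ − m₂m₃ > 0 (`eliminated_equation`). So the potential alone
controls |λ|N, for any complex λ, while testing with u gives E ≤ |λ|m₀N + |∫ V|u|²|.

Both potential integrals are estimated by Cauchy–Schwarz with the weight |z|²/G (`potential_bound`)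
and the radial Hardy inequality d²m₁H ≤ E (`hardy_radial`). The second is at most bE/d; by
`moment_inequality`, m₀ times the first is at most 4bcE. Hence E ≤ b(4 + 1/d)E. On the other hand
κ_d ≥ (4d+1)/d² (`kappa_ge`), so b(4d+1) < d. This forces E = 0, and Hardy gives u = 0.

The moment inequality comes from a recurrence between m_j and m_{j+2} (the divergence theorem),
which reduces all moments to m₀ and m₁, and from m₂² ≤ m₁m₃, which compares these two. What remains
is a polynomial inequality in d ≥ 1.

Since g need not be differentiable, all derivatives are kept on test functions of τ. In particular
Hardy's inequality is proved by duality on the line (`dual_hardy`). -/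

namespace Heisenberg

variable {d : ℕ}

/-! ### The horizontal derivatives of `|z|²` and `|z|⁴ + t²` -/

/-- `|z|²` -/
noncomputable def sqZ (p : Space d) : ℝ := ∑ j, ((p.1 j).re ^ 2 + (p.1 j).im ^ 2)

/-- The fourth power `|z|⁴ + t²` of the Koranyi norm. -/
noncomputable def gauge (p : Space d) : ℝ := sqZ p ^ 2 + p.2 ^ 2

/-- Derivative along the `k`-th horizontal field. -/
noncomputable def hDeriv {F : Type*} [NormedAddCommGroup F] [NormedSpace ℝ F]
    (k : Fin d ⊕ Fin d) (f : Space d → F) (p : Space d) : F :=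
  fderiv ℝ f p (horizontalField k p)

/-- The horizontal derivatives of `|z|²`. -/
noncomputable def hSqZ : Fin d ⊕ Fin d → Space d → ℝ
  | Sum.inl j, p => 2 * (p.1 j).re
  | Sum.inr j, p => 2 * (p.1 j).im

/-- The horizontal derivatives of `|z|⁴ + t²`. -/
noncomputable def hGauge : Fin d ⊕ Fin d → Space d → ℝ
  | Sum.inl j, p => 4 * sqZ p * (p.1 j).re + 4 * p.2 * (p.1 j).im
  | Sum.inr j, p => 4 * sqZ p * (p.1 j).im - 4 * p.2 * (p.1 j).re

/-- The coordinate `x_j` as a continuous linear map. -/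
noncomputable def reL (j : Fin d) : Space d →L[ℝ] ℝ :=
  Complex.reCLM ∘L ContinuousLinearMap.proj (R := ℝ) (φ := fun _ : Fin d => ℂ) j ∘L
    ContinuousLinearMap.fst ℝ (Fin d → ℂ) ℝ

/-- The coordinate `y_j` as a continuous linear map. -/
noncomputable def imL (j : Fin d) : Space d →L[ℝ] ℝ :=
  Complex.imCLM ∘L ContinuousLinearMap.proj (R := ℝ) (φ := fun _ : Fin d => ℂ) j ∘L
    ContinuousLinearMap.fst ℝ (Fin d → ℂ) ℝ

@[simp] lemma reL_apply (j : Fin d) (p : Space d) : reL j p = (p.1 j).re := rfl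
@[simp] lemma imL_apply (j : Fin d) (p : Space d) : imL j p = (p.1 j).im := rfl

lemma hasFDerivAt_re (j : Fin d) (p : Space d) :
    HasFDerivAt (fun p : Space d => (p.1 j).re) (reL j) p := (reL j).hasFDerivAt

lemma hasFDerivAt_im (j : Fin d) (p : Space d) :
    HasFDerivAt (fun p : Space d => (p.1 j).im) (imL j) p := (imL j).hasFDerivAt

lemma contDiff_re (j : Fin d) : ContDiff ℝ ∞ (fun p : Space d => (p.1 j).re) :=
  (reL j).contDiff

lemma contDiff_im (j : Fin d) : ContDiff ℝ ∞ (fun p : Space d => (p.1 j).im) :=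
  (imL j).contDiff

lemma contDiff_sqZ : ContDiff ℝ ∞ (sqZ : Space d → ℝ) := by
  unfold sqZ
  exact ContDiff.sum fun j _ => ((contDiff_re j).pow 2).add ((contDiff_im j).pow 2)

lemma contDiff_gauge : ContDiff ℝ ∞ (gauge : Space d → ℝ) := by
  unfold gauge
  exact (contDiff_sqZ.pow 2).add (contDiff_snd.pow 2)

lemma contDiff_horizontalField (k : Fin d ⊕ Fin d) :
    ContDiff ℝ ∞ (horizontalField k : Space d → Space d) := by
  rcases k with j | j
  · exact contDiff_const.prodMk (contDiff_const.mul (contDiff_im j))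
  · exact contDiff_const.prodMk (contDiff_const.mul (contDiff_re j)).neg

lemma contDiff_hSqZ (k : Fin d ⊕ Fin d) : ContDiff ℝ ∞ (hSqZ k) := by
  rcases k with j | j
  · exact contDiff_const.mul (contDiff_re j)
  · exact contDiff_const.mul (contDiff_im j)

lemma contDiff_hGauge (k : Fin d ⊕ Fin d) : ContDiff ℝ ∞ (hGauge k) := by
  rcases k with j | j
  · exact ((contDiff_const.mul contDiff_sqZ).mul (contDiff_re j)).add
      ((contDiff_const.mul contDiff_snd).mul (contDiff_im j))
  · exact ((contDiff_const.mul contDiff_sqZ).mul (contDiff_im j)).sub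
      ((contDiff_const.mul contDiff_snd).mul (contDiff_re j))

lemma sqZ_nonneg (p : Space d) : 0 ≤ sqZ p := Finset.sum_nonneg fun _ _ => by positivity

lemma gauge_nonneg (p : Space d) : 0 ≤ gauge p := by unfold gauge; positivity

section hDeriv

variable {F : Type*} [NormedAddCommGroup F] [NormedSpace ℝ F]

lemma contDiff_hDeriv {k : Fin d ⊕ Fin d} {f : Space d → F} (hf : ContDiff ℝ ∞ f) :
    ContDiff ℝ ∞ (hDeriv k f) :=
  (hf.fderiv_right (m := ∞) (by simp)).clm_apply (contDiff_horizontalField k)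

lemma hasCompactSupport_hDeriv {k : Fin d ⊕ Fin d} {f : Space d → F} (hf : HasCompactSupport f) :
    HasCompactSupport (hDeriv k f) :=
  (hf.fderiv (𝕜 := ℝ)).mono (fun p hp => by
    contrapose! hp; simp only [Function.mem_support, not_not] at hp ⊢; simp [hDeriv, hp])

end hDeriv

lemma hDeriv_mul {k : Fin d ⊕ Fin d} {f g : Space d → ℝ} {p : Space d}
    (hf : DifferentiableAt ℝ f p) (hg : DifferentiableAt ℝ g p) :
    hDeriv k (fun p => f p * g p) p = f p * hDeriv k g p + hDeriv k f p * g p := by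
  simp only [hDeriv, fderiv_fun_mul hf hg, add_apply,
    smul_apply, smul_eq_mul]
  ring

lemma hDeriv_comp {k : Fin d ⊕ Fin d} {f : Space d → ℝ} {φ : ℝ → ℝ} {φ' : ℝ} {p : Space d}
    (hφ : HasDerivAt φ φ' (f p)) (hf : DifferentiableAt ℝ f p) :
    hDeriv k (fun p => φ (f p)) p = φ' * hDeriv k f p := by
  have := (hφ.comp_hasFDerivAt p hf.hasFDerivAt).fderiv
  simp only [hDeriv]
  rw [show (fun p => φ (f p)) = φ ∘ f from rfl, this]
  simp

lemma hDeriv_re (k : Fin d ⊕ Fin d) (i : Fin d) (p : Space d) :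
    hDeriv k (fun p : Space d => (p.1 i).re) p = if k = Sum.inl i then 1 else 0 := by
  rw [hDeriv, (hasFDerivAt_re i p).fderiv]
  rcases k with j | j
  · by_cases h : j = i
    · subst h; simp [horizontalField]
    · simp [horizontalField, h, Ne.symm h]
  · by_cases h : j = i
    · subst h; simp [horizontalField]
    · simp [horizontalField, Ne.symm h]

lemma hDeriv_im (k : Fin d ⊕ Fin d) (i : Fin d) (p : Space d) :
    hDeriv k (fun p : Space d => (p.1 i).im) p = if k = Sum.inr i then 1 else 0 := by
  rw [hDeriv, (hasFDerivAt_im i p).fderiv]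
  rcases k with j | j
  · by_cases h : j = i
    · subst h; simp [horizontalField]
    · simp [horizontalField, Ne.symm h]
  · by_cases h : j = i
    · subst h; simp [horizontalField]
    · simp [horizontalField, h, Ne.symm h]

lemma hDeriv_snd (k : Fin d ⊕ Fin d) (p : Space d) :
    hDeriv k (fun p : Space d => p.2) p = (horizontalField k p).2 := by
  rw [hDeriv, fderiv_snd]; rfl

lemma hDeriv_add {k : Fin d ⊕ Fin d} {f g : Space d → ℝ} {p : Space d}
    (hf : DifferentiableAt ℝ f p) (hg : DifferentiableAt ℝ g p) :
    hDeriv k (fun p => f p + g p) p = hDeriv k f p + hDeriv k g p := by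
  simp [hDeriv, fderiv_fun_add hf hg]

lemma hDeriv_sub {k : Fin d ⊕ Fin d} {f g : Space d → ℝ} {p : Space d}
    (hf : DifferentiableAt ℝ f p) (hg : DifferentiableAt ℝ g p) :
    hDeriv k (fun p => f p - g p) p = hDeriv k f p - hDeriv k g p := by
  simp [hDeriv, fderiv_fun_sub hf hg]

lemma hDeriv_const_mul {k : Fin d ⊕ Fin d} {f : Space d → ℝ} {p : Space d} (c : ℝ)
    (hf : DifferentiableAt ℝ f p) :
    hDeriv k (fun p => c * f p) p = c * hDeriv k f p := by
  simp [hDeriv, fderiv_const_mul hf]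

lemma hDeriv_pow {k : Fin d ⊕ Fin d} {f : Space d → ℝ} {p : Space d} (n : ℕ)
    (hf : DifferentiableAt ℝ f p) :
    hDeriv k (fun p => f p ^ n) p = n * f p ^ (n - 1) * hDeriv k f p :=
  hDeriv_comp (φ := fun x => x ^ n) (hasDerivAt_pow n _) hf

@[fun_prop]
lemma differentiable_re (j : Fin d) : Differentiable ℝ (fun p : Space d => (p.1 j).re) :=
  (contDiff_re j).differentiable (by simp)

@[fun_prop]
lemma differentiable_im (j : Fin d) : Differentiable ℝ (fun p : Space d => (p.1 j).im) :=
  (contDiff_im j).differentiable (by simp)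

@[fun_prop]
lemma differentiable_sqZ : Differentiable ℝ (sqZ : Space d → ℝ) :=
  contDiff_sqZ.differentiable (by simp)

@[fun_prop]
lemma differentiable_gauge : Differentiable ℝ (gauge : Space d → ℝ) :=
  contDiff_gauge.differentiable (by simp)

lemma hDeriv_sqZ (k : Fin d ⊕ Fin d) (p : Space d) : hDeriv k sqZ p = hSqZ k p := by
  have h1 : ∀ i, DifferentiableAt ℝ (fun p : Space d => (p.1 i).re ^ 2 + (p.1 i).im ^ 2) p :=
    fun i => ((differentiable_re i).pow 2 p).add ((differentiable_im i).pow 2 p)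
  have h2 : hDeriv k sqZ p
      = ∑ i, hDeriv k (fun p : Space d => (p.1 i).re ^ 2 + (p.1 i).im ^ 2) p := by
    simp only [hDeriv]
    rw [show (sqZ : Space d → ℝ) = fun p => ∑ i, ((p.1 i).re ^ 2 + (p.1 i).im ^ 2) from rfl,
      fderiv_fun_sum fun i _ => h1 i]
    simp
  rw [h2]
  have h3 : ∀ i, hDeriv k (fun p : Space d => (p.1 i).re ^ 2 + (p.1 i).im ^ 2) p
      = (if k = Sum.inl i then 2 * (p.1 i).re else 0)
        + (if k = Sum.inr i then 2 * (p.1 i).im else 0) := by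
    intro i
    rw [hDeriv_add (f := fun p : Space d => (p.1 i).re ^ 2) (g := fun p => (p.1 i).im ^ 2)
        (by fun_prop) (by fun_prop),
      hDeriv_pow 2 (differentiable_re i p), hDeriv_pow 2 (differentiable_im i p),
      hDeriv_re, hDeriv_im]
    split_ifs <;> simp
  simp_rw [h3, Finset.sum_add_distrib]
  rcases k with j | j <;> simp [hSqZ]

lemma hDeriv_gauge (k : Fin d ⊕ Fin d) (p : Space d) : hDeriv k gauge p = hGauge k p := by
  have h : hDeriv k gauge p = 2 * sqZ p * hSqZ k p + 2 * p.2 * (horizontalField k p).2 := by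
    rw [show (gauge : Space d → ℝ) = fun p => sqZ p ^ 2 + p.2 ^ 2 from rfl,
      hDeriv_add (f := fun p : Space d => sqZ p ^ 2) (g := fun p => p.2 ^ 2) (by fun_prop)
        (by fun_prop),
      hDeriv_pow 2 (differentiable_sqZ p), hDeriv_pow 2 (differentiable_snd p), hDeriv_sqZ,
      hDeriv_snd]
    simp
  rw [h]
  rcases k with j | j <;> simp [hSqZ, hGauge, horizontalField] <;> ring

lemma sum_hSqZ_hSqZ (p : Space d) : ∑ k, hSqZ k p * hSqZ k p = 4 * sqZ p := by
  simp only [Fintype.sum_sum_type, hSqZ, sqZ, Finset.mul_sum, ← Finset.sum_add_distrib]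
  exact Finset.sum_congr rfl fun i _ => by ring

lemma sum_hSqZ_hGauge (p : Space d) : ∑ k, hSqZ k p * hGauge k p = 8 * sqZ p ^ 2 := by
  simp only [Fintype.sum_sum_type, hSqZ, hGauge, ← Finset.sum_add_distrib]
  rw [show 8 * sqZ p ^ 2 = (8 * sqZ p) * ∑ j, ((p.1 j).re ^ 2 + (p.1 j).im ^ 2) by
    rw [← sqZ]; ring, Finset.mul_sum]
  exact Finset.sum_congr rfl fun i _ => by ring

/-- With A = 4|z|² and B = 4t, each index contributes (Ax + By)² + (Ay − Bx)² = (A² + B²)(x² + y²),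
so the cross terms cancel. -/
lemma sum_hGauge_hGauge (p : Space d) :
    ∑ k, hGauge k p * hGauge k p = 16 * sqZ p * gauge p := by
  simp only [Fintype.sum_sum_type, hGauge, ← Finset.sum_add_distrib]
  rw [show 16 * sqZ p * gauge p = (16 * gauge p) * ∑ j, ((p.1 j).re ^ 2 + (p.1 j).im ^ 2) by
    rw [← sqZ]; ring, Finset.mul_sum]
  exact Finset.sum_congr rfl fun i _ => by simp only [gauge]; ring

lemma sum_hDeriv_hSqZ (p : Space d) : ∑ k, hDeriv k (hSqZ k) p = 4 * d := by
  have h : ∀ k : Fin d ⊕ Fin d, hDeriv k (hSqZ k) p = 2 := by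
    rintro (j | j)
    · rw [show hSqZ (Sum.inl j) = fun p : Space d => 2 * (p.1 j).re from rfl,
        hDeriv_const_mul _ (differentiable_re j p), hDeriv_re]; simp
    · rw [show hSqZ (Sum.inr j) = fun p : Space d => 2 * (p.1 j).im from rfl,
        hDeriv_const_mul _ (differentiable_im j p), hDeriv_im]; simp
  simp [h]; ring

/-- Since X_j t = 2y_j and Y_j t = −2x_j, differentiating the factor t completes x_j² or y_j² to
|z_j|². Each of the 2d fields thus gives 4|z|² + 8|z_j|². -/
lemma sum_hDeriv_hGauge (p : Space d) : ∑ k, hDeriv k (hGauge k) p = 8 * (d + 2) * sqZ p := by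
  have h : ∀ k : Fin d ⊕ Fin d, hDeriv k (hGauge k) p
      = 4 * sqZ p + 8 * match k with
        | Sum.inl j => (p.1 j).re ^ 2 + (p.1 j).im ^ 2
        | Sum.inr j => (p.1 j).re ^ 2 + (p.1 j).im ^ 2 := by
    rintro (j | j)
    · rw [show hGauge (Sum.inl j) = fun p : Space d =>
        (4 * sqZ p) * (p.1 j).re + (4 * p.2) * (p.1 j).im from rfl,
        hDeriv_add (f := fun p : Space d => (4 * sqZ p) * (p.1 j).re)
          (g := fun p => (4 * p.2) * (p.1 j).im) (by fun_prop) (by fun_prop),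
        hDeriv_mul (f := fun p : Space d => 4 * sqZ p) (by fun_prop) (differentiable_re j p),
        hDeriv_mul (f := fun p : Space d => 4 * p.2) (by fun_prop) (differentiable_im j p),
        hDeriv_const_mul _ (differentiable_sqZ p), hDeriv_const_mul _ (differentiable_snd p),
        hDeriv_re, hDeriv_im, hDeriv_sqZ, hDeriv_snd]
      simp [hSqZ, horizontalField]; ring
    · rw [show hGauge (Sum.inr j) = fun p : Space d =>
        (4 * sqZ p) * (p.1 j).im - (4 * p.2) * (p.1 j).re from rfl,
        hDeriv_sub (f := fun p : Space d => (4 * sqZ p) * (p.1 j).im)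
          (g := fun p => (4 * p.2) * (p.1 j).re) (by fun_prop) (by fun_prop),
        hDeriv_mul (f := fun p : Space d => 4 * sqZ p) (by fun_prop) (differentiable_im j p),
        hDeriv_mul (f := fun p : Space d => 4 * p.2) (by fun_prop) (differentiable_re j p),
        hDeriv_const_mul _ (differentiable_sqZ p), hDeriv_const_mul _ (differentiable_snd p),
        hDeriv_re, hDeriv_im, hDeriv_sqZ, hDeriv_snd]
      simp [hSqZ, horizontalField]; ring
  have e : ∑ j, ((p.1 j).re ^ 2 + (p.1 j).im ^ 2) = sqZ p := rfl
  simp only [Fintype.sum_sum_type, h, Finset.sum_add_distrib, ← Finset.mul_sum] at e ⊢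
  rw [e]
  simp
  ring

/-! ### Integration by parts -/

instance : (volume : Measure (Fin d → ℂ)).IsAddHaarMeasure :=
  inferInstanceAs (Measure.pi fun _ : Fin d => (volume : Measure ℂ)).IsAddHaarMeasure

instance : (volume : Measure (Space d)).IsAddHaarMeasure :=
  inferInstanceAs ((volume : Measure (Fin d → ℂ)).prod (volume : Measure ℝ)).IsAddHaarMeasure

lemma integral_fderiv_eq_zero {g : Space d → ℂ} (hg : ContDiff ℝ ∞ g) (hc : HasCompactSupport g)
    (v : Space d) :
    Integrable (fun p => fderiv ℝ g p v) volume ∧ ∫ p, fderiv ℝ g p v = 0 := by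
  have hi : Integrable (fun p => fderiv ℝ g p v) volume :=
    ((hg.continuous_fderiv (by simp)).clm_apply continuous_const).integrable_of_hasCompactSupport
      ((hc.fderiv (𝕜 := ℝ)).mono fun p hp => by
        contrapose! hp; simp only [Function.mem_support, not_not] at hp ⊢; simp [hp])
  refine ⟨hi, ?_⟩
  have := integral_mul_fderiv_eq_neg_fderiv_mul_of_integrable (μ := (volume : Measure (Space d)))
    (f := fun _ => (1 : ℂ)) (g := g) (v := v) (by simp) (by simpa using hi)
    (by simpa using hg.continuous.integrable_of_hasCompactSupport hc)
    (fun x _ => differentiableAt_const _) (fun x _ => (hg.differentiable (by simp)) x)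
  simpa using this

/-- The coefficient of ∂_t does not depend on t. This is what makes the fields divergence free and
reduces integration by parts to constant directions. -/
lemma exists_horizontalField_eq (k : Fin d ⊕ Fin d) :
    ∃ (v : Space d) (ℓ : Space d →L[ℝ] ℝ),
      (∀ p, horizontalField k p = v + ℓ p • ((0, 1) : Space d)) ∧ ℓ (0, 1) = 0 := by
  rcases k with j | j
  · exact ⟨(Pi.single j 1, 0), (2 : ℝ) • imL j, fun p => by simp [horizontalField], by simp⟩
  · exact ⟨(Pi.single j Complex.I, 0), (-2 : ℝ) • reL j, fun p => by simp [horizontalField],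
      by simp⟩

lemma integral_hDeriv_eq_zero (k : Fin d ⊕ Fin d) {f : Space d → ℂ} (hf : ContDiff ℝ ∞ f)
    (hc : HasCompactSupport f) : ∫ p, hDeriv k f p = 0 := by
  have hdf : Differentiable ℝ f := hf.differentiable (by simp)
  obtain ⟨v, ℓ, hℓ, hℓ'⟩ := exists_horizontalField_eq k
  have hs : ContDiff ℝ ∞ (fun p => ℓ p • f p) := ℓ.contDiff.smul hf
  have h2 := integral_fderiv_eq_zero hs (HasCompactSupport.smul_left (f := fun p => ℓ p) hc) (0, 1)
  have h1 := integral_fderiv_eq_zero hf hc v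
  have : ∀ p, hDeriv k f p = fderiv ℝ f p v + fderiv ℝ (fun p => ℓ p • f p) p (0, 1) := by
    intro p
    rw [fderiv_fun_smul ℓ.differentiableAt (hdf p), ContinuousLinearMap.fderiv]
    simp only [hDeriv, hℓ, map_add, map_smul, add_apply, smul_apply,
      ContinuousLinearMap.smulRight_apply, hℓ', zero_smul, add_zero]
  simp_rw [this]
  rw [integral_add h1.1 h2.1, h1.2, h2.2, add_zero]

lemma hDeriv_mul_complex {k : Fin d ⊕ Fin d} {f g : Space d → ℂ} {p : Space d}
    (hf : DifferentiableAt ℝ f p) (hg : DifferentiableAt ℝ g p) :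
    hDeriv k (fun p => f p * g p) p = f p * hDeriv k g p + hDeriv k f p * g p := by
  simp only [hDeriv, fderiv_fun_mul hf hg, add_apply,
    smul_apply, smul_eq_mul]
  ring

lemma hDeriv_ofReal {k : Fin d ⊕ Fin d} {f : Space d → ℝ} {p : Space d}
    (hf : DifferentiableAt ℝ f p) :
    hDeriv k (fun p => (f p : ℂ)) p = (hDeriv k f p : ℝ) := by
  have := (Complex.ofRealCLM.hasFDerivAt.comp p hf.hasFDerivAt).fderiv
  simp only [hDeriv]
  rw [show (fun p => (f p : ℂ)) = Complex.ofRealCLM ∘ f from rfl, this]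
  simp

lemma contDiff_ofReal_comp {f : Space d → ℝ} (hf : ContDiff ℝ ∞ f) :
    ContDiff ℝ ∞ (fun p => (f p : ℂ)) := Complex.ofRealCLM.contDiff.comp hf

lemma hasCompactSupport_ofReal_comp {f : Space d → ℝ} (hf : HasCompactSupport f) :
    HasCompactSupport (fun p => (f p : ℂ)) := hf.comp_left (g := Complex.ofReal) rfl

lemma isWeakDeriv_of_contDiff (k : Fin d ⊕ Fin d) {v : Space d → ℂ} (hv : ContDiff ℝ ∞ v) :
    IsWeakDeriv k v (hDeriv k v) := by
  intro φ hφ hc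
  have h := integral_hDeriv_eq_zero k (hv.mul hφ) hc.mul_left
  have e : hDeriv k (fun p => v p * φ p) = fun p => v p * hDeriv k φ p + hDeriv k v p * φ p :=
    funext fun p => hDeriv_mul_complex (hv.differentiable (by simp) p)
      (hφ.differentiable (by simp) p)
  rw [e, integral_add] at h
  · exact eq_neg_of_add_eq_zero_left h
  · exact (hv.continuous.mul (contDiff_hDeriv hφ).continuous).integrable_of_hasCompactSupport
      (hasCompactSupport_hDeriv hc).mul_left
  · exact ((contDiff_hDeriv hv).continuous.mul hφ.continuous).integrable_of_hasCompactSupport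
      hc.mul_left

/-- Real test functions are elements of `H¹`. -/
noncomputable def H1.ofTest (v : Space d → ℝ) (hv : ContDiff ℝ ∞ v) (hc : HasCompactSupport v) :
    H1 d where
  fn p := v p
  grad k p := (hDeriv k v p : ℝ)
  memLp_fn := (contDiff_ofReal_comp hv).continuous.memLp_of_hasCompactSupport
    (hasCompactSupport_ofReal_comp hc)
  memLp_grad k := (contDiff_ofReal_comp (contDiff_hDeriv hv)).continuous.memLp_of_hasCompactSupport
    (hasCompactSupport_ofReal_comp (hasCompactSupport_hDeriv hc))
  isWeakDeriv k := by
    have := isWeakDeriv_of_contDiff k (contDiff_ofReal_comp hv)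
    rwa [show hDeriv k (fun p => (v p : ℂ)) = fun p => ((hDeriv k v p : ℝ) : ℂ) from
      funext fun p => hDeriv_ofReal (hv.differentiable (by simp) p)] at this

/-- A horizontal field `∑ₖ aₖ Xₖ` with smooth coefficients is integrated by parts. -/
lemma sum_grad_mul_eq {u : Space d → ℂ} {gr : Fin d ⊕ Fin d → Space d → ℂ}
    (hu : LocallyIntegrable u volume) (hgr : ∀ k, LocallyIntegrable (gr k) volume)
    (hw : ∀ k, IsWeakDeriv k u (gr k)) {a : Fin d ⊕ Fin d → Space d → ℝ}
    (ha : ∀ k, ContDiff ℝ ∞ (a k)) {f : Space d → ℝ} (hf : ContDiff ℝ ∞ f)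
    (hc : HasCompactSupport f) :
    ∫ p, (∑ k, gr k p * a k p) * f p
      = -∫ p, u p * ((∑ k, (a k p * hDeriv k f p + hDeriv k (a k) p * f p) : ℝ) : ℂ) := by
  have hder : ∀ k, hDeriv k (fun p => ((a k p * f p : ℝ) : ℂ))
      = fun p => ((a k p * hDeriv k f p + hDeriv k (a k) p * f p : ℝ) : ℂ) := fun k => by
    funext p
    rw [hDeriv_ofReal (f := fun p => a k p * f p)
      (((ha k).mul hf).differentiable (by simp) p),
      hDeriv_mul ((ha k).differentiable (by simp) p) (hf.differentiable (by simp) p)]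
  have hsm : ∀ k, ContDiff ℝ ∞ (fun p => ((a k p * f p : ℝ) : ℂ)) := fun k =>
    contDiff_ofReal_comp ((ha k).mul hf)
  have hcc : ∀ k, HasCompactSupport (fun p => ((a k p * f p : ℝ) : ℂ)) := fun k =>
    hasCompactSupport_ofReal_comp hc.mul_left
  have h1 : ∀ k, Integrable (fun p => gr k p * ((a k p * f p : ℝ) : ℂ)) volume := fun k => by
    simpa [mul_comm] using
      (hgr k).integrable_smul_left_of_hasCompactSupport (hsm k).continuous (hcc k)
  have h2 : ∀ k, Integrable (fun p => u p *
      ((a k p * hDeriv k f p + hDeriv k (a k) p * f p : ℝ) : ℂ)) volume := fun k => by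
    have := hu.integrable_smul_left_of_hasCompactSupport
      (contDiff_hDeriv (k := k) (hsm k)).continuous (hasCompactSupport_hDeriv (hcc k))
    rw [hder k] at this
    simpa [mul_comm] using this
  calc ∫ p, (∑ k, gr k p * a k p) * f p
      = ∫ p, ∑ k, gr k p * ((a k p * f p : ℝ) : ℂ) := by
        congr 1; funext p; rw [Finset.sum_mul]; push_cast
        exact Finset.sum_congr rfl fun k _ => by ring
    _ = ∑ k, ∫ p, gr k p * ((a k p * f p : ℝ) : ℂ) := integral_finsetSum _ fun k _ => h1 k
    _ = ∑ k, -∫ p, u p * ((a k p * hDeriv k f p + hDeriv k (a k) p * f p : ℝ) : ℂ) := by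
        refine Finset.sum_congr rfl fun k _ => ?_
        have := hw k _ (hsm k) (hcc k)
        change ∫ p, u p * hDeriv k (fun p => ((a k p * f p : ℝ) : ℂ)) p = _ at this
        rw [hder k] at this
        rw [this, neg_neg]
    _ = _ := by
        rw [Finset.sum_neg_distrib, ← integral_finsetSum _ fun k _ => h2 k]
        congr 2; funext p; rw [← Finset.mul_sum]; push_cast; rfl


/-! ### Radial test functions -/

/-- Real test functions of one real variable. -/
def IsTest (χ : ℝ → ℝ) : Prop := ContDiff ℝ ∞ χ ∧ HasCompactSupport χ

/-- The function `χ ∘ log`, extended by zero. -/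
noncomputable def lift (χ : ℝ → ℝ) (b : ℝ) : ℝ := if 0 < b then χ (Real.log b) else 0

lemma lift_of_pos {χ : ℝ → ℝ} {b : ℝ} (hb : 0 < b) : lift χ b = χ (Real.log b) := if_pos hb

lemma IsTest.isTest_deriv {χ : ℝ → ℝ} (h : IsTest χ) : IsTest (deriv χ) :=
  ⟨by simpa using h.1.iterate_deriv 1, h.2.deriv⟩

lemma IsTest.mul_left {χ θ : ℝ → ℝ} (h : IsTest χ) (hθ : ContDiff ℝ ∞ θ) :
    IsTest (fun τ => θ τ * χ τ) := ⟨hθ.mul h.1, h.2.mul_left⟩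

lemma contDiff_exp_mul (c : ℝ) : ContDiff ℝ ∞ (fun τ : ℝ => Real.exp (c * τ)) := by fun_prop

lemma IsTest.hasDerivAt {χ : ℝ → ℝ} (h : IsTest χ) (τ : ℝ) :
    HasDerivAt χ (deriv χ τ) τ := (h.1.differentiable (by simp) τ).hasDerivAt

lemma IsTest.continuous {χ : ℝ → ℝ} (h : IsTest χ) : Continuous χ := h.1.continuous

/-- The profile of the derivative of `lift χ`. -/
noncomputable def liftDeriv (χ : ℝ → ℝ) (τ : ℝ) : ℝ := Real.exp (-1 * τ) * deriv χ τ

lemma IsTest.isTest_liftDeriv {χ : ℝ → ℝ} (h : IsTest χ) : IsTest (liftDeriv χ) :=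
  h.isTest_deriv.mul_left (contDiff_exp_mul (-1))

lemma IsTest.exists_bound {χ : ℝ → ℝ} (h : IsTest χ) : ∃ R, 0 < R ∧ ∀ τ, R < |τ| → χ τ = 0 := by
  obtain ⟨R, hR0, hR⟩ := h.2.isBounded.exists_pos_norm_le
  refine ⟨R, hR0, fun τ hτ => ?_⟩
  by_contra hne
  exact absurd (hR τ (subset_tsupport _ hne)) (not_le.mpr hτ)

/-- Compact support in the logarithmic variable keeps the lifted function away from 0, so the
extension by zero is smooth. -/
lemma IsTest.lift_eventuallyEq_zero {χ : ℝ → ℝ} (h : IsTest χ) {b : ℝ} (hb : b ≤ 0) :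
    lift χ =ᶠ[nhds b] fun _ => 0 := by
  obtain ⟨R, hR0, hR⟩ := h.exists_bound
  filter_upwards [Iio_mem_nhds (hb.trans_lt (Real.exp_pos (-R)))] with x hx
  rw [lift]
  split_ifs with hx0
  · refine hR _ ?_
    have := (Real.log_lt_iff_lt_exp hx0).2 hx
    rw [abs_of_neg (by linarith)]; linarith
  · rfl

lemma lift_eventuallyEq_comp_log {χ : ℝ → ℝ} {b : ℝ} (hb : 0 < b) :
    lift χ =ᶠ[nhds b] fun x => χ (Real.log x) := by
  filter_upwards [Ioi_mem_nhds hb] with x hx using lift_of_pos hx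

lemma IsTest.contDiff_lift {χ : ℝ → ℝ} (h : IsTest χ) : ContDiff ℝ ∞ (lift χ) := by
  rw [contDiff_iff_contDiffAt]
  intro b
  rcases lt_or_ge 0 b with hb | hb
  · exact (h.1.contDiffAt.comp b (Real.contDiffAt_log.2 hb.ne')).congr_of_eventuallyEq
      (lift_eventuallyEq_comp_log hb)
  · exact contDiffAt_const.congr_of_eventuallyEq (h.lift_eventuallyEq_zero hb)

lemma IsTest.hasDerivAt_lift {χ : ℝ → ℝ} (h : IsTest χ) (b : ℝ) :
    HasDerivAt (lift χ) (lift (liftDeriv χ) b) b := by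
  rcases lt_or_ge 0 b with hb | hb
  · have := ((h.hasDerivAt (Real.log b)).comp b (Real.hasDerivAt_log hb.ne')).congr_of_eventuallyEq
      (lift_eventuallyEq_comp_log hb)
    refine this.congr_deriv ?_
    rw [lift_of_pos hb, liftDeriv, neg_one_mul, Real.exp_neg, Real.exp_log hb, mul_comm]
  · have := (hasDerivAt_const b (0 : ℝ)).congr_of_eventuallyEq (h.lift_eventuallyEq_zero hb)
    exact this.congr_deriv (if_neg (not_lt.mpr hb)).symm

lemma sqZ_sq_le_gauge (p : Space d) : sqZ p ^ 2 ≤ gauge p := by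
  unfold gauge; nlinarith [sq_nonneg p.2]

/-- A crude bound: only the boundedness of the sublevel sets matters. -/
lemma norm_le_of_gauge_le {p : Space d} {C : ℝ} (hC : gauge p ≤ C) : ‖p‖ ≤ C + 1 := by
  have h1 := sqZ_sq_le_gauge p
  have h2 : sqZ p ≤ (C + 1) / 2 + 0 := by nlinarith [sq_nonneg (sqZ p - 1)]
  have hC0 := gauge_nonneg p
  refine max_le ((pi_norm_le_iff_of_nonneg (by linarith)).2 fun j => ?_) ?_
  · have h3 : ‖p.1 j‖ ^ 2 ≤ sqZ p := by
      have : ‖p.1 j‖ ^ 2 = (p.1 j).re ^ 2 + (p.1 j).im ^ 2 := by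
        rw [Complex.sq_norm, Complex.normSq_apply]; ring
      rw [this]
      exact Finset.single_le_sum (f := fun j => (p.1 j).re ^ 2 + (p.1 j).im ^ 2)
        (fun _ _ => by positivity) (Finset.mem_univ j)
    nlinarith [sq_nonneg (‖p.1 j‖ - 1)]
  · have : p.2 ^ 2 ≤ C := by unfold gauge at hC; nlinarith [sq_nonneg (sqZ p)]
    rw [Real.norm_eq_abs, abs_le]
    constructor <;> nlinarith [sq_nonneg (p.2 - 1), sq_nonneg (p.2 + 1)]

/-- The function `|z|^{2j} φ(|z|⁴ + t²)` with `φ = lift χ`. -/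
noncomputable def radialTest (j : ℕ) (χ : ℝ → ℝ) (p : Space d) : ℝ := sqZ p ^ j * lift χ (gauge p)

lemma IsTest.contDiff_radialTest {χ : ℝ → ℝ} (h : IsTest χ) (j : ℕ) :
    ContDiff ℝ ∞ (radialTest j χ : Space d → ℝ) :=
  (contDiff_sqZ.pow j).mul (h.contDiff_lift.comp contDiff_gauge)

lemma IsTest.hasCompactSupport_radialTest {χ : ℝ → ℝ} (h : IsTest χ) (j : ℕ) :
    HasCompactSupport (radialTest j χ : Space d → ℝ) := by
  obtain ⟨R, hR0, hR⟩ := h.exists_bound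
  refine HasCompactSupport.intro (isCompact_closedBall 0 (Real.exp R + 1)) fun p hp => ?_
  have hg : Real.exp R < gauge p := by
    by_contra hle
    exact hp (by simpa using norm_le_of_gauge_le (not_lt.mp hle))
  have h0 : 0 < gauge p := (Real.exp_pos R).trans hg
  have h1 := (Real.lt_log_iff_exp_lt h0).2 hg
  rw [radialTest, lift_of_pos h0, hR _ (by rwa [abs_of_pos (by linarith)]), mul_zero]

lemma IsTest.hDeriv_radialTest {χ : ℝ → ℝ} (h : IsTest χ) (j : ℕ) (k : Fin d ⊕ Fin d)
    (p : Space d) :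
    hDeriv k (radialTest j χ) p = j * sqZ p ^ (j - 1) * lift χ (gauge p) * hSqZ k p
      + radialTest j (liftDeriv χ) p * hGauge k p := by
  have h1 : DifferentiableAt ℝ (fun p : Space d => lift χ (gauge p)) p :=
    (h.contDiff_lift.comp contDiff_gauge).differentiable (by simp) p
  rw [show (radialTest j χ : Space d → ℝ) = fun p => sqZ p ^ j * lift χ (gauge p)
    from rfl, hDeriv_mul (f := fun p : Space d => sqZ p ^ j) (by fun_prop) h1,
    hDeriv_pow j (differentiable_sqZ p), hDeriv_comp (h.hasDerivAt_lift _) (differentiable_gauge p),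
    hDeriv_sqZ, hDeriv_gauge, radialTest]
  ring

/-- The divergence of the field `radialTest j χ` ∇|z|². The scalar products of gradients only
produce powers of |z|², so the result is again a combination of functions `radialTest`. -/
lemma sum_hSqZ_hDeriv_radialTest {χ : ℝ → ℝ} (h : IsTest χ) (j : ℕ) (p : Space d) :
    ∑ k, (hSqZ k p * hDeriv k (radialTest j χ) p + hDeriv k (hSqZ k) p * radialTest j χ p)
      = (4 * j + 4 * d) * radialTest j χ p + 8 * radialTest (j + 2) (liftDeriv χ) p := by
  have e : ∀ k, hSqZ k p * hDeriv k (radialTest j χ) p + hDeriv k (hSqZ k) p * radialTest j χ p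
      = (j * sqZ p ^ (j - 1) * lift χ (gauge p)) * (hSqZ k p * hSqZ k p)
        + radialTest j (liftDeriv χ) p * (hSqZ k p * hGauge k p)
        + radialTest j χ p * hDeriv k (hSqZ k) p := fun k => by
    rw [h.hDeriv_radialTest]; ring
  simp_rw [e, Finset.sum_add_distrib, ← Finset.mul_sum]
  rw [sum_hSqZ_hSqZ, sum_hSqZ_hGauge, sum_hDeriv_hSqZ]
  -- The exponent j − 1 is truncated at j = 0, where the factor j removes the term.
  rcases j with _ | j <;> simp [radialTest] <;> ring

lemma sum_hGauge_hDeriv_radialTest {χ : ℝ → ℝ} (h : IsTest χ) (j : ℕ) (p : Space d) :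
    ∑ k, (hGauge k p * hDeriv k (radialTest j χ) p + hDeriv k (hGauge k) p * radialTest j χ p)
      = 8 * (j + d + 2) * radialTest (j + 1) χ p
        + 16 * gauge p * radialTest (j + 1) (liftDeriv χ) p := by
  have e : ∀ k, hGauge k p * hDeriv k (radialTest j χ) p
        + hDeriv k (hGauge k) p * radialTest j χ p
      = (j * sqZ p ^ (j - 1) * lift χ (gauge p)) * (hSqZ k p * hGauge k p)
        + radialTest j (liftDeriv χ) p * (hGauge k p * hGauge k p)
        + radialTest j χ p * hDeriv k (hGauge k) p := fun k => by
    rw [h.hDeriv_radialTest]; ring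
  simp_rw [e, Finset.sum_add_distrib, ← Finset.mul_sum]
  rw [sum_hSqZ_hGauge, sum_hGauge_hGauge, sum_hDeriv_hGauge]
  rcases j with _ | j <;> simp [radialTest] <;> ring

/-- A locally integrable function together with a locally integrable weak horizontal gradient. -/
structure WeakPair (u : Space d → ℂ) (gr : Fin d ⊕ Fin d → Space d → ℂ) : Prop where
  fn : LocallyIntegrable u volume
  grad : ∀ k, LocallyIntegrable (gr k) volume
  weak : ∀ k, IsWeakDeriv k u (gr k)

lemma WeakPair.integral_hSqZ {u : Space d → ℂ} {gr : Fin d ⊕ Fin d → Space d → ℂ}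
    (hu : WeakPair u gr) {χ : ℝ → ℝ} (h : IsTest χ) (j : ℕ) :
    ∫ p, (∑ k, gr k p * hSqZ k p) * radialTest j χ p
      = -∫ p, u p * (((4 * j + 4 * d) * radialTest j χ p
          + 8 * radialTest (j + 2) (liftDeriv χ) p : ℝ) : ℂ) := by
  rw [sum_grad_mul_eq hu.fn hu.grad hu.weak contDiff_hSqZ (h.contDiff_radialTest j)
    (h.hasCompactSupport_radialTest j)]
  simp_rw [sum_hSqZ_hDeriv_radialTest h]

lemma WeakPair.integral_hGauge {u : Space d → ℂ} {gr : Fin d ⊕ Fin d → Space d → ℂ}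
    (hu : WeakPair u gr) {χ : ℝ → ℝ} (h : IsTest χ) (j : ℕ) :
    ∫ p, (∑ k, gr k p * hGauge k p) * radialTest j χ p
      = -∫ p, u p * ((8 * (j + d + 2) * radialTest (j + 1) χ p
          + 16 * gauge p * radialTest (j + 1) (liftDeriv χ) p : ℝ) : ℂ) := by
  rw [sum_grad_mul_eq hu.fn hu.grad hu.weak contDiff_hGauge (h.contDiff_radialTest j)
    (h.hasCompactSupport_radialTest j)]
  simp_rw [sum_hGauge_hDeriv_radialTest h]

/-- The constant 1 is not in L², which is why the integral formulas ask only for local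
integrability. Applied to it, they give the recurrence of the moments. -/
lemma weakPair_one : WeakPair (fun _ : Space d => (1 : ℂ)) (fun _ _ => 0) where
  fn := continuous_const.locallyIntegrable
  grad _ := continuous_const.locallyIntegrable
  weak k φ hφ hc := by
    have := integral_hDeriv_eq_zero k hφ hc
    simpa [hDeriv] using this

lemma H1.weakPair (u : H1 d) : WeakPair u.fn u.grad where
  fn := u.memLp_fn.locallyIntegrable (by norm_num)
  grad k := (u.memLp_grad k).locallyIntegrable (by norm_num)
  weak := u.isWeakDeriv


/-! ### Polar coordinates adapted to the dilations -/

/-- Half of the exponent of the homogeneous growth of the volume, in the variable `|z|⁴ + t²`. -/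
noncomputable def growth (d : ℕ) : ℝ := (d + 1) / 2

/-- The dilations of the Heisenberg group, normalised so that `|z|⁴ + t²` is multiplied by
`exp τ`. -/
noncomputable def dil (τ : ℝ) (p : Space d) : Space d :=
  (Real.exp (τ / 4) • p.1, Real.exp (τ / 2) • p.2)

lemma sqZ_dil (τ : ℝ) (p : Space d) : sqZ (dil τ p) = Real.exp (τ / 2) * sqZ p := by
  have h : Real.exp (τ / 2) = Real.exp (τ / 4) ^ 2 := by
    rw [← Real.exp_nat_mul]; congr 1; push_cast; ring
  simp only [sqZ, dil, Finset.mul_sum, h, Pi.smul_apply, Complex.smul_re, Complex.smul_im,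
    smul_eq_mul]
  exact Finset.sum_congr rfl fun _ _ => by ring

lemma gauge_dil (τ : ℝ) (p : Space d) : gauge (dil τ p) = Real.exp τ * gauge p := by
  have h : Real.exp τ = Real.exp (τ / 2) ^ 2 := by
    rw [← Real.exp_nat_mul]; congr 1; push_cast; ring
  simp only [gauge, sqZ_dil, h]
  simp only [dil, smul_eq_mul]
  ring

lemma dil_neg_dil (τ : ℝ) (p : Space d) : dil (-τ) (dil τ p) = p := by
  simp only [dil, smul_smul, ← Real.exp_add]
  ext <;> simp [neg_div]

lemma continuous_dil : Continuous fun x : ℝ × Space d => dil x.1 x.2 := by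
  unfold dil; fun_prop

lemma measurable_dil : Measurable fun x : ℝ × Space d => dil x.1 x.2 := continuous_dil.measurable

lemma measurable_dil_right (τ : ℝ) : Measurable (dil τ : Space d → Space d) :=
  measurable_dil.comp measurable_prodMk_left

lemma continuous_sqZ : Continuous (sqZ : Space d → ℝ) := contDiff_sqZ.continuous

lemma continuous_gauge : Continuous (gauge : Space d → ℝ) := contDiff_gauge.continuous

/-- The Jacobian consists of 2d real factors e^{τ/4} and one factor e^{τ/2}, in all e^{(d+1)τ/2};
the image measure carries its inverse. -/
lemma map_dil (τ : ℝ) : (volume : Measure (Space d)).map (dil τ)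
    = ENNReal.ofReal (Real.exp (-(growth d * τ))) • volume := by
  have e : (dil τ : Space d → Space d)
      = Prod.map (fun z => Real.exp (τ / 4) • z) (fun t => Real.exp (τ / 2) • t) := rfl
  have hv : (volume : Measure (Space d)) = (volume : Measure (Fin d → ℂ)).prod volume := rfl
  rw [e, hv, ← Measure.map_prod_map _ _ (measurable_const_smul _) (measurable_const_smul _),
    Measure.map_addHaar_smul _ (Real.exp_pos _).ne', Measure.map_addHaar_smul _ (Real.exp_pos _).ne',
    Measure.prod_smul_left, Measure.prod_smul_right, smul_smul,
    ← ENNReal.ofReal_mul (abs_nonneg _)]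
  congr 2
  rw [abs_of_pos (by positivity), abs_of_pos (by positivity), ← Real.exp_nat_mul,
    ← Real.exp_nat_mul, ← Real.exp_neg, ← Real.exp_neg, ← Real.exp_add]
  congr 1
  have : Module.finrank ℝ (Fin d → ℂ) = 2 * d := by
    rw [Module.finrank_pi_fintype]; simp [Complex.finrank_real_complex, mul_comm]
  rw [this, growth]
  simp
  ring

lemma lintegral_dil (τ : ℝ) {F : Space d → ENNReal} (hF : Measurable F) :
    ENNReal.ofReal (Real.exp (growth d * τ)) * ∫⁻ p, F (dil τ p) = ∫⁻ p, F p := by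
  rw [← lintegral_map hF (measurable_dil_right τ), map_dil, lintegral_smul_measure, smul_eq_mul,
    ← mul_assoc, ← ENNReal.ofReal_mul (Real.exp_pos _).le, ← Real.exp_add]
  simp

/-- The logarithm of `|z|⁴ + t²`. -/
noncomputable def logGauge (p : Space d) : ℝ := Real.log (gauge p)

lemma measurable_logGauge : Measurable (logGauge : Space d → ℝ) :=
  Real.measurable_log.comp continuous_gauge.measurable

/-- A fundamental annulus for the dilations. -/
def annulus (d : ℕ) : Set (Space d) := {p | 1 < gauge p ∧ gauge p < Real.exp 1}

lemma isOpen_annulus : IsOpen (annulus d) :=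
  (isOpen_lt continuous_const continuous_gauge).inter (isOpen_lt continuous_gauge continuous_const)

/-- The angular measure, realised on a fundamental annulus. -/
noncomputable def angular (d : ℕ) : Measure (Space d) :=
  (volume.restrict (annulus d)).withDensity fun p =>
    ENNReal.ofReal (Real.exp (-(growth d * logGauge p)))

/-- The radial measure, in the variable `log (|z|⁴ + t²)`. -/
noncomputable def radial (d : ℕ) : Measure ℝ :=
  volume.withDensity fun τ => ENNReal.ofReal (Real.exp (growth d * τ))

/-- Polar coordinates. -/
noncomputable def polar (x : ℝ × Space d) : Space d := dil (x.1 - logGauge x.2) x.2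

instance : SFinite (radial d) := by unfold radial; infer_instance

instance : IsFiniteMeasure (angular d) := by
  have hfin : volume (annulus d) < ⊤ := by
    refine (measure_mono fun p hp => ?_).trans_lt
      (measure_closedBall_lt_top (x := (0 : Space d)) (r := Real.exp 1 + 1))
    simpa using norm_le_of_gauge_le hp.2.le
  refine isFiniteMeasure_withDensity (ne_of_lt ?_)
  calc ∫⁻ p in annulus d, ENNReal.ofReal (Real.exp (-(growth d * logGauge p)))
      ≤ ∫⁻ _ in annulus d, 1 := by
        refine setLIntegral_mono' isOpen_annulus.measurableSet fun p hp => ?_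
        have : 0 ≤ growth d * logGauge p :=
          mul_nonneg (by unfold growth; positivity) (Real.log_nonneg hp.1.le)
        exact (ENNReal.ofReal_le_ofReal (Real.exp_le_one_iff.2 (by linarith))).trans (by simp)
    _ < ⊤ := by simpa using hfin

lemma measurable_polar : Measurable (polar : ℝ × Space d → Space d) :=
  measurable_dil.comp ((measurable_fst.sub (measurable_logGauge.comp measurable_snd)).prodMk
    measurable_snd)

lemma ae_sqZ_pos [NeZero d] : ∀ᵐ p : Space d, 0 < sqZ p := by
  have h0 : (volume : Measure (Fin d → ℂ)) {0} = 0 := by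
    have : Nonempty (Fin d) := ⟨0⟩
    exact measure_singleton _
  have h1 : (volume : Measure (Space d)) (Prod.fst ⁻¹' {0}) = 0 := by
    have : (volume : Measure (Space d)) = (volume : Measure (Fin d → ℂ)).prod volume := rfl
    rw [this]
    exact Measure.quasiMeasurePreserving_fst.preimage_null h0
  filter_upwards [measure_eq_zero_iff_ae_notMem.1 h1] with p hp
  refine (sqZ_nonneg p).lt_of_ne fun h => hp ?_
  have h := (Finset.sum_eq_zero_iff_of_nonneg fun _ _ => by positivity).1 h.symm
  simp only [Set.mem_preimage, Set.mem_singleton_iff]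
  funext j
  have := h j (Finset.mem_univ j)
  exact Complex.ext (by simpa using (by nlinarith : (p.1 j).re = 0))
    (by simpa using (by nlinarith : (p.1 j).im = 0))

lemma gauge_pos_of_sqZ_pos {p : Space d} (h : 0 < sqZ p) : 0 < gauge p :=
  (pow_pos h 2).trans_le (sqZ_sq_le_gauge p)

lemma ae_gauge_pos [NeZero d] : ∀ᵐ p : Space d, 0 < gauge p := by
  filter_upwards [ae_sqZ_pos] with p hp using gauge_pos_of_sqZ_pos hp

lemma lintegral_radial {f : ℝ → ENNReal} (hf : Measurable f) :
    ∫⁻ τ, f τ ∂(radial d) = ∫⁻ τ, ENNReal.ofReal (Real.exp (growth d * τ)) * f τ :=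
  lintegral_withDensity_eq_lintegral_mul _ (by fun_prop) hf

lemma lintegral_angular {f : Space d → ENNReal} (hf : Measurable f) :
    ∫⁻ q, f q ∂(angular d)
      = ∫⁻ q in annulus d, ENNReal.ofReal (Real.exp (-(growth d * logGauge q))) * f q :=
  lintegral_withDensity_eq_lintegral_mul _
    (Real.measurable_exp.comp (measurable_logGauge.const_mul _).neg).ennreal_ofReal hf

/-- Translating τ by log G(q) replaces `polar` by the plain dilation; the factor that comes out is
the inverse of the density of `angular`. -/
lemma lintegral_radial_polar {F : Space d → ENNReal} (hF : Measurable F) (q : Space d) :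
    ∫⁻ τ, F (polar (τ, q)) ∂(radial d)
      = ENNReal.ofReal (Real.exp (growth d * logGauge q))
        * ∫⁻ τ, ENNReal.ofReal (Real.exp (growth d * τ)) * F (dil τ q) := by
  have hm : Measurable fun τ => F (dil τ q) :=
    (hF.comp measurable_dil).comp measurable_prodMk_right
  have hp : Measurable fun τ => F (polar (τ, q)) :=
    hF.comp (measurable_polar.comp measurable_prodMk_right)
  have hE : Measurable fun τ : ℝ => ENNReal.ofReal (Real.exp (growth d * τ)) := by fun_prop
  have hEm : Measurable fun τ : ℝ =>
      ENNReal.ofReal (Real.exp (growth d * τ)) * F (dil τ q) := hE.mul hm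
  rw [lintegral_radial hp, ← lintegral_add_right_eq_self _ (logGauge q),
    ← lintegral_const_mul _ hEm]
  congr 1; funext τ
  simp only [polar, add_sub_cancel_right]
  rw [mul_add, Real.exp_add, ENNReal.ofReal_mul (Real.exp_pos _).le]
  ring

lemma measurable_indicator_annulus :
    Measurable ((annulus d).indicator (1 : Space d → ENNReal)) :=
  measurable_one.indicator isOpen_annulus.measurableSet

lemma lintegral_indicator_annulus_dil {F : Space d → ENNReal} (hF : Measurable F) (τ : ℝ) :
    ∫⁻ q, ENNReal.ofReal (Real.exp (growth d * τ)) * ((annulus d).indicator 1 q * F (dil τ q))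
      = ∫⁻ p, (annulus d).indicator 1 (dil (-τ) p) * F p := by
  have hm : Measurable fun p => (annulus d).indicator (1 : Space d → ENNReal) (dil (-τ) p) * F p :=
    (measurable_indicator_annulus.comp (measurable_dil_right _)).mul hF
  have hm' : Measurable fun q => (annulus d).indicator (1 : Space d → ENNReal) q * F (dil τ q) :=
    measurable_indicator_annulus.mul (hF.comp (measurable_dil_right τ))
  rw [← lintegral_dil τ hm, lintegral_const_mul _ hm']
  simp_rw [dil_neg_dil]

/-- Along a dilation orbit log G moves with unit speed, and the annulus is the interval (0, 1) of
values of log G. Every orbit thus spends time exactly 1 in it, which normalises the angular measure.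
-/
lemma lintegral_indicator_annulus_orbit {p : Space d} (hp : 0 < gauge p) :
    ∫⁻ τ, (annulus d).indicator (1 : Space d → ENNReal) (dil (-τ) p) = 1 := by
  have : ∀ τ, (annulus d).indicator (1 : Space d → ENNReal) (dil (-τ) p)
      = (Set.Ioo (logGauge p - 1) (logGauge p)).indicator 1 τ := by
    intro τ
    simp only [Set.indicator]
    congr 1
    simp only [annulus, Set.mem_ofPred_eq, gauge_dil, Set.mem_Ioo, eq_iff_iff]
    rw [← Real.exp_log hp, ← Real.exp_add, Real.one_lt_exp_iff, Real.exp_lt_exp, logGauge]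
    constructor <;> rintro ⟨h1, h2⟩ <;> constructor <;> linarith
  simp_rw [this]
  rw [lintegral_indicator_one measurableSet_Ioo]
  simp

lemma lintegral_polar_eq_annulus {F : Space d → ENNReal} (hF : Measurable F) :
    ∫⁻ x, F (polar x) ∂(radial d).prod (angular d)
      = ∫⁻ q in annulus d, ∫⁻ τ, ENNReal.ofReal (Real.exp (growth d * τ)) * F (dil τ q) := by
  have hFp : Measurable fun x : ℝ × Space d => F (polar x) := hF.comp measurable_polar
  rw [lintegral_prod_symm' _ hFp, lintegral_angular hFp.lintegral_prod_left]
  congr 1; funext q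
  rw [lintegral_radial_polar hF, ← mul_assoc, ← ENNReal.ofReal_mul (Real.exp_pos _).le,
    ← Real.exp_add]
  simp

lemma lintegral_dil_swap {F : Space d → ENNReal} (hF : Measurable F) :
    ∫⁻ q in annulus d, ∫⁻ τ, ENNReal.ofReal (Real.exp (growth d * τ)) * F (dil τ q)
      = ∫⁻ τ, ∫⁻ p, (annulus d).indicator 1 (dil (-τ) p) * F p := by
  have hFd : Measurable fun x : Space d × ℝ => F (dil x.2 x.1) :=
    hF.comp (measurable_dil.comp measurable_swap)
  have hE : Measurable fun x : Space d × ℝ => ENNReal.ofReal (Real.exp (growth d * x.2)) :=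
    Measurable.ennreal_ofReal (Real.measurable_exp.comp (measurable_snd.const_mul _))
  have hI : Measurable fun x : Space d × ℝ => (annulus d).indicator (1 : Space d → ENNReal) x.1 :=
    measurable_indicator_annulus.comp measurable_fst
  have hsw : Measurable fun x : Space d × ℝ => ENNReal.ofReal (Real.exp (growth d * x.2))
      * ((annulus d).indicator 1 x.1 * F (dil x.2 x.1)) := hE.mul (hI.mul hFd)
  have h := lintegral_lintegral_swap (μ := (volume : Measure (Space d))) (ν := (volume : Measure ℝ))
    (f := fun q τ => ENNReal.ofReal (Real.exp (growth d * τ))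
      * ((annulus d).indicator 1 q * F (dil τ q))) hsw.aemeasurable
  simp_rw [lintegral_indicator_annulus_dil hF] at h
  rw [← h, ← lintegral_indicator isOpen_annulus.measurableSet]
  congr 1; funext q
  by_cases hq : q ∈ annulus d <;> simp [hq]

lemma lintegral_orbit_swap [NeZero d] {F : Space d → ENNReal} (hF : Measurable F) :
    ∫⁻ τ, ∫⁻ p, (annulus d).indicator 1 (dil (-τ) p) * F p = ∫⁻ p, F p := by
  have hd : Measurable fun x : ℝ × Space d => dil (-x.1) x.2 :=
    measurable_dil.comp (measurable_fst.neg.prodMk measurable_snd)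
  have hI : Measurable fun x : ℝ × Space d =>
      (annulus d).indicator (1 : Space d → ENNReal) (dil (-x.1) x.2) :=
    measurable_indicator_annulus.comp hd
  have hIF : Measurable fun x : ℝ × Space d =>
      (annulus d).indicator (1 : Space d → ENNReal) (dil (-x.1) x.2) * F x.2 :=
    hI.mul (hF.comp measurable_snd)
  have h := lintegral_lintegral_swap (μ := (volume : Measure ℝ)) (ν := (volume : Measure (Space d)))
    (f := fun τ p => (annulus d).indicator (1 : Space d → ENNReal) (dil (-τ) p) * F p)
    hIF.aemeasurable
  rw [h]
  refine lintegral_congr_ae ?_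
  filter_upwards [ae_gauge_pos] with p hp
  have hdp : Measurable fun τ : ℝ => dil (-τ) p :=
    hd.comp (measurable_id.prodMk measurable_const)
  have hm : Measurable fun τ : ℝ =>
      (annulus d).indicator (1 : Space d → ENNReal) (dil (-τ) p) :=
    measurable_indicator_annulus.comp hdp
  rw [lintegral_mul_const _ hm, lintegral_indicator_annulus_orbit hp, one_mul]

lemma lintegral_polar [NeZero d] {F : Space d → ENNReal} (hF : Measurable F) :
    ∫⁻ x, F (polar x) ∂(radial d).prod (angular d) = ∫⁻ p, F p := by
  rw [lintegral_polar_eq_annulus hF, lintegral_dil_swap hF, lintegral_orbit_swap hF]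

lemma measurePreserving_polar [NeZero d] :
    MeasurePreserving (polar : ℝ × Space d → Space d) ((radial d).prod (angular d)) volume := by
  refine ⟨measurable_polar, Measure.ext fun s hs => ?_⟩
  have := lintegral_polar (measurable_one.indicator hs : Measurable (s.indicator 1))
  rw [lintegral_indicator_one hs] at this
  rw [Measure.map_apply measurable_polar hs, ← this,
    ← lintegral_indicator_one (measurable_polar hs)]
  rfl

lemma ae_angular_gauge : ∀ᵐ q ∂(angular d), 0 < gauge q := by
  refine (withDensity_absolutelyContinuous _ _).ae_le ?_
  filter_upwards [ae_restrict_mem isOpen_annulus.measurableSet] with q hq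
  linarith [hq.1]

lemma ae_angular_of_ae {P : Space d → Prop} (h : ∀ᵐ p, P p) : ∀ᵐ q ∂(angular d), P q :=
  (withDensity_absolutelyContinuous _ _).ae_le (ae_restrict_of_ae h)

/-- The homogeneous function `|z|² / (|z|⁴ + t²)^{1/2}`. -/
noncomputable def slope (p : Space d) : ℝ := sqZ p / √(gauge p)

lemma measurable_slope : Measurable (slope : Space d → ℝ) :=
  continuous_sqZ.measurable.div (Real.continuous_sqrt.comp continuous_gauge).measurable

lemma slope_nonneg (p : Space d) : 0 ≤ slope p := div_nonneg (sqZ_nonneg p) (Real.sqrt_nonneg _)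

lemma slope_le_one (p : Space d) : slope p ≤ 1 :=
  div_le_one_of_le₀ (Real.le_sqrt_of_sq_le (sqZ_sq_le_gauge p)) (Real.sqrt_nonneg _)

lemma slope_dil (τ : ℝ) (p : Space d) : slope (dil τ p) = slope p := by
  have h : √(Real.exp τ) = Real.exp (τ / 2) := by
    rw [← Real.exp_half]
  rw [slope, sqZ_dil, gauge_dil, Real.sqrt_mul (Real.exp_pos _).le, h,
    mul_div_mul_left _ _ (Real.exp_pos _).ne', slope]

lemma slope_polar (x : ℝ × Space d) : slope (polar x) = slope x.2 := slope_dil _ _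

lemma logGauge_polar {x : ℝ × Space d} (h : 0 < gauge x.2) : logGauge (polar x) = x.1 := by
  rw [logGauge, polar, gauge_dil, Real.log_mul (Real.exp_pos _).ne' h.ne', Real.log_exp]
  simp [logGauge]

lemma gauge_eq_exp {p : Space d} (h : 0 < gauge p) : gauge p = Real.exp (logGauge p) :=
  (Real.exp_log h).symm

lemma sqZ_eq {p : Space d} (h : 0 < gauge p) : sqZ p = Real.exp (logGauge p / 2) * slope p := by
  have : √(gauge p) = Real.exp (logGauge p / 2) := by
    rw [gauge_eq_exp h, ← Real.exp_half]
  rw [slope, this, mul_div_cancel₀ _ (Real.exp_pos _).ne']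

/-- The moments of `|z|² / (|z|⁴ + t²)^{1/2}`. -/
noncomputable def moment (d j : ℕ) : ℝ := ∫ q, slope q ^ j ∂(angular d)

lemma integrable_slope_pow (j : ℕ) : Integrable (fun q => slope q ^ j) (angular d) := by
  refine Integrable.of_bound (C := 1) (measurable_slope.pow_const j).aestronglyMeasurable
    (Filter.Eventually.of_forall fun q => ?_)
  rw [Real.norm_of_nonneg (pow_nonneg (slope_nonneg q) j)]
  exact pow_le_one₀ (slope_nonneg q) (slope_le_one q)

lemma ae_polar_logGauge :
    ∀ᵐ x ∂(radial d).prod (angular d), logGauge (polar x) = x.1 := by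
  have : ∀ᵐ x ∂(radial d).prod (angular d), 0 < gauge x.2 :=
    Measure.quasiMeasurePreserving_snd.ae ae_angular_gauge
  filter_upwards [this] with x hx using logGauge_polar hx

lemma integral_polar [NeZero d] {F : Space d → ℂ} (hF : AEStronglyMeasurable F volume) :
    ∫ p, F p = ∫ x, F (polar x) ∂(radial d).prod (angular d) := by
  conv_lhs => rw [← measurePreserving_polar.map_eq]
  exact integral_map measurable_polar.aemeasurable (by rwa [measurePreserving_polar.map_eq])

lemma integral_radial (f : ℝ → ℂ) :
    ∫ τ, f τ ∂(radial d) = ∫ τ, Real.exp (growth d * τ) * f τ := by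
  rw [radial, integral_withDensity_eq_integral_toReal_smul (by fun_prop) (by simp)]
  simp [ENNReal.toReal_ofReal, Real.exp_nonneg]

/-- Functions of `log (|z|⁴ + t²)` times a power of the slope. -/
lemma integral_logGauge_mul_slope [NeZero d] {h : ℝ → ℂ} (hh : Measurable h) (j : ℕ) :
    ∫ p : Space d, h (logGauge p) * ((slope p ^ j : ℝ) : ℂ)
      = moment d j * ∫ τ, Real.exp (growth d * τ) * h τ := by
  have hm : Measurable fun p : Space d => h (logGauge p) * ((slope p ^ j : ℝ) : ℂ) :=
    (hh.comp measurable_logGauge).mul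
      (Complex.measurable_ofReal.comp (measurable_slope.pow_const j))
  rw [integral_polar hm.aestronglyMeasurable]
  have : ∀ᵐ x ∂(radial d).prod (angular d),
      h (logGauge (polar x)) * ((slope (polar x) ^ j : ℝ) : ℂ)
        = h x.1 * ((slope x.2 ^ j : ℝ) : ℂ) := by
    filter_upwards [ae_polar_logGauge] with x hx
    rw [hx, slope_polar]
  rw [integral_congr_ae this, integral_prod_mul h (fun q => ((slope q ^ j : ℝ) : ℂ)),
    integral_radial, mul_comm, moment, integral_complex_ofReal]


/-! ### Pairings of radial functions with test functions -/

lemma angular_ne_zero [NeZero d] : angular d ≠ 0 := by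
  intro h
  have := (measurePreserving_polar (d := d)).map_eq
  rw [h, Measure.prod_zero, Measure.map_zero] at this
  exact (NeZero.ne (volume : Measure (Space d))) this.symm

lemma moment_pos [NeZero d] (j : ℕ) : 0 < moment d j := by
  have hpos : ∀ᵐ q ∂(angular d), 0 < slope q ^ j := by
    filter_upwards [ae_angular_of_ae (ae_sqZ_pos (d := d)), ae_angular_gauge] with q h1 h2
    exact pow_pos (div_pos h1 (Real.sqrt_pos.2 h2)) j
  rw [moment, integral_pos_iff_support_of_nonneg_ae (hpos.mono fun _ h => h.le)
    (integrable_slope_pow j)]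
  have : Function.support (fun q : Space d => slope q ^ j) =ᵐ[angular d] Set.univ := by
    filter_upwards [hpos] with q hq
    exact propext ⟨fun _ => trivial, fun _ => hq.ne'⟩
  rw [measure_congr this]
  exact Measure.measure_univ_pos.2 angular_ne_zero

lemma integrable_logGauge_iff [NeZero d] {h : ℝ → ℂ} (hh : Measurable h) :
    Integrable (fun p : Space d => h (logGauge p)) volume
      ↔ Integrable (fun τ => (Real.exp (growth d * τ) : ℂ) * h τ) := by
  have hm : Measurable fun p : Space d => h (logGauge p) := hh.comp measurable_logGauge
  rw [← measurePreserving_polar.integrable_comp hm.aestronglyMeasurable,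
    integrable_congr (g := fun x : ℝ × Space d => h x.1)
      (by filter_upwards [ae_polar_logGauge] with x hx; simp [hx]),
    Integrable.comp_fst_iff angular_ne_zero, radial,
    integrable_withDensity_iff_integrable_smul' (by fun_prop) (by simp)]
  simp [ENNReal.toReal_ofReal, Real.exp_nonneg]

/-- The pairing of `g` with `exp (κ τ) χ(τ)`. -/
noncomputable def pair (g : ℝ → ℂ) (κ : ℝ) (χ : ℝ → ℝ) : ℂ :=
  ∫ τ, g τ * ((Real.exp (κ * τ) * χ τ : ℝ) : ℂ)

lemma pair_exp_mul (g : ℝ → ℂ) (κ c : ℝ) (χ : ℝ → ℝ) :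
    pair g κ (fun τ => Real.exp (c * τ) * χ τ) = pair g (κ + c) χ := by
  simp only [pair]
  congr 1; funext τ
  rw [← mul_assoc (Real.exp _), ← Real.exp_add]
  ring_nf

lemma radialTest_eq (j : ℕ) (χ : ℝ → ℝ) {p : Space d} (h : 0 < gauge p) :
    radialTest j χ p = slope p ^ j * (Real.exp (j / 2 * logGauge p) * χ (logGauge p)) := by
  rw [radialTest, lift_of_pos h, sqZ_eq h, mul_pow, ← Real.exp_nat_mul, ← logGauge]
  ring_nf

lemma gauge_mul_radialTest_liftDeriv (j : ℕ) (χ : ℝ → ℝ) (p : Space d) :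
    gauge p * radialTest j (liftDeriv χ) p = radialTest j (deriv χ) p := by
  simp only [radialTest, lift]
  split_ifs with h
  · rw [liftDeriv, neg_one_mul, Real.exp_neg, Real.exp_log h]
    field_simp
  · simp

section

variable {u : Space d → ℂ} {gr : Fin d ⊕ Fin d → Space d → ℂ} {g : ℝ → ℂ}

lemma integral_mul_radialTest [NeZero d] (hg : Measurable g)
    (hug : u =ᵐ[volume] fun p => g (logGauge p)) {χ : ℝ → ℝ} (hχ : IsTest χ) (j : ℕ) :
    ∫ p, u p * (radialTest j χ p : ℂ) = moment d j * pair g (growth d + j / 2) χ := by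
  have e : ∀ᵐ p : Space d, u p * (radialTest j χ p : ℂ)
      = (fun τ => g τ * ((Real.exp (j / 2 * τ) * χ τ : ℝ) : ℂ)) (logGauge p)
        * ((slope p ^ j : ℝ) : ℂ) := by
    filter_upwards [hug, ae_gauge_pos] with p h1 h2
    rw [h1, radialTest_eq j χ h2]
    push_cast; ring
  have hm : Measurable fun τ => g τ * ((Real.exp (j / 2 * τ) * χ τ : ℝ) : ℂ) :=
    hg.mul (Complex.measurable_ofReal.comp
      ((by fun_prop : Measurable fun τ : ℝ => Real.exp (j / 2 * τ)).mul hχ.continuous.measurable))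
  rw [integral_congr_ae e, integral_logGauge_mul_slope hm, pair]
  congr 2; funext τ
  rw [add_mul, Real.exp_add]
  push_cast; ring

lemma integrable_mul_radialTest (hu : LocallyIntegrable u volume) {χ : ℝ → ℝ} (hχ : IsTest χ)
    (j : ℕ) : Integrable (fun p => u p * (radialTest j χ p : ℂ)) volume := by
  simpa using hu.integrable_smul_right_of_hasCompactSupport
    (contDiff_ofReal_comp (hχ.contDiff_radialTest j)).continuous
    (hasCompactSupport_ofReal_comp (hχ.hasCompactSupport_radialTest j))

lemma integrable_pair [NeZero d] (hu : LocallyIntegrable u volume) (hg : Measurable g)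
    (hug : u =ᵐ[volume] fun p => g (logGauge p)) {χ : ℝ → ℝ} (hχ : IsTest χ) (κ : ℝ) :
    Integrable (fun τ => g τ * ((Real.exp (κ * τ) * χ τ : ℝ) : ℂ)) := by
  -- The polar density contributes e^{growth τ}, so the weight e^{(κ − growth)τ} leaves e^{κτ}.
  have h1 := integrable_mul_radialTest hu (hχ.mul_left (contDiff_exp_mul (κ - growth d))) 0
  have hm : Measurable fun τ => g τ * ((Real.exp ((κ - growth d) * τ) * χ τ : ℝ) : ℂ) :=
    hg.mul (Complex.measurable_ofReal.comp
      ((contDiff_exp_mul _).continuous.mul hχ.continuous).measurable)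
  rw [integrable_congr (g := fun p => (fun τ => g τ *
    ((Real.exp ((κ - growth d) * τ) * χ τ : ℝ) : ℂ)) (logGauge p)), integrable_logGauge_iff hm] at h1
  · convert h1 using 2 with τ
    rw [show κ * τ = growth d * τ + (κ - growth d) * τ by ring, Real.exp_add]
    push_cast; ring
  · filter_upwards [hug, ae_gauge_pos] with p h1 h2
    rw [h1, radialTest_eq _ _ h2]
    simp

lemma WeakPair.integral_hSqZ_radial [NeZero d] (hu : WeakPair u gr) (hg : Measurable g)
    (hug : u =ᵐ[volume] fun p => g (logGauge p)) {χ : ℝ → ℝ} (hχ : IsTest χ) (j : ℕ) :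
    ∫ p, (∑ k, gr k p * hSqZ k p) * radialTest j χ p
      = -((4 * j + 4 * d) * moment d j * pair g (growth d + j / 2) χ
        + 8 * moment d (j + 2) * pair g (growth d + j / 2) (deriv χ)) := by
  rw [hu.integral_hSqZ hχ j]
  have e : ∀ p, u p * (((4 * j + 4 * d) * radialTest j χ p
      + 8 * radialTest (j + 2) (liftDeriv χ) p : ℝ) : ℂ)
      = (4 * j + 4 * d) * (u p * (radialTest j χ p : ℂ))
        + 8 * (u p * (radialTest (j + 2) (liftDeriv χ) p : ℂ)) := fun p => by push_cast; ring
  simp_rw [e]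
  rw [integral_add ((integrable_mul_radialTest hu.fn hχ j).const_mul _)
    ((integrable_mul_radialTest hu.fn hχ.isTest_liftDeriv _).const_mul _),
    integral_const_mul, integral_const_mul, integral_mul_radialTest hg hug hχ,
    integral_mul_radialTest hg hug hχ.isTest_liftDeriv, show liftDeriv χ
      = fun τ => Real.exp (-1 * τ) * deriv χ τ from rfl, pair_exp_mul]
  -- The extra factor |z|⁴ adds 1 to the exponent of e^τ, and the e^{−τ} in `liftDeriv` removes it.
  have : growth d + ((j + 2 : ℕ) : ℝ) / 2 + -1 = growth d + j / 2 := by push_cast; ring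
  rw [this]
  ring

lemma WeakPair.integral_hGauge_radial [NeZero d] (hu : WeakPair u gr) (hg : Measurable g)
    (hug : u =ᵐ[volume] fun p => g (logGauge p)) {χ : ℝ → ℝ} (hχ : IsTest χ) (j : ℕ) :
    ∫ p, (∑ k, gr k p * hGauge k p) * radialTest j χ p
      = -(moment d (j + 1) * (8 * (j + d + 2) * pair g (growth d + (j + 1) / 2) χ
        + 16 * pair g (growth d + (j + 1) / 2) (deriv χ))) := by
  rw [hu.integral_hGauge hχ j]
  have e : ∀ p, u p * ((8 * (j + d + 2) * radialTest (j + 1) χ p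
      + 16 * gauge p * radialTest (j + 1) (liftDeriv χ) p : ℝ) : ℂ)
      = (8 * (j + d + 2)) * (u p * (radialTest (j + 1) χ p : ℂ))
        + 16 * (u p * (radialTest (j + 1) (deriv χ) p : ℂ)) := fun p => by
    rw [mul_assoc 16, gauge_mul_radialTest_liftDeriv]; push_cast; ring
  simp_rw [e]
  rw [integral_add ((integrable_mul_radialTest hu.fn hχ _).const_mul _)
    ((integrable_mul_radialTest hu.fn hχ.isTest_deriv _).const_mul _),
    integral_const_mul, integral_const_mul, integral_mul_radialTest hg hug hχ,
    integral_mul_radialTest hg hug hχ.isTest_deriv]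
  push_cast
  ring

end

/-! ### The recurrence of the moments -/

lemma IsTest.integrable {χ : ℝ → ℝ} (h : IsTest χ) : Integrable χ :=
  h.continuous.integrable_of_hasCompactSupport h.2

lemma exists_isTest_integral_exp_pos (κ : ℝ) :
    ∃ χ, IsTest χ ∧ 0 < ∫ τ, Real.exp (κ * τ) * χ τ := by
  let f : ContDiffBump (0 : ℝ) := ⟨1, 2, one_pos, one_lt_two⟩
  have ht : IsTest f := ⟨f.contDiff, f.hasCompactSupport⟩
  refine ⟨fun τ => Real.exp (-κ * τ) * f τ, ht.mul_left (contDiff_exp_mul _), ?_⟩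
  have : ∀ τ, Real.exp (κ * τ) * (Real.exp (-κ * τ) * f τ) = f τ := fun τ => by
    rw [← mul_assoc, ← Real.exp_add]; simp
  simp_rw [this]
  exact f.integral_pos

lemma integral_exp_mul_deriv {χ : ℝ → ℝ} (h : IsTest χ) (κ : ℝ) :
    ∫ τ, Real.exp (κ * τ) * deriv χ τ = -(κ * ∫ τ, Real.exp (κ * τ) * χ τ) := by
  have h1 := (h.mul_left (contDiff_exp_mul κ)).integrable
  have h2 := (h.isTest_deriv.mul_left (contDiff_exp_mul κ)).integrable
  have h3 := integral_eq_zero_of_hasDerivAt_of_integrable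
    (f := fun τ => Real.exp (κ * τ) * χ τ)
    (f' := fun τ => κ * (Real.exp (κ * τ) * χ τ) + Real.exp (κ * τ) * deriv χ τ)
    (fun τ => by
      have := (((hasDerivAt_id τ).const_mul κ).exp).mul (h.hasDerivAt τ)
      refine this.congr_deriv ?_
      simp; ring) ((h1.const_mul κ).add h2) h1
  rw [integral_add (h1.const_mul κ) h2, integral_const_mul] at h3
  linarith

/-- The divergence theorem for the field |z|^{2j}φ(G)∇|z|², that is, the pairing with the constant
function 1. Once the derivative is moved off χ, both terms contain the same radial integral, which
can be chosen positive and divided out. -/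
lemma moment_recurrence [NeZero d] (j : ℕ) :
    (d + j) * moment d j = (d + j + 1) * moment d (j + 2) := by
  obtain ⟨χ, hχ, hpos⟩ := exists_isTest_integral_exp_pos (growth d + j / 2)
  have h := weakPair_one.integral_hSqZ_radial (d := d) (g := fun _ => 1) measurable_const
    (Filter.EventuallyEq.refl _ _) hχ j
  simp only [pair, one_mul, integral_complex_ofReal, zero_mul, Finset.sum_const_zero,
    integral_zero, integral_exp_mul_deriv hχ] at h
  have h' : (4 * j + 4 * d) * moment d j * (∫ τ, Real.exp ((growth d + j / 2) * τ) * χ τ)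
      + 8 * moment d (j + 2) * -((growth d + j / 2)
        * ∫ τ, Real.exp ((growth d + j / 2) * τ) * χ τ) = 0 := by
    exact_mod_cast neg_eq_zero.1 h.symm
  have h'' : ((4 * j + 4 * d) * moment d j - 8 * moment d (j + 2) * (growth d + j / 2))
      * (∫ τ, Real.exp ((growth d + j / 2) * τ) * χ τ) = 0 := by linarith
  have := (mul_eq_zero.1 h'').resolve_right hpos.ne'
  rw [growth] at this
  linarith

/-! ### The weak equation for radial functions -/

/-- The test function has a gradient part along ∇|z|², which yields m_j and m_{j+2}, and a part
along ∇G, which yields m_{j+2}. The recurrence trades m_j for m_{j+2}, so a single moment factors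
out. -/
lemma integral_grad_radialTest [NeZero d] {u : Space d → ℂ}
    {gr : Fin d ⊕ Fin d → Space d → ℂ} {g : ℝ → ℂ} (hu : WeakPair u gr) (hg : Measurable g)
    (hug : u =ᵐ[volume] fun p => g (logGauge p)) {χ : ℝ → ℝ} (hχ : IsTest χ) (j : ℕ) :
    ∫ p, ∑ k, gr k p * ((hDeriv k (radialTest (j + 1) χ) p : ℝ) : ℂ)
      = -(moment d (j + 2) * (4 * (j + 1) * (d + j + 1) * pair g (growth d + j / 2) χ
        + (16 * j + 8 * d + 16) * pair g (growth d + j / 2) (deriv χ)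
        + 16 * pair g (growth d + j / 2) (deriv (deriv χ)))) := by
  have hloc : ∀ {a : Fin d ⊕ Fin d → Space d → ℝ}, (∀ k, ContDiff ℝ ∞ (a k)) →
      ∀ {ξ : ℝ → ℝ}, IsTest ξ → ∀ i : ℕ,
      Integrable (fun p => (∑ k, gr k p * a k p) * radialTest i ξ p) volume := by
    intro a ha ξ hξ i
    simp_rw [Finset.sum_mul, mul_assoc]
    refine integrable_finsetSum _ fun k _ => ?_
    have := (hu.grad k).integrable_smul_right_of_hasCompactSupport
      (contDiff_ofReal_comp ((ha k).mul (hξ.contDiff_radialTest i))).continuous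
      (hasCompactSupport_ofReal_comp (hξ.hasCompactSupport_radialTest i).mul_left)
    simpa using this
  have e : ∀ p, ∑ k, gr k p * ((hDeriv k (radialTest (j + 1) χ) p : ℝ) : ℂ)
      = (j + 1) * ((∑ k, gr k p * hSqZ k p) * radialTest j χ p)
        + (∑ k, gr k p * hGauge k p) * radialTest (j + 1) (liftDeriv χ) p := fun p => by
    simp only [hχ.hDeriv_radialTest, Finset.sum_mul, Finset.mul_sum, ← Finset.sum_add_distrib]
    refine Finset.sum_congr rfl fun k _ => ?_
    simp [radialTest]; ring
  simp_rw [e]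
  have hdd : deriv (liftDeriv χ)
      = fun τ => Real.exp (-1 * τ) * (deriv (deriv χ) τ - deriv χ τ) := by
    funext τ
    have := (((hasDerivAt_id τ).const_mul (-1)).exp).mul (hχ.isTest_deriv.hasDerivAt τ)
    refine this.deriv.trans ?_
    simp; ring
  have hsub : ∀ κ, pair g κ (fun τ => deriv (deriv χ) τ - deriv χ τ)
      = pair g κ (deriv (deriv χ)) - pair g κ (deriv χ) := fun κ => by
    rw [pair, pair, pair, ← integral_sub (integrable_pair hu.fn hg hug hχ.isTest_deriv.isTest_deriv κ)
      (integrable_pair hu.fn hg hug hχ.isTest_deriv κ)]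
    congr 1; funext τ; push_cast; ring
  rw [integral_add ((hloc contDiff_hSqZ hχ j).const_mul _)
    (hloc contDiff_hGauge hχ.isTest_liftDeriv (j + 1)), integral_const_mul,
    hu.integral_hSqZ_radial hg hug hχ, hu.integral_hGauge_radial hg hug hχ.isTest_liftDeriv, hdd,
    show liftDeriv χ = fun τ => Real.exp (-1 * τ) * deriv χ τ from rfl, pair_exp_mul, pair_exp_mul,
    hsub]
  have hκ : growth d + (((j + 1 : ℕ) : ℝ) + 1) / 2 + -1 = growth d + j / 2 := by push_cast; ring
  rw [hκ]
  have hrec : ((d : ℂ) + j) * moment d j = (d + j + 1) * moment d (j + 2) := by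
    exact_mod_cast moment_recurrence (d := d) j
  push_cast
  linear_combination (-4 * (j + 1) * pair g (growth d + j / 2) χ) * hrec

/-- For the test functions `slope ^ (j + 1) χ` the weak equation for a radial function depends on
`j` only through a factor. -/
lemma integral_grad_slope_mul [NeZero d] {u : Space d → ℂ}
    {gr : Fin d ⊕ Fin d → Space d → ℂ} {g : ℝ → ℂ} (hu : WeakPair u gr) (hg : Measurable g)
    (hug : u =ᵐ[volume] fun p => g (logGauge p)) {χ : ℝ → ℝ} (hχ : IsTest χ) (j : ℕ) :
    ∫ p, ∑ k, gr k p
        * ((hDeriv k (radialTest (j + 1) fun τ => Real.exp (-((j + 1) / 2) * τ) * χ τ) p : ℝ) : ℂ)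
      = -(moment d (j + 2) * (8 * d * pair g (d / 2) (deriv χ)
        + 16 * pair g (d / 2) (deriv (deriv χ)))) := by
  -- With this exponent e^{cτ}|z|^{2(j+1)} = s^{j+1}. The coefficient of χ becomes 4(j+1)(d+j+1) +
  -- c(16j+8d+16) + 16c² = 0 and that of χ' becomes 8d, which reflects the orthogonality of ∇s and
  -- ∇G.
  set c : ℝ := -((j + 1) / 2) with hc
  have hdE : ∀ {ξ : ℝ → ℝ}, IsTest ξ → deriv (fun τ => Real.exp (c * τ) * ξ τ)
      = fun τ => Real.exp (c * τ) * (c * ξ τ + deriv ξ τ) := fun {ξ} hξ => by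
    funext τ
    have := (((hasDerivAt_id τ).const_mul c).exp).mul (hξ.hasDerivAt τ)
    refine this.deriv.trans ?_
    simp; ring
  have h1 : IsTest fun τ => c * χ τ + deriv χ τ :=
    ⟨(contDiff_const.mul hχ.1).add hχ.isTest_deriv.1, (hχ.2.mul_left).add hχ.isTest_deriv.2⟩
  have h2 : deriv (fun τ => c * χ τ + deriv χ τ) = fun τ => c * deriv χ τ + deriv (deriv χ) τ := by
    funext τ
    exact (((hχ.hasDerivAt τ).const_mul c).add (hχ.isTest_deriv.hasDerivAt τ)).deriv
  have hκ : growth d + j / 2 + c = d / 2 := by rw [hc, growth]; ring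
  have hlin : ∀ {ξ η : ℝ → ℝ}, IsTest ξ → IsTest η → pair g (d / 2) (fun τ => c * ξ τ + η τ)
      = c * pair g (d / 2) ξ + pair g (d / 2) η := fun {ξ η} hξ hη => by
    rw [pair, pair, pair, ← integral_const_mul, ← integral_add
      ((integrable_pair hu.fn hg hug hξ _).const_mul _) (integrable_pair hu.fn hg hug hη _)]
    congr 1; funext τ; push_cast; ring
  have h3 : IsTest fun τ => c * deriv χ τ + deriv (deriv χ) τ :=
    ⟨(contDiff_const.mul hχ.isTest_deriv.1).add hχ.isTest_deriv.isTest_deriv.1,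
      (hχ.isTest_deriv.2.mul_left).add hχ.isTest_deriv.isTest_deriv.2⟩
  rw [integral_grad_radialTest hu hg hug (hχ.mul_left (contDiff_exp_mul c)), hdE hχ, hdE h1, h2,
    pair_exp_mul, pair_exp_mul, pair_exp_mul, hκ, hlin h1 h3, hlin hχ hχ.isTest_deriv,
    hlin hχ.isTest_deriv hχ.isTest_deriv.isTest_deriv]
  have hcc : (c : ℂ) = -((j + 1) / 2) := by rw [hc]; push_cast; ring
  rw [hcc]
  ring


/-! ### A one-dimensional Hardy inequality in dual form -/

lemma integral_linear_combination {α : Type*} [MeasurableSpace α] {μ : Measure α} {f g h : α → ℝ}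
    (hf : Integrable f μ) (hg : Integrable g μ) (hh : Integrable h μ) (a b : ℝ) :
    ∫ x, (f x + (a * g x + b * h x)) ∂μ
      = ∫ x, f x ∂μ + (a * ∫ x, g x ∂μ + b * ∫ x, h x ∂μ) := by
  have h1 : Integrable (fun x => a * g x + b * h x) μ := (hg.const_mul a).add (hh.const_mul b)
  rw [integral_add hf h1, integral_add (hg.const_mul a) (hh.const_mul b), integral_const_mul,
    integral_const_mul]

lemma sq_integral_mul_le {α : Type*} [MeasurableSpace α] {μ : Measure α} {f g : α → ℝ}
    (hf : MemLp f 2 μ) (hg : MemLp g 2 μ) :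
    (∫ x, f x * g x ∂μ) ^ 2 ≤ (∫ x, f x ^ 2 ∂μ) * ∫ x, g x ^ 2 ∂μ := by
  have hf2 := hf.integrable_sq
  have hg2 := hg.integrable_sq
  have hfg : Integrable (fun x => f x * g x) μ := hf.integrable_mul hg
  have key : ∀ t : ℝ, 0 ≤ (∫ x, g x ^ 2 ∂μ) * (t * t) + (2 * ∫ x, f x * g x ∂μ) * t
      + ∫ x, f x ^ 2 ∂μ := by
    intro t
    have h0 : 0 ≤ ∫ x, (f x + t * g x) ^ 2 ∂μ := integral_nonneg fun _ => sq_nonneg _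
    have e : ∀ x, (f x + t * g x) ^ 2 = f x ^ 2 + (2 * t * (f x * g x) + t ^ 2 * g x ^ 2) :=
      fun x => by ring
    simp_rw [e] at h0
    rw [integral_linear_combination hf2 hfg hg2] at h0
    linarith
  have := discrim_le_zero key
  unfold discrim at this
  linarith

lemma abs_integral_mul_le {α : Type*} [MeasurableSpace α] {μ : Measure α} {f g : α → ℝ}
    (hf : MemLp f 2 μ) (hg : MemLp g 2 μ) :
    |∫ x, f x * g x ∂μ| ≤ √(∫ x, f x ^ 2 ∂μ) * √(∫ x, g x ^ 2 ∂μ) := by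
  rw [← Real.sqrt_mul (integral_nonneg fun _ => sq_nonneg _), ← Real.sqrt_sq_eq_abs]
  exact Real.sqrt_le_sqrt (sq_integral_mul_le hf hg)

lemma memLp_of_le_exp {ξ : ℝ → ℝ} (hξ : Continuous ξ) {R C c : ℝ} (hc : 0 < c)
    (h0 : ∀ τ, τ < R → ξ τ = 0) (hC : ∀ τ, |ξ τ| ≤ C * Real.exp (-c * τ)) : MemLp ξ 2 volume := by
  rw [memLp_two_iff_integrable_sq hξ.aestronglyMeasurable]
  have hi : Integrable ((Set.Ici R).indicator fun τ => C ^ 2 * Real.exp (-(2 * c) * τ)) := by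
    rw [integrable_indicator_iff measurableSet_Ici]
    exact ((integrableOn_Ici_iff_integrableOn_Ioi (by simp)).2
      (integrableOn_exp_mul_Ioi (by linarith) R)).const_mul _
  refine hi.mono' (hξ.pow 2).aestronglyMeasurable (Filter.Eventually.of_forall fun τ => ?_)
  by_cases h : τ < R
  · rw [h0 τ h, Set.indicator_of_notMem (by simpa using h)]; simp
  · rw [Set.indicator_of_mem (by simpa using h), Real.norm_of_nonneg (sq_nonneg _), ← sq_abs]
    calc |ξ τ| ^ 2 ≤ (C * Real.exp (-c * τ)) ^ 2 := by gcongr; exact hC τ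
      _ = C ^ 2 * Real.exp (-(2 * c) * τ) := by
        rw [mul_pow, ← Real.exp_nat_mul]; ring_nf

/-- Solution of `ξ' + c ξ = ψ` vanishing near `-∞`. -/
lemma exists_solution {ψ : ℝ → ℝ} (hψ : IsTest ψ) (c : ℝ) :
    ∃ (ξ : ℝ → ℝ) (R C : ℝ), ContDiff ℝ ∞ ξ ∧ (∀ τ, deriv ξ τ = ψ τ - c * ξ τ) ∧
      (∀ τ, τ < R → ξ τ = 0) ∧ ∀ τ, |ξ τ| ≤ C * Real.exp (-c * τ) := by
  obtain ⟨R, hR0, hR⟩ := hψ.exists_bound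
  have hE := hψ.mul_left (contDiff_exp_mul c)
  -- Variation of constants; the lower limit lies to the left of the support of ψ, so F vanishes
  -- near −∞.
  set F : ℝ → ℝ := fun τ => ∫ s in (-R - 1)..τ, Real.exp (c * s) * ψ s with hF
  have hFd : ∀ τ, HasDerivAt F (Real.exp (c * τ) * ψ τ) τ := fun τ =>
    intervalIntegral.integral_hasDerivAt_right (hE.continuous.intervalIntegrable _ _)
      hE.continuous.stronglyMeasurable.stronglyMeasurableAtFilter hE.continuous.continuousAt
  have hFs : ContDiff ℝ ∞ F := by
    rw [contDiff_infty_iff_deriv]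
    refine ⟨fun τ => (hFd τ).differentiableAt, ?_⟩
    rw [show deriv F = fun τ => Real.exp (c * τ) * ψ τ from funext fun τ => (hFd τ).deriv]
    exact hE.1
  refine ⟨fun τ => Real.exp (-c * τ) * F τ, -R - 1, ∫ s, |Real.exp (c * s) * ψ s|,
    (contDiff_exp_mul (-c)).mul hFs, fun τ => ?_, fun τ hτ => ?_, fun τ => ?_⟩
  · have := (((hasDerivAt_id τ).const_mul (-c)).exp).mul (hFd τ)
    refine this.deriv.trans ?_
    have h1 : Real.exp (-c * τ) * Real.exp (c * τ) = 1 := by rw [← Real.exp_add]; simp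
    simp only [id_eq, mul_one]
    linear_combination ψ τ * h1
  · have : F τ = 0 := by
      rw [hF]
      refine intervalIntegral.integral_zero_ae (Filter.Eventually.of_forall fun s hs => ?_)
      rw [Set.uIoc_of_ge hτ.le] at hs
      rw [hR s (by rw [abs_of_neg] <;> linarith [hs.2]), mul_zero]
    simp [this]
  · rw [abs_mul, abs_of_pos (Real.exp_pos _), mul_comm]
    gcongr
    calc |F τ| ≤ ∫ s in Set.uIoc (-R - 1) τ, |Real.exp (c * s) * ψ s| :=
          intervalIntegral.norm_integral_le_integral_norm_uIoc
            (f := fun s => Real.exp (c * s) * ψ s) (μ := volume)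
      _ ≤ _ := setIntegral_le_integral hE.integrable.norm
          (Filter.Eventually.of_forall fun _ => abs_nonneg _)

/-- Multiply ξ' + cξ = ψ by ξ and integrate: the total derivative drops out, and c‖ξ‖² = ∫ ξψ ≤
‖ξ‖‖ψ‖. -/
lemma integral_sq_solution_le {ψ ξ : ℝ → ℝ} (hψ : IsTest ψ) {c : ℝ} (hc : 0 < c)
    (hξ : ContDiff ℝ ∞ ξ) (hd : ∀ τ, deriv ξ τ = ψ τ - c * ξ τ) (hL : MemLp ξ 2 volume) :
    c * √(∫ τ, ξ τ ^ 2) ≤ √(∫ τ, ψ τ ^ 2) := by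
  have hψL : MemLp ψ 2 volume := hψ.continuous.memLp_of_hasCompactSupport hψ.2
  have hi := hL.integrable_sq
  have hm : Integrable (fun τ => ξ τ * ψ τ) := hL.integrable_mul hψL
  have h := integral_eq_zero_of_hasDerivAt_of_integrable (f := fun τ => ξ τ ^ 2)
    (f' := fun τ => 2 * (ξ τ * ψ τ) - 2 * c * ξ τ ^ 2) (fun τ => by
      have := ((hξ.differentiable (by simp) τ).hasDerivAt).pow 2
      refine this.congr_deriv ?_
      rw [hd]; simp; ring) ((hm.const_mul _).sub (hi.const_mul _)) hi
  rw [integral_sub (hm.const_mul _) (hi.const_mul _), integral_const_mul, integral_const_mul] at h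
  have hcs := (le_abs_self _).trans (abs_integral_mul_le hL hψL)
  have hs := Real.mul_self_sqrt (integral_nonneg (μ := volume) fun τ => sq_nonneg (ξ τ))
  rcases (Real.sqrt_nonneg (∫ τ, ξ τ ^ 2)).eq_or_lt with h0 | h0
  · rw [← h0]; simp
  · refine le_of_mul_le_mul_left ?_ h0
    nlinarith

/-- A smooth cutoff equal to one on `(-∞, n]` and to zero on `[n + 1, ∞)`. -/
noncomputable def cutoff (n : ℕ) (τ : ℝ) : ℝ := Real.smoothTransition (n + 1 - τ)

lemma contDiff_cutoff (n : ℕ) : ContDiff ℝ ∞ (cutoff n) :=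
  Real.smoothTransition.contDiff.comp (contDiff_const.sub contDiff_id)

lemma cutoff_of_le {n : ℕ} {τ : ℝ} (h : τ ≤ n) : cutoff n τ = 1 :=
  Real.smoothTransition.one_of_one_le (by linarith)

lemma cutoff_of_ge {n : ℕ} {τ : ℝ} (h : n + 1 ≤ τ) : cutoff n τ = 0 :=
  Real.smoothTransition.zero_of_nonpos (by linarith)

lemma deriv_cutoff (n : ℕ) (τ : ℝ) :
    deriv (cutoff n) τ = -deriv Real.smoothTransition (n + 1 - τ) := by
  have h : HasDerivAt (fun τ : ℝ => (n : ℝ) + 1 - τ) (-1) τ := by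
    simpa using (hasDerivAt_id τ).const_sub ((n : ℝ) + 1)
  have hs : HasDerivAt Real.smoothTransition (deriv Real.smoothTransition (n + 1 - τ)) (n + 1 - τ) :=
    ((Real.smoothTransition.contDiff (n := 1)).differentiable (by simp) _).hasDerivAt
  have := (hs.comp τ h).deriv
  rw [show cutoff n = Real.smoothTransition ∘ fun τ : ℝ => (n : ℝ) + 1 - τ from rfl, this]
  ring

lemma deriv_cutoff_of_lt {n : ℕ} {τ : ℝ} (h : τ < n) : deriv (cutoff n) τ = 0 := by
  have : cutoff n =ᶠ[nhds τ] fun _ => 1 := by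
    filter_upwards [Iio_mem_nhds h] with x hx using cutoff_of_le (le_of_lt hx)
  rw [this.deriv_eq, deriv_const]

lemma exists_deriv_cutoff_bound : ∃ D, ∀ n τ, |deriv (cutoff n) τ| ≤ D := by
  have hcont : Continuous (deriv Real.smoothTransition) :=
    (Real.smoothTransition.contDiff (n := 1)).continuous_deriv (by simp)
  have hcs : HasCompactSupport (deriv Real.smoothTransition) := by
    refine HasCompactSupport.intro (isCompact_Icc (a := (0 : ℝ)) (b := 1)) fun x hx => ?_
    rw [Set.mem_Icc, not_and_or, not_le, not_le] at hx
    rcases hx with hx | hx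
    · have : Real.smoothTransition =ᶠ[nhds x] fun _ => 0 := by
        filter_upwards [Iio_mem_nhds hx] with y hy
          using Real.smoothTransition.zero_of_nonpos (le_of_lt hy)
      rw [this.deriv_eq, deriv_const]
    · have : Real.smoothTransition =ᶠ[nhds x] fun _ => 1 := by
        filter_upwards [Ioi_mem_nhds hx] with y hy
          using Real.smoothTransition.one_of_one_le (le_of_lt hy)
      rw [this.deriv_eq, deriv_const]
  obtain ⟨D, hD⟩ := hcs.exists_bound_of_continuous hcont
  exact ⟨D, fun n τ => by rw [deriv_cutoff, abs_neg]; exact hD _⟩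

/-- Solve ξ' + cξ = ψ with ‖ξ‖ ≤ ‖ψ‖/c and insert ξ into the hypothesis. As ξ has only exponential
decay at +∞, it is first cut off; the error ∫ wξ·(cutoff)' tends to 0 because wξ is integrable, and
this is where `hL` enters. -/
lemma abs_integral_mul_test_le {w : ℝ → ℝ} {a c K : ℝ} (ha : 0 < a) (hc : 0 < c) (hK : 0 ≤ K)
    (hL : MemLp (fun τ => Real.exp (a * τ) * w τ) 2 volume)
    (h : ∀ ξ, IsTest ξ → |∫ τ, w τ * (deriv ξ τ + c * ξ τ)| ≤ K * √(∫ τ, ξ τ ^ 2))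
    {ψ : ℝ → ℝ} (hψ : IsTest ψ) : |∫ τ, w τ * ψ τ| ≤ K / c * √(∫ τ, ψ τ ^ 2) := by
  obtain ⟨ξ, R, C, hξ, hd, h0, hC⟩ := exists_solution hψ c
  have hξL := memLp_of_le_exp hξ.continuous hc h0 hC
  have hle := integral_sq_solution_le hψ hc hξ hd hξL
  obtain ⟨S, hS0, hS⟩ := hψ.exists_bound
  obtain ⟨D, hD⟩ := exists_deriv_cutoff_bound
  have hloc : ∀ {f : ℝ → ℝ}, MemLp (fun τ => Real.exp (-a * τ) * f τ) 2 volume →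
      Integrable (fun τ => w τ * f τ) := fun {f} hf => by
    refine (hL.integrable_mul hf).congr (Filter.Eventually.of_forall fun τ => ?_)
    have h1 : Real.exp (a * τ) * Real.exp (-a * τ) = 1 := by rw [← Real.exp_add]; simp
    simp only [Pi.mul_apply]
    linear_combination w τ * f τ * h1
  have hwψ : Integrable (fun τ => w τ * ψ τ) := by
    have := hψ.mul_left (contDiff_exp_mul (-a))
    exact hloc (this.continuous.memLp_of_hasCompactSupport this.2)
  have hwξ : Integrable (fun τ => w τ * ξ τ) := by
    refine hloc (memLp_of_le_exp (((contDiff_exp_mul (-a)).mul hξ).continuous)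
      (c := a + c) (R := R) (C := C) (by linarith) (fun τ hτ => by simp [h0 τ hτ]) fun τ => ?_)
    rw [abs_mul, abs_of_pos (Real.exp_pos _)]
    calc Real.exp (-a * τ) * |ξ τ| ≤ Real.exp (-a * τ) * (C * Real.exp (-c * τ)) := by
          gcongr; exact hC τ
      _ = C * (Real.exp (-a * τ) * Real.exp (-c * τ)) := by ring
      _ = _ := by rw [← Real.exp_add]; ring_nf
  have hcut : ∀ n : ℕ, S < n →
      |(∫ τ, w τ * ψ τ) + ∫ τ, w τ * ξ τ * deriv (cutoff n) τ| ≤ K / c * √(∫ τ, ψ τ ^ 2) := by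
    intro n hn
    have ht : IsTest fun τ => cutoff n τ * ξ τ := by
      refine ⟨(contDiff_cutoff n).mul hξ, HasCompactSupport.intro
        (isCompact_Icc (a := R) (b := n + 1)) fun τ hτ => ?_⟩
      rw [Set.mem_Icc, not_and_or, not_le, not_le] at hτ
      rcases hτ with hτ | hτ
      · rw [h0 τ hτ, mul_zero]
      · rw [cutoff_of_ge hτ.le, zero_mul]
    have hder : ∀ τ, w τ * (deriv (fun τ => cutoff n τ * ξ τ) τ + c * (cutoff n τ * ξ τ))
        = w τ * ψ τ + w τ * ξ τ * deriv (cutoff n) τ := fun τ => by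
      have h1 := (((contDiff_cutoff n).differentiable (by simp) τ).hasDerivAt.mul
        (hξ.differentiable (by simp) τ).hasDerivAt).deriv
      have h2 : cutoff n τ * ψ τ = ψ τ := by
        rcases le_or_gt τ n with hτ | hτ
        · rw [cutoff_of_le hτ, one_mul]
        · rw [hS τ ((hn.trans hτ).trans_le (le_abs_self τ)), mul_zero]
      change w τ * (deriv (cutoff n * ξ) τ + _) = _
      rw [h1, hd]
      linear_combination w τ * h2
    have h3 := h _ ht
    simp_rw [hder] at h3
    rw [integral_add hwψ (hwξ.mul_bdd (c := D)
      ((contDiff_cutoff n).continuous_deriv (by simp)).aestronglyMeasurable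
      (Filter.Eventually.of_forall fun τ => hD n τ))] at h3
    have h4 : √(∫ τ, (cutoff n τ * ξ τ) ^ 2) ≤ √(∫ τ, ξ τ ^ 2) := by
      refine Real.sqrt_le_sqrt (integral_mono_of_nonneg
        (Filter.Eventually.of_forall fun τ => sq_nonneg _) hξL.integrable_sq
        (Filter.Eventually.of_forall fun τ => ?_))
      have h1 : cutoff n τ ≤ 1 := Real.smoothTransition.le_one _
      have h2 : 0 ≤ cutoff n τ := Real.smoothTransition.nonneg _
      have h5 : cutoff n τ ^ 2 ≤ 1 := pow_le_one₀ h2 h1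
      simp only [mul_pow]
      nlinarith [sq_nonneg (ξ τ)]
    calc _ ≤ K * √(∫ τ, (cutoff n τ * ξ τ) ^ 2) := h3
      _ ≤ K * √(∫ τ, ξ τ ^ 2) := by gcongr
      _ ≤ K * (√(∫ τ, ψ τ ^ 2) / c) := by
          gcongr; rw [le_div_iff₀ hc]; linarith
      _ = _ := by ring
  have hlim : Filter.Tendsto (fun n : ℕ => ∫ τ, w τ * ξ τ * deriv (cutoff n) τ) Filter.atTop
      (nhds (∫ _ : ℝ, (0 : ℝ))) := by
    refine tendsto_integral_of_dominated_convergence (fun τ => |w τ * ξ τ| * D)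
      (fun n => hwξ.aestronglyMeasurable.mul
        ((contDiff_cutoff n).continuous_deriv (by simp)).aestronglyMeasurable)
      (hwξ.abs.mul_const D) (fun n => Filter.Eventually.of_forall fun τ => ?_)
      (Filter.Eventually.of_forall fun τ => ?_)
    · rw [norm_mul, Real.norm_eq_abs, Real.norm_eq_abs]
      gcongr; exact hD n τ
    · refine tendsto_const_nhds.congr' ?_
      obtain ⟨N, hN⟩ := exists_nat_gt τ
      filter_upwards [Filter.eventually_ge_atTop N] with n hn
      rw [deriv_cutoff_of_lt (hN.trans_le (by exact_mod_cast hn)), mul_zero]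
  rw [integral_zero] at hlim
  have hlim' := (hlim.const_add (∫ τ, w τ * ψ τ)).abs
  rw [add_zero] at hlim'
  refine le_of_tendsto hlim' ?_
  obtain ⟨N, hN⟩ := exists_nat_gt S
  filter_upwards [Filter.eventually_ge_atTop N] with n hn
  exact hcut n (hN.trans_le (by exact_mod_cast hn))

/-- A locally square integrable function which defines an `L²`-bounded functional on the test
functions is in `L²`. -/
lemma integral_sq_le_of_dual {w : ℝ → ℝ} {K : ℝ} (hK : 0 ≤ K)
    (hw : ∀ n : ℕ, MemLp ((Set.Icc (-n : ℝ) n).indicator w) 2 volume)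
    (h : ∀ ψ, IsTest ψ → |∫ τ, w τ * ψ τ| ≤ K * √(∫ τ, ψ τ ^ 2)) (n : ℕ) :
    ∫ τ, (Set.Icc (-n : ℝ) n).indicator w τ ^ 2 ≤ K ^ 2 := by
  set v := (Set.Icc (-n : ℝ) n).indicator w with hv
  set v' := (Set.Icc (-((n + 2 : ℕ) : ℝ)) (n + 2 : ℕ)).indicator w with hv'
  set A := ∫ τ, v τ ^ 2 with hA
  have hA0 : 0 ≤ A := integral_nonneg fun _ => sq_nonneg _
  have hvL : MemLp v 2 volume := hw n
  have hv'L : MemLp v' 2 volume := hw (n + 2)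
  -- The approximants given by density have uncontrolled supports, and w is only locally in L².
  -- Multiplying by a fixed ζ confines them to [−n−2, n+2], so the norm of v' stays fixed as ε tends
  -- to 0.
  let ζ : ContDiffBump (0 : ℝ) := ⟨n + 1, n + 2, by positivity, by linarith⟩
  have hζ1 : ∀ τ, τ ∈ Set.Icc (-n : ℝ) n → ζ τ = 1 := fun τ hτ => by
    refine ζ.one_of_mem_closedBall ?_
    rw [mem_closedBall_zero_iff, Real.norm_eq_abs, abs_le]
    change -((n : ℝ) + 1) ≤ τ ∧ τ ≤ n + 1
    constructor <;> linarith [hτ.1, hτ.2]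
  have hζ0 : ∀ τ, τ ∉ Set.Icc (-((n + 2 : ℕ) : ℝ)) (n + 2 : ℕ) → ζ τ = 0 := fun τ hτ => by
    refine ζ.zero_of_le_dist ?_
    rw [dist_zero_right, Real.norm_eq_abs]
    change (n : ℝ) + 2 ≤ |τ|
    by_contra hlt
    rw [not_le, abs_lt] at hlt
    refine hτ ⟨?_, ?_⟩ <;> push_cast <;> linarith [hlt.1, hlt.2]
  have hle : ∀ ε : ℝ, 0 < ε → A ≤ K * (√A + ε) + √(∫ τ, v' τ ^ 2) * ε := by
    intro ε hε
    obtain ⟨ψ, hψc, hψs, hψε⟩ := hvL.exist_eLpNorm_sub_le (by simp) (by norm_num) hε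
    have hψt : IsTest ψ := ⟨hψs, hψc⟩
    have hψL : MemLp ψ 2 volume := hψt.continuous.memLp_of_hasCompactSupport hψc
    have hrL : MemLp (fun τ => v τ - ψ τ) 2 volume := hvL.sub hψL
    have hr : √(∫ τ, (v τ - ψ τ) ^ 2) ≤ ε := by
      rw [show v - ψ = fun τ => v τ - ψ τ from rfl, hrL.eLpNorm_eq_integral_rpow_norm (by simp)
        (by simp), ENNReal.ofReal_le_ofReal_iff hε.le] at hψε
      rw [Real.sqrt_eq_rpow]
      simpa using hψε
    have hζψ : IsTest fun τ => ζ τ * ψ τ := hψt.mul_left ζ.contDiff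
    have hζψL : MemLp (fun τ => ζ τ * ψ τ) 2 volume :=
      hζψ.continuous.memLp_of_hasCompactSupport hζψ.2
    have hζr : MemLp (fun τ => ζ τ * (v τ - ψ τ)) 2 volume := by
      have h1 : MemLp (fun τ => ζ τ * v τ) 2 volume := by
        convert hvL using 1
        funext τ
        by_cases hτ : τ ∈ Set.Icc (-n : ℝ) n
        · rw [hζ1 τ hτ, one_mul]
        · rw [hv, Set.indicator_of_notMem hτ, mul_zero]
      simp only [mul_sub]
      exact h1.sub hζψL
    have hζle : ∀ f : ℝ → ℝ, MemLp f 2 volume →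
        √(∫ τ, (ζ τ * f τ) ^ 2) ≤ √(∫ τ, f τ ^ 2) := fun f hf => by
      refine Real.sqrt_le_sqrt (integral_mono_of_nonneg
        (Filter.Eventually.of_forall fun τ => sq_nonneg _) hf.integrable_sq
        (Filter.Eventually.of_forall fun τ => ?_))
      have h5 : ζ τ ^ 2 ≤ 1 := pow_le_one₀ ζ.nonneg ζ.le_one
      simp only [mul_pow]
      nlinarith [sq_nonneg (f τ)]
    have hsplit : A = (∫ τ, w τ * (ζ τ * ψ τ)) + ∫ τ, v' τ * (ζ τ * (v τ - ψ τ)) := by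
      have e1 : ∀ τ, w τ * (ζ τ * ψ τ) = v' τ * (ζ τ * ψ τ) := fun τ => by
        by_cases hτ : τ ∈ Set.Icc (-((n + 2 : ℕ) : ℝ)) (n + 2 : ℕ)
        · rw [hv', Set.indicator_of_mem hτ]
        · rw [hζ0 τ hτ]; ring
      simp_rw [e1]
      have i1 : Integrable (fun τ => v' τ * (ζ τ * ψ τ)) := hv'L.integrable_mul hζψL
      have i2 : Integrable (fun τ => v' τ * (ζ τ * (v τ - ψ τ))) := hv'L.integrable_mul hζr
      rw [← integral_add i1 i2, hA]
      congr 1; funext τ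
      by_cases hτ : τ ∈ Set.Icc (-n : ℝ) n
      · have h2 : τ ∈ Set.Icc (-((n + 2 : ℕ) : ℝ)) (n + 2 : ℕ) := by
          push_cast; constructor <;> linarith [hτ.1, hτ.2]
        rw [hζ1 τ hτ, hv, hv', Set.indicator_of_mem hτ, Set.indicator_of_mem h2]; ring
      · rw [hv, Set.indicator_of_notMem hτ]; ring
    have hψA : √(∫ τ, ψ τ ^ 2) ≤ √A + ε := by
      rw [Real.sqrt_le_left (by positivity)]
      have e : ∀ τ, ψ τ ^ 2 = v τ ^ 2 + (-2 * (v τ * (v τ - ψ τ)) + 1 * (v τ - ψ τ) ^ 2) :=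
        fun τ => by ring
      have hvr : Integrable (fun τ => v τ * (v τ - ψ τ)) := hvL.integrable_mul hrL
      simp_rw [e]
      rw [integral_linear_combination hvL.integrable_sq hvr hrL.integrable_sq, ← hA]
      have hcs := abs_le.1 (abs_integral_mul_le hvL hrL)
      have hr2 := Real.sq_sqrt (integral_nonneg (μ := volume) fun τ => sq_nonneg (v τ - ψ τ))
      have hA2 := Real.sq_sqrt hA0
      rw [← hA] at hcs
      have h7 : √A * √(∫ τ, (v τ - ψ τ) ^ 2) ≤ √A * ε := by gcongr
      have h8 : √(∫ τ, (v τ - ψ τ) ^ 2) ^ 2 ≤ ε ^ 2 := by gcongr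
      nlinarith [hcs.1]
    have h1 := (le_abs_self _).trans (h _ hζψ)
    have h2 := (le_abs_self _).trans (abs_integral_mul_le hv'L hζr)
    calc A = _ := hsplit
      _ ≤ K * √(∫ τ, (ζ τ * ψ τ) ^ 2) + √(∫ τ, v' τ ^ 2) * √(∫ τ, (ζ τ * (v τ - ψ τ)) ^ 2) :=
          add_le_add h1 h2
      _ ≤ K * (√A + ε) + √(∫ τ, v' τ ^ 2) * ε := by
          gcongr
          · exact (hζle ψ hψL).trans hψA
          · exact (hζle _ hrL).trans hr
  have hfin : A ≤ K * √A := by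
    refine le_of_forall_pos_le_add fun δ hδ => ?_
    set B := √(∫ τ, v' τ ^ 2) with hB
    have hB0 : 0 ≤ B := Real.sqrt_nonneg _
    have := hle (δ / (K + B + 1)) (by positivity)
    have h3 : (K + B) * (δ / (K + B + 1)) ≤ δ := by
      rw [mul_div_assoc', div_le_iff₀ (by positivity)]
      nlinarith
    nlinarith
  have hs := Real.mul_self_sqrt hA0
  rcases (Real.sqrt_nonneg A).eq_or_lt with h0 | h0
  · rw [← hs, ← h0]; nlinarith
  · have : √A ≤ K := le_of_mul_le_mul_right (by linarith) h0
    rw [← hs]; nlinarith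

/-- Formally the hypothesis says ‖w' − cw‖ ≤ K. The condition `hL` at +∞ excludes the homogeneous
solution e^{cτ}, and inverting the operator costs 1/c. -/
lemma dual_hardy {w : ℝ → ℝ} (hwm : Measurable w) {a c K : ℝ} (ha : 0 < a) (hc : 0 < c)
    (hK : 0 ≤ K) (hL : MemLp (fun τ => Real.exp (a * τ) * w τ) 2 volume)
    (h : ∀ ξ, IsTest ξ → |∫ τ, w τ * (deriv ξ τ + c * ξ τ)| ≤ K * √(∫ τ, ξ τ ^ 2)) :
    Integrable (fun τ => w τ ^ 2) ∧ ∫ τ, w τ ^ 2 ≤ (K / c) ^ 2 := by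
  have hw : ∀ n : ℕ, MemLp ((Set.Icc (-n : ℝ) n).indicator w) 2 volume := fun n => by
    refine (hL.const_mul (Real.exp (a * n))).mono
      (hwm.indicator measurableSet_Icc).aestronglyMeasurable
      (Filter.Eventually.of_forall fun τ => ?_)
    by_cases hτ : τ ∈ Set.Icc (-n : ℝ) n
    · rw [Set.indicator_of_mem hτ, ← mul_assoc, norm_mul, ← Real.exp_add]
      have : 1 ≤ ‖Real.exp (a * n + a * τ)‖ := by
        rw [Real.norm_of_nonneg (Real.exp_pos _).le, Real.one_le_exp_iff]
        nlinarith [hτ.1]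
      nlinarith [norm_nonneg (w τ)]
    · rw [Set.indicator_of_notMem hτ, norm_zero]; exact norm_nonneg _
  have hb := integral_sq_le_of_dual (div_nonneg hK hc.le) hw
    fun ψ hψ => abs_integral_mul_test_le ha hc hK hL h hψ
  have hlint : ∫⁻ τ, ENNReal.ofReal (w τ ^ 2) ≤ ENNReal.ofReal ((K / c) ^ 2) := by
    have hf : ∀ n : ℕ, Measurable fun τ =>
        ENNReal.ofReal ((Set.Icc (-n : ℝ) n).indicator w τ ^ 2) :=
      fun n => ((hwm.indicator measurableSet_Icc).pow_const 2).ennreal_ofReal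
    refine (lintegral_mono fun τ => ?_).trans
      ((lintegral_liminf_le (μ := volume) (u := Filter.atTop) hf).trans ?_)
    · refine le_of_eq (Filter.Tendsto.liminf_eq (tendsto_const_nhds.congr' ?_)).symm
      obtain ⟨N, hN⟩ := exists_nat_gt |τ|
      filter_upwards [Filter.eventually_ge_atTop N] with n hn
      have : |τ| ≤ n := hN.le.trans (by exact_mod_cast hn)
      rw [Set.indicator_of_mem (Set.mem_Icc.2 (abs_le.1 this))]
    · refine Filter.liminf_le_of_le (by isBoundedDefault) fun b hb' => ?_
      obtain ⟨n, hn⟩ := hb'.exists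
      refine hn.trans ?_
      rw [← ofReal_integral_eq_lintegral_ofReal (hw n).integrable_sq
        (Filter.Eventually.of_forall fun _ => sq_nonneg _)]
      exact ENNReal.ofReal_le_ofReal (hb n)
  have hi : Integrable (fun τ => w τ ^ 2) := by
    refine ⟨(hwm.pow_const 2).aestronglyMeasurable, ?_⟩
    rw [hasFiniteIntegral_iff_ofReal (Filter.Eventually.of_forall fun _ => sq_nonneg _)]
    exact hlint.trans_lt ENNReal.ofReal_lt_top
  refine ⟨hi, ?_⟩
  rw [← ofReal_integral_eq_lintegral_ofReal hi (Filter.Eventually.of_forall fun _ => sq_nonneg _),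
    ENNReal.ofReal_le_ofReal_iff (sq_nonneg _)] at hlint
  exact hlint


/-! ### Radial functions and their Hardy inequality -/

lemma absZ_sq (p : Space d) : absZ p ^ 2 = sqZ p := by
  rw [absZ, Real.sq_sqrt (Finset.sum_nonneg fun _ _ => by positivity), sqZ]
  refine Finset.sum_congr rfl fun j _ => ?_
  rw [Complex.sq_norm, Complex.normSq_apply]; ring

lemma koranyi_eq (p : Space d) : koranyi p = gauge p ^ (1 / 4 : ℝ) := by
  rw [koranyi, gauge, ← absZ_sq]; ring_nf

lemma koranyi_pow_four (p : Space d) : koranyi p ^ 4 = gauge p := by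
  rw [koranyi_eq, ← Real.rpow_natCast, ← Real.rpow_mul (gauge_nonneg p)]
  norm_num

/-- A measurable radial function has a measurable profile. -/
lemma IsRadial.exists_measurable [NeZero d] {u : Space d → ℂ} (h : IsRadial u)
    (hu : AEStronglyMeasurable u volume) :
    ∃ g : ℝ → ℂ, Measurable g ∧ u =ᵐ[volume] fun p => g (logGauge p) := by
  obtain ⟨g₀, hg₀⟩ := h
  set v := hu.mk u with hv
  have hvm : Measurable v := hu.stronglyMeasurable_mk.measurable
  have h1 : ∀ᵐ p : Space d, v p = g₀ (koranyi p) ∧ 0 < gauge p := by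
    filter_upwards [hu.ae_eq_mk, hg₀, ae_gauge_pos] with p h1 h2 h3
    exact ⟨by rw [hv, ← h1, h2], h3⟩
  have h2 : ∀ᵐ x ∂(radial d).prod (angular d),
      v (polar x) = g₀ (Real.exp x.1 ^ (1 / 4 : ℝ)) := by
    filter_upwards [measurePreserving_polar.quasiMeasurePreserving.ae h1, ae_polar_logGauge]
      with x hx hx'
    rw [hx.1, koranyi_eq, gauge_eq_exp hx.2, hx']
  have h3 : ∀ᵐ q ∂(angular d), ∀ᵐ τ ∂(radial d),
      v (polar (τ, q)) = g₀ (Real.exp τ ^ (1 / 4 : ℝ)) :=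
    Measure.ae_ae_of_ae_prod (Measure.measurePreserving_swap.quasiMeasurePreserving.ae h2)
  have : NeZero (angular d) := ⟨angular_ne_zero⟩
  -- The given profile g₀ need not be measurable. By Fubini it agrees a.e. with the measurable
  -- function v along almost every ray, and one such ray supplies a measurable profile.
  obtain ⟨q, hq⟩ := h3.exists
  have hgm : Measurable fun τ => v (polar (τ, q)) :=
    hvm.comp (measurable_polar.comp measurable_prodMk_right)
  refine ⟨fun τ => v (polar (τ, q)), hgm, hu.ae_eq_mk.trans ?_⟩
  have hset : MeasurableSet {p : Space d | v p = (fun τ => v (polar (τ, q))) (logGauge p)} :=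
    measurableSet_eq_fun hvm (hgm.comp measurable_logGauge)
  have h4 : ∀ᵐ x ∂(radial d).prod (angular d),
      v (polar x) = (fun τ => v (polar (τ, q))) (logGauge (polar x)) := by
    filter_upwards [h2, Measure.quasiMeasurePreserving_fst.ae hq, ae_polar_logGauge]
      with x hx hx1 hx2
    rw [hx2, hx]
    exact hx1.symm
  change ∀ᵐ p : Space d, v p = (fun τ => v (polar (τ, q))) (logGauge p)
  rw [← measurePreserving_polar.map_eq]
  exact (ae_map_iff measurable_polar.aemeasurable hset).2 h4

lemma sq_sum_integral_mul_le {α ι : Type*} [MeasurableSpace α] {μ : Measure α} (s : Finset ι)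
    {f g : ι → α → ℝ} (hf : ∀ k, MemLp (f k) 2 μ) (hg : ∀ k, MemLp (g k) 2 μ) :
    |∑ k ∈ s, ∫ x, f k x * g k x ∂μ|
      ≤ √(∑ k ∈ s, ∫ x, f k x ^ 2 ∂μ) * √(∑ k ∈ s, ∫ x, g k x ^ 2 ∂μ) := by
  refine (Finset.abs_sum_le_sum_abs _ _).trans
    ((Finset.sum_le_sum fun k _ => abs_integral_mul_le (hf k) (hg k)).trans ?_)
  exact Real.sum_sqrt_mul_sqrt_le _ (fun k => integral_nonneg fun _ => sq_nonneg _)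
    (fun k => integral_nonneg fun _ => sq_nonneg _)

lemma integrable_exp_mul_norm_sq [NeZero d] {u : Space d → ℂ} {g : ℝ → ℂ}
    (hu : MemLp u 2 volume) (hg : Measurable g) (hug : u =ᵐ[volume] fun p => g (logGauge p)) :
    Integrable (fun τ => Real.exp (growth d * τ) * ‖g τ‖ ^ 2) := by
  have h1 : Integrable (fun p : Space d => ((‖g (logGauge p)‖ ^ 2 : ℝ) : ℂ)) := by
    refine (hu.integrable_norm_pow (by norm_num)).ofReal.congr ?_
    filter_upwards [hug] with p hp
    simp [hp]
  rw [integrable_logGauge_iff (h := fun τ => ((‖g τ‖ ^ 2 : ℝ) : ℂ))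
    (Complex.measurable_ofReal.comp (hg.norm.pow_const 2))] at h1
  refine h1.re.congr (Filter.Eventually.of_forall fun τ => ?_)
  beta_reduce
  rw [← Complex.ofReal_mul]
  exact Complex.ofReal_re _

/-- The radial weak derivative, tested against `exp (d τ / 4) ξ`. -/
lemma integral_grad_radial [NeZero d] {u : Space d → ℂ}
    {gr : Fin d ⊕ Fin d → Space d → ℂ} {g : ℝ → ℂ} (hu : WeakPair u gr) (hg : Measurable g)
    (hug : u =ᵐ[volume] fun p => g (logGauge p)) {ξ : ℝ → ℝ} (hξ : IsTest ξ) :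
    ∫ p, (∑ k, gr k p * hGauge k p)
        * radialTest 0 (fun τ => Real.exp (-(1 + d / 4) * τ) * ξ τ) p
      = -(16 * moment d 1 * pair g (d / 4) (fun τ => deriv ξ τ + d / 4 * ξ τ)) := by
  -- This exponent makes the squared L² norm of the test field 16m₁∫ξ², without weight, and turns
  -- the pairing into one with w = e^{dτ/4}g.
  set s : ℝ := -(1 + d / 4) with hs
  have hd : deriv (fun τ => Real.exp (s * τ) * ξ τ)
      = fun τ => Real.exp (s * τ) * (s * ξ τ + deriv ξ τ) := by
    funext τ
    have := (((hasDerivAt_id τ).const_mul s).exp).mul (hξ.hasDerivAt τ)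
    refine this.deriv.trans ?_
    simp; ring
  have hlin : ∀ a : ℝ, pair g (d / 4) (fun τ => a * ξ τ + deriv ξ τ)
      = a * pair g (d / 4) ξ + pair g (d / 4) (deriv ξ) := fun a => by
    rw [pair, pair, pair, ← integral_const_mul, ← integral_add
      ((integrable_pair hu.fn hg hug hξ _).const_mul _)
      (integrable_pair hu.fn hg hug hξ.isTest_deriv _)]
    congr 1; funext τ; push_cast; ring
  have hκ : growth d + ((0 : ℕ) + 1) / 2 + s = d / 4 := by rw [hs, growth]; push_cast; ring
  rw [hu.integral_hGauge_radial hg hug (hξ.mul_left (contDiff_exp_mul s)), hd, pair_exp_mul,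
    pair_exp_mul, hκ, hlin, show (fun τ => deriv ξ τ + d / 4 * ξ τ)
      = fun τ => (d / 4 : ℝ) * ξ τ + deriv ξ τ from funext fun _ => add_comm _ _, hlin, hs]
  push_cast
  ring

lemma sum_integral_hGauge_sq [NeZero d] {ξ : ℝ → ℝ} (hξ : IsTest ξ) :
    ∑ k, ∫ p : Space d, (hGauge k p
        * radialTest 0 (fun τ => Real.exp (-(1 + d / 4) * τ) * ξ τ) p) ^ 2
      = 16 * moment d 1 * ∫ τ, ξ τ ^ 2 := by
  have ht := hξ.mul_left (contDiff_exp_mul (-(1 + d / 4)))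
  have hi : ∀ k, Integrable (fun p : Space d => (hGauge k p
      * radialTest 0 (fun τ => Real.exp (-(1 + d / 4) * τ) * ξ τ) p) ^ 2) volume := fun k =>
    (((contDiff_hGauge k).continuous.mul (ht.contDiff_radialTest 0).continuous).pow
      2).integrable_of_hasCompactSupport (by
        simpa only [pow_two] using (ht.hasCompactSupport_radialTest 0).mul_left.mul_left)
  rw [← integral_finsetSum _ fun k _ => hi k]
  have e : ∀ᵐ p : Space d, ((∑ k, (hGauge k p
        * radialTest 0 (fun τ => Real.exp (-(1 + d / 4) * τ) * ξ τ) p) ^ 2 : ℝ) : ℂ)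
      = (fun τ => ((16 * (Real.exp (-growth d * τ) * ξ τ ^ 2) : ℝ) : ℂ)) (logGauge p)
        * ((slope p ^ 1 : ℝ) : ℂ) := by
    filter_upwards [ae_gauge_pos] with p hp
    have h1 : ∀ k : Fin d ⊕ Fin d, (hGauge k p
        * radialTest 0 (fun τ => Real.exp (-(1 + d / 4) * τ) * ξ τ) p) ^ 2
        = (hGauge k p * hGauge k p)
          * radialTest 0 (fun τ => Real.exp (-(1 + d / 4) * τ) * ξ τ) p ^ 2 := fun k => by ring
    rw [Finset.sum_congr rfl fun k _ => h1 k, ← Finset.sum_mul, sum_hGauge_hGauge,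
      radialTest_eq _ _ hp, sqZ_eq hp, gauge_eq_exp hp, ← Complex.ofReal_mul]
    congr 1
    have h2 : Real.exp (-growth d * logGauge p) = Real.exp (logGauge p / 2)
        * Real.exp (logGauge p) * Real.exp (-(1 + d / 4) * logGauge p) ^ 2 := by
      rw [← Real.exp_nat_mul, ← Real.exp_add, ← Real.exp_add, growth]
      congr 1; push_cast; ring
    rw [h2]
    simp
    ring
  have hm : Measurable fun τ : ℝ => ((16 * (Real.exp (-growth d * τ) * ξ τ ^ 2) : ℝ) : ℂ) :=
    Complex.measurable_ofReal.comp
      ((((contDiff_exp_mul _).continuous.mul (hξ.continuous.pow 2)).measurable).const_mul 16)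
  have h := integral_logGauge_mul_slope (d := d) hm 1
  rw [← integral_congr_ae e, integral_complex_ofReal] at h
  have e2 : ∀ τ, (Real.exp (growth d * τ) : ℂ)
      * ((16 * (Real.exp (-growth d * τ) * ξ τ ^ 2) : ℝ) : ℂ) = ((16 * ξ τ ^ 2 : ℝ) : ℂ) := by
    intro τ
    have h3 : Real.exp (growth d * τ) * Real.exp (-growth d * τ) = 1 := by
      rw [← Real.exp_add]; simp
    rw [← Complex.ofReal_mul]
    congr 1
    linear_combination 16 * ξ τ ^ 2 * h3
  simp_rw [e2] at h
  rw [integral_complex_ofReal, integral_const_mul, ← Complex.ofReal_mul] at h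
  have := Complex.ofReal_injective h
  rw [this]; ring

/-- Hardy's inequality for a real component `L u` of a radial function. -/
lemma hardy_component [NeZero d] (u : H1 d) {g : ℝ → ℂ} (hg : Measurable g)
    (hug : u.fn =ᵐ[volume] fun p => g (logGauge p)) (L : ℂ →L[ℝ] ℝ) (hL : ∀ z, |L z| ≤ ‖z‖) :
    Integrable (fun τ => Real.exp (d / 2 * τ) * L (g τ) ^ 2) ∧
      d ^ 2 * moment d 1 * ∫ τ, Real.exp (d / 2 * τ) * L (g τ) ^ 2
        ≤ ∑ k, ∫ p, L (u.grad k p) ^ 2 := by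
  set EL := ∑ k, ∫ p, L (u.grad k p) ^ 2 with hEL
  have hM := moment_pos (d := d) 1
  have hd : (0 : ℝ) < d := by exact_mod_cast NeZero.pos d
  have hEL0 : 0 ≤ EL := Finset.sum_nonneg fun k _ => integral_nonneg fun _ => sq_nonneg _
  have hLg : Measurable fun τ => L (g τ) := L.continuous.measurable.comp hg
  have hwm : Measurable fun τ => Real.exp (d / 4 * τ) * L (g τ) :=
    (contDiff_exp_mul _).continuous.measurable.mul hLg
  have hw2 : ∀ τ, (Real.exp (d / 4 * τ) * L (g τ)) ^ 2
      = Real.exp (d / 2 * τ) * L (g τ) ^ 2 := fun τ => by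
    rw [mul_pow, ← Real.exp_nat_mul]
    congr 2; push_cast; ring
  -- The product of the two exponentials is the square root of the polar density e^{(d+1)τ/2}, so
  -- this is u ∈ L²; it provides the condition at +∞ required by `dual_hardy`.
  have hmem : MemLp (fun τ => Real.exp (1 / 4 * τ) * (Real.exp (d / 4 * τ) * L (g τ))) 2
      volume := by
    have hm : Measurable fun τ =>
        Real.exp (1 / 4 * τ) * (Real.exp (d / 4 * τ) * L (g τ)) :=
      (contDiff_exp_mul (1 / 4)).continuous.measurable.mul hwm
    rw [memLp_two_iff_integrable_sq hm.aestronglyMeasurable]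
    refine (integrable_exp_mul_norm_sq u.memLp_fn hg hug).mono'
      (hm.pow_const 2).aestronglyMeasurable (Filter.Eventually.of_forall fun τ => ?_)
    rw [Real.norm_of_nonneg (sq_nonneg _)]
    have : Real.exp (growth d * τ) = Real.exp (1 / 4 * τ) ^ 2 * Real.exp (d / 4 * τ) ^ 2 := by
      rw [← Real.exp_nat_mul, ← Real.exp_nat_mul, ← Real.exp_add, growth]
      congr 1; push_cast; ring
    rw [this, mul_pow, mul_pow, mul_assoc, ← sq_abs (L (g τ))]
    gcongr; exact hL _
  have hdual : ∀ ξ, IsTest ξ →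
      |∫ τ, Real.exp (d / 4 * τ) * L (g τ) * (deriv ξ τ + d / 4 * ξ τ)|
        ≤ √(EL / (16 * moment d 1)) * √(∫ τ, ξ τ ^ 2) := by
    intro ξ hξ
    have ht := hξ.mul_left (contDiff_exp_mul (-(1 + d / 4)))
    set v : Space d → ℝ := radialTest 0 fun τ => Real.exp (-(1 + d / 4) * τ) * ξ τ with hv
    have hLr : ∀ (z : ℂ) (r : ℝ), L (z * r) = L z * r := fun z r => by
      rw [mul_comm z, ← Complex.real_smul, map_smul, smul_eq_mul, mul_comm]
    have hξ' : IsTest fun τ => deriv ξ τ + d / 4 * ξ τ :=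
      ⟨hξ.isTest_deriv.1.add (contDiff_const.mul hξ.1), hξ.isTest_deriv.2.add hξ.2.mul_left⟩
    have hcc : ∀ k : Fin d ⊕ Fin d, Continuous (fun p => hGauge k p * v p) ∧
        HasCompactSupport (fun p => hGauge k p * v p) := fun k =>
      ⟨(contDiff_hGauge k).continuous.mul (ht.contDiff_radialTest 0).continuous,
        (ht.hasCompactSupport_radialTest 0).mul_left⟩
    have hik : ∀ k : Fin d ⊕ Fin d,
        Integrable (fun p => u.grad k p * ((hGauge k p * v p : ℝ) : ℂ)) volume := fun k => by
      simpa using (u.weakPair.grad k).integrable_smul_right_of_hasCompactSupport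
        (Complex.continuous_ofReal.comp (hcc k).1) (hasCompactSupport_ofReal_comp (hcc k).2)
    have h1 := integral_grad_radial u.weakPair hg hug hξ
    have h2 : ∫ p, (∑ k, u.grad k p * hGauge k p) * (v p : ℂ)
        = ∑ k, ∫ p, u.grad k p * ((hGauge k p * v p : ℝ) : ℂ) := by
      rw [← integral_finsetSum _ fun k _ => hik k]
      congr 1; funext p; rw [Finset.sum_mul]; push_cast
      exact Finset.sum_congr rfl fun k _ => by ring
    rw [h2] at h1
    have h3 := congrArg L h1
    have hpair : L (pair g (d / 4) fun τ => deriv ξ τ + d / 4 * ξ τ)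
        = ∫ τ, Real.exp (d / 4 * τ) * L (g τ) * (deriv ξ τ + d / 4 * ξ τ) := by
      rw [pair, ← L.integral_comp_comm (integrable_pair u.weakPair.fn hg hug hξ' _)]
      congr 1; funext τ
      rw [hLr]; ring
    have h4 : L (-(16 * moment d 1 * pair g (d / 4) fun τ => deriv ξ τ + d / 4 * ξ τ))
        = -(16 * moment d 1
          * ∫ τ, Real.exp (d / 4 * τ) * L (g τ) * (deriv ξ τ + d / 4 * ξ τ)) := by
      rw [map_neg, ← hpair, mul_comm (16 * moment d 1 : ℝ), ← hLr]
      congr 2; push_cast; ring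
    rw [h4, map_sum] at h3
    have h5 : ∀ k, L (∫ p, u.grad k p * ((hGauge k p * v p : ℝ) : ℂ))
        = ∫ p, L (u.grad k p) * (hGauge k p * v p) := fun k => by
      rw [← L.integral_comp_comm (hik k)]
      congr 1; funext p; rw [hLr]
    simp_rw [h5] at h3
    have h6 := sq_sum_integral_mul_le (μ := (volume : Measure (Space d))) Finset.univ
      (f := fun k p => L (u.grad k p)) (g := fun k p => hGauge k p * v p)
      (fun k => L.comp_memLp' (u.memLp_grad k))
      (fun k => (hcc k).1.memLp_of_hasCompactSupport (hcc k).2)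
    rw [h3, abs_neg, abs_mul, abs_of_pos (by positivity), sum_integral_hGauge_sq hξ, ← hEL,
      Real.sqrt_mul (by positivity)] at h6
    rw [Real.sqrt_div hEL0, div_mul_eq_mul_div, le_div_iff₀ (by positivity)]
    have h7 := Real.mul_self_sqrt (show (0 : ℝ) ≤ 16 * moment d 1 by positivity)
    refine le_of_mul_le_mul_right ?_ (show 0 < √(16 * moment d 1) by positivity)
    calc _ = (√(16 * moment d 1) * √(16 * moment d 1))
          * |∫ τ, Real.exp (d / 4 * τ) * L (g τ) * (deriv ξ τ + d / 4 * ξ τ)| := by ring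
      _ ≤ _ := by rw [h7]; linarith
  -- With K² = EL/(16m₁) and c = d/4 the bound (K/c)² equals EL/(d²m₁), the Hardy constant d².
  have h := dual_hardy hwm (a := 1 / 4) (c := d / 4) (by norm_num) (by positivity)
    (Real.sqrt_nonneg _) hmem hdual
  simp_rw [hw2] at h
  refine ⟨h.1, ?_⟩
  have h8 := h.2
  rw [div_pow, Real.sq_sqrt (by positivity)] at h8
  calc d ^ 2 * moment d 1 * ∫ τ, Real.exp (d / 2 * τ) * L (g τ) ^ 2
      ≤ d ^ 2 * moment d 1 * (EL / (16 * moment d 1) / (d / 4) ^ 2) := by gcongr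
    _ = EL := by field_simp; norm_num

/-- The Dirichlet energy as a real number. -/
noncomputable def realEnergy (u : H1 d) : ℝ := ∫ p, ∑ k, ‖u.grad k p‖ ^ 2

lemma integrable_grad_sq (u : H1 d) (k : Fin d ⊕ Fin d) :
    Integrable (fun p => ‖u.grad k p‖ ^ 2) volume :=
  (u.memLp_grad k).integrable_norm_pow (by norm_num)

lemma realEnergy_eq_sum (u : H1 d) : realEnergy u = ∑ k, ∫ p, ‖u.grad k p‖ ^ 2 :=
  integral_finsetSum _ fun k _ => integrable_grad_sq u k

lemma realEnergy_nonneg (u : H1 d) : 0 ≤ realEnergy u :=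
  integral_nonneg fun _ => Finset.sum_nonneg fun _ _ => by positivity

lemma energy_eq (u : H1 d) : energy u = ENNReal.ofReal (realEnergy u) := by
  rw [realEnergy, ofReal_integral_eq_lintegral_ofReal
    (integrable_finsetSum _ fun k _ => integrable_grad_sq u k)
    (Filter.Eventually.of_forall fun _ => Finset.sum_nonneg fun _ _ => by positivity), energy]
  congr 1; funext p
  rw [ENNReal.ofReal_sum_of_nonneg fun _ _ => by positivity]
  refine Finset.sum_congr rfl fun k _ => ?_
  rw [ENNReal.ofReal_pow (norm_nonneg _), ofReal_norm]

/-- Hardy's inequality for radial functions. -/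
lemma hardy_radial [NeZero d] (u : H1 d) {g : ℝ → ℂ} (hg : Measurable g)
    (hug : u.fn =ᵐ[volume] fun p => g (logGauge p)) :
    Integrable (fun τ => Real.exp (d / 2 * τ) * ‖g τ‖ ^ 2) ∧
      d ^ 2 * (moment d 1 * ∫ τ, Real.exp (d / 2 * τ) * ‖g τ‖ ^ 2) ≤ realEnergy u := by
  obtain ⟨h1, h1'⟩ := hardy_component u hg hug Complex.reCLM Complex.abs_re_le_norm
  obtain ⟨h2, h2'⟩ := hardy_component u hg hug Complex.imCLM Complex.abs_im_le_norm
  have e : ∀ z : ℂ, ‖z‖ ^ 2 = Complex.reCLM z ^ 2 + Complex.imCLM z ^ 2 := fun z => by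
    rw [Complex.sq_norm, Complex.normSq_apply, Complex.reCLM_apply, Complex.imCLM_apply]; ring
  have e' : ∀ τ, Real.exp (d / 2 * τ) * ‖g τ‖ ^ 2
      = Real.exp (d / 2 * τ) * Complex.reCLM (g τ) ^ 2
        + Real.exp (d / 2 * τ) * Complex.imCLM (g τ) ^ 2 := fun τ => by rw [e]; ring
  simp_rw [e']
  refine ⟨h1.add h2, ?_⟩
  rw [integral_add h1 h2, realEnergy_eq_sum]
  have e2 : ∀ k, ∫ p, ‖u.grad k p‖ ^ 2
      = (∫ p, Complex.reCLM (u.grad k p) ^ 2) + ∫ p, Complex.imCLM (u.grad k p) ^ 2 := fun k => by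
    have i1 : Integrable (fun p => Complex.reCLM (u.grad k p) ^ 2) volume :=
      (Complex.reCLM.comp_memLp' (u.memLp_grad k)).integrable_sq
    have i2 : Integrable (fun p => Complex.imCLM (u.grad k p) ^ 2) volume :=
      (Complex.imCLM.comp_memLp' (u.memLp_grad k)).integrable_sq
    rw [← integral_add i1 i2]
    congr 1; funext p; exact e _
  simp_rw [e2, Finset.sum_add_distrib]
  linarith


/-! ### The numerical inequalities -/

/-- Without √δ/(2γ) the root equals the first summand; without γ√δ the sum is 2(8d+2)/(4d). Both
omitted terms are nonnegative. -/
lemma constK_ge {d : ℕ} (hd : 1 ≤ d) {δ : ℝ} : (4 * d + 1 : ℝ) / d ≤ constK d δ := by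
  have hd' : (0 : ℝ) < d := by exact_mod_cast hd
  refine le_csInf ((Set.nonempty_Ioi).image _) ?_
  rintro _ ⟨γ, hγ, rfl⟩
  have hγ' : (0 : ℝ) < γ := hγ
  set x : ℝ := (8 * d + 2 + γ * √δ) / (4 * d) with hx
  have hx0 : 0 ≤ x := by positivity
  have h1 : x ≤ √((8 * d + 2 + γ * √δ) ^ 2 / (16 * (d : ℝ) ^ 2) + √δ / (2 * γ)) := by
    refine Real.le_sqrt_of_sq_le ?_
    have : x ^ 2 = (8 * d + 2 + γ * √δ) ^ 2 / (16 * (d : ℝ) ^ 2) := by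
      rw [hx, div_pow]; ring
    rw [this]
    have : 0 ≤ √δ / (2 * γ) := by positivity
    linarith
  have h2 : (4 * d + 1 : ℝ) / d ≤ 2 * x := by
    rw [hx, div_le_iff₀ hd']
    field_simp
    have : 0 ≤ γ * √δ := by positivity
    linarith
  simp only
  linarith

/-- The second entry of the maximum suffices. -/
lemma kappa_ge {d : ℕ} (hd : 1 ≤ d) : (4 * d + 1 : ℝ) / d ^ 2 ≤ kappa d := by
  have hd' : (0 : ℝ) < d := by exact_mod_cast hd
  refine le_csInf ((Set.nonempty_Ioi).image _) ?_
  rintro _ ⟨δ, _, rfl⟩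
  refine le_trans ?_ (le_max_right _ _)
  rw [pow_two, ← div_div]
  gcongr
  exact constK_ge hd

lemma mul_lt_of_lt_kappa {d : ℕ} (hd : 1 ≤ d) {b : ℝ} (hb : b < 1 / (d * kappa d)) :
    b * (4 * d + 1) < d := by
  have hd' : (0 : ℝ) < d := by exact_mod_cast hd
  have h1 : (4 * d + 1 : ℝ) / d ≤ d * kappa d := by
    calc (4 * d + 1 : ℝ) / d = d * ((4 * d + 1) / d ^ 2) := by field_simp
      _ ≤ _ := by gcongr; exact kappa_ge hd
  have h2 : 1 / (d * kappa d) ≤ 1 / ((4 * d + 1 : ℝ) / d) := by gcongr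
  have h3 := hb.trans_le h2
  rwa [one_div_div, lt_div_iff₀ (by positivity)] at h3

/-- Cauchy–Schwarz for s² = s^{1/2}·s^{3/2}. The recurrence goes in steps of two, so this is what
links the even moments to the odd ones. -/
lemma moment_two_sq_le : moment d 2 ^ 2 ≤ moment d 1 * moment d 3 := by
  have hm : ∀ {f : Space d → ℝ}, Measurable f → (∀ q, 0 ≤ f q) → (∀ q, f q ≤ 1) →
      MemLp f 2 (angular d) := fun {f} hf h0 h1 =>
    MemLp.of_bound hf.aestronglyMeasurable 1 (Filter.Eventually.of_forall fun q => by
      rw [Real.norm_of_nonneg (h0 q)]; exact h1 q)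
  have hs : Measurable fun q : Space d => √(slope q) :=
    Real.continuous_sqrt.measurable.comp measurable_slope
  have h1 : ∀ q : Space d, √(slope q) ≤ 1 := fun q => Real.sqrt_le_one.2 (slope_le_one q)
  have h := sq_integral_mul_le (μ := angular d)
    (hm hs (fun q => Real.sqrt_nonneg _) h1)
    (hm (measurable_slope.mul hs) (fun q => mul_nonneg (slope_nonneg q) (Real.sqrt_nonneg _))
      fun q => mul_le_one₀ (slope_le_one q) (Real.sqrt_nonneg _) (h1 q))
  have hsq : ∀ q : Space d, √(slope q) ^ 2 = slope q := fun q => Real.sq_sqrt (slope_nonneg q)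
  have e1 : ∀ q : Space d, √(slope q) * (slope q * √(slope q)) = slope q ^ 2 := fun q => by
    linear_combination slope q * hsq q
  have e2 : ∀ q : Space d, (slope q * √(slope q)) ^ 2 = slope q ^ 3 := fun q => by
    linear_combination slope q ^ 2 * hsq q
  simp only [Pi.mul_apply, e1, e2, hsq] at h
  simpa [moment] using h

/-- The inequality between moments which excludes nonzero eigenvalues. -/
lemma moment_inequality [NeZero d] :
    moment d 0 ^ 2 * (moment d 4 ^ 2 * moment d 3 - 2 * moment d 4 * moment d 2 * moment d 5
        + moment d 2 ^ 2 * moment d 7)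
      ≤ 16 * d ^ 2 * moment d 1 * (moment d 4 * moment d 1 - moment d 2 * moment d 3) ^ 2 := by
  have hd : (1 : ℝ) ≤ d := by exact_mod_cast NeZero.pos d
  have h1 := moment_pos (d := d) 1
  have h0 := moment_pos (d := d) 0
  have r0 := moment_recurrence (d := d) 0
  have r1 := moment_recurrence (d := d) 1
  have r2 := moment_recurrence (d := d) 2
  have r3 := moment_recurrence (d := d) 3
  have r5 := moment_recurrence (d := d) 5
  have hc := moment_two_sq_le (d := d)
  push_cast at r0 r1 r2 r3 r5
  norm_num at r0 r1 r2 r3 r5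
  generalize moment d 0 = m0 at *
  generalize moment d 1 = m1 at *
  generalize moment d 2 = m2 at *
  generalize moment d 3 = m3 at *
  generalize moment d 4 = m4 at *
  generalize moment d 5 = m5 at *
  generalize moment d 7 = m7 at *
  generalize (d : ℝ) = x at *
  have e2 : m2 = x / (x + 1) * m0 := by field_simp; linarith
  have e3 : m3 = (x + 1) / (x + 2) * m1 := by field_simp; linarith
  have e4 : m4 = (x + 2) / (x + 3) * m2 := by field_simp; linarith
  have e5 : m5 = (x + 3) / (x + 4) * m3 := by field_simp; linarith
  have e7 : m7 = (x + 5) / (x + 6) * m5 := by field_simp; linarith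
  have hm : x ^ 2 * (x + 2) * m0 ^ 2 ≤ (x + 1) ^ 3 * m1 ^ 2 := by
    rw [e3, e2] at hc
    have : x ^ 2 * (x + 2) * m0 ^ 2
        = (x / (x + 1) * m0) ^ 2 * ((x + 1) ^ 2 * (x + 2)) := by field_simp
    rw [this]
    calc _ ≤ (m1 * ((x + 1) / (x + 2) * m1)) * ((x + 1) ^ 2 * (x + 2)) := by gcongr
      _ = _ := by field_simp
  -- This quantity is the integral of s(m₄s − m₂s³)² over the angular measure, written in closed
  -- form by the recurrence.
  have hl : m4 ^ 2 * m3 - 2 * m4 * m2 * m5 + m2 ^ 2 * m7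
      = m1 * m2 ^ 2 * ((x + 1) * (2 * x ^ 2 + 10 * x + 15)
        / ((x + 2) * (x + 3) ^ 2 * (x + 4) * (x + 6))) := by
    rw [e7, e5, e4, e3]; field_simp; ring
  have hr : m4 * m1 - m2 * m3 = m1 * m2 / ((x + 2) * (x + 3)) := by
    rw [e4, e3]; field_simp; ring
  have hp : (x + 1) ^ 4 * (2 * x ^ 2 + 10 * x + 15) ≤ 16 * x ^ 4 * (x + 4) * (x + 6) := by
    -- Expanded about x = 1 the difference has nonnegative coefficients; this uses d ≥ 1.
    obtain ⟨y, rfl⟩ : ∃ y, x = 1 + y := ⟨x - 1, by ring⟩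
    have hy : 0 ≤ y := by linarith
    have : 0 ≤ 16 * (1 + y) ^ 4 * (1 + y + 4) * (1 + y + 6)
        - (1 + y + 1) ^ 4 * (2 * (1 + y) ^ 2 + 10 * (1 + y) + 15) := by
      ring_nf; positivity
    linarith
  rw [hl, hr]
  have hkey : m0 ^ 2 * ((x + 1) * (2 * x ^ 2 + 10 * x + 15) * (x + 2))
      ≤ 16 * x ^ 2 * m1 ^ 2 * ((x + 4) * (x + 6)) := by
    refine le_of_mul_le_mul_left ?_ (show 0 < x ^ 2 * (x + 1) ^ 3 by positivity)
    calc x ^ 2 * (x + 1) ^ 3 * (m0 ^ 2 * ((x + 1) * (2 * x ^ 2 + 10 * x + 15) * (x + 2)))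
        = (x ^ 2 * (x + 2) * m0 ^ 2) * ((x + 1) ^ 4 * (2 * x ^ 2 + 10 * x + 15)) := by ring
      _ ≤ ((x + 1) ^ 3 * m1 ^ 2) * (16 * x ^ 4 * (x + 4) * (x + 6)) := by gcongr
      _ = _ := by ring
  have hleft : m0 ^ 2 * (m1 * m2 ^ 2 * ((x + 1) * (2 * x ^ 2 + 10 * x + 15)
        / ((x + 2) * (x + 3) ^ 2 * (x + 4) * (x + 6))))
      = m1 * m2 ^ 2 / ((x + 2) ^ 2 * (x + 3) ^ 2 * ((x + 4) * (x + 6)))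
        * (m0 ^ 2 * ((x + 1) * (2 * x ^ 2 + 10 * x + 15) * (x + 2))) := by field_simp
  have hright : 16 * x ^ 2 * m1 * (m1 * m2 / ((x + 2) * (x + 3))) ^ 2
      = m1 * m2 ^ 2 / ((x + 2) ^ 2 * (x + 3) ^ 2 * ((x + 4) * (x + 6)))
        * (16 * x ^ 2 * m1 ^ 2 * ((x + 4) * (x + 6))) := by field_simp
  rw [hleft, hright]
  gcongr

/-- By the recurrence m₄/m₂ = (d+2)/(d+3), which exceeds m₃/m₁ = (d+1)/(d+2). -/
lemma moment_diff_pos [NeZero d] : 0 < moment d 4 * moment d 1 - moment d 2 * moment d 3 := by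
  have h1 := moment_pos (d := d) 1
  have h2 := moment_pos (d := d) 2
  have r1 := moment_recurrence (d := d) 1
  have r2 := moment_recurrence (d := d) 2
  have hd : (1 : ℝ) ≤ d := by exact_mod_cast NeZero.pos d
  norm_num at r1 r2
  generalize moment d 1 = m1 at *
  generalize moment d 2 = m2 at *
  generalize moment d 3 = m3 at *
  generalize moment d 4 = m4 at *
  generalize (d : ℝ) = x at *
  have e3 : m3 = (x + 1) / (x + 2) * m1 := by field_simp; linarith
  have e4 : m4 = (x + 2) / (x + 3) * m2 := by field_simp; linarith
  have hr : m4 * m1 - m2 * m3 = m1 * m2 / ((x + 2) * (x + 3)) := by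
    rw [e4, e3]; field_simp; ring
  rw [hr]; positivity

/-- Here x is the dimension d, Y and X bound the potential integrals against the conjugate of u
without and with the factor m₄s − m₂s³, and S is the weighted moment of that factor. Hardy absorbs H
into E, giving xY ≤ bE and m₀X ≤ 4bcE. Eliminating lam·N between `h1` and `h2` leaves xE ≤ b(4x+1)E.
-/
lemma energy_eq_zero_of_bounds {E N H lam b x m0 m1 c S X Y : ℝ} (hE : 0 ≤ E) (hx : 1 ≤ x)
    (hb : 0 < b) (hbx : b * (4 * x + 1) < x) (hm1 : 0 < m1) (hm0 : 0 < m0) (hc : 0 < c)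
    (hS : m0 ^ 2 * S ≤ 16 * x ^ 2 * m1 * c ^ 2) (hardy : x ^ 2 * (m1 * H) ≤ E)
    (hH : 0 ≤ H) (h1 : E ≤ lam * (m0 * N) + Y) (hY : Y ^ 2 ≤ b ^ 2 * E * (m1 * H))
    (h2 : lam * (c * N) ≤ X) (hX : X ^ 2 ≤ b ^ 2 * E * (S * H)) : E = 0 := by
  by_contra hne
  have hE' : 0 < E := lt_of_le_of_ne hE (Ne.symm hne)
  have hx0 : 0 < x := by linarith
  have hYb : x * Y ≤ b * E := by
    refine abs_le_of_sq_le_sq' ?_ (by positivity) |>.2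
    calc (x * Y) ^ 2 = x ^ 2 * Y ^ 2 := by ring
      _ ≤ x ^ 2 * (b ^ 2 * E * (m1 * H)) := by gcongr
      _ = b ^ 2 * E * (x ^ 2 * (m1 * H)) := by ring
      _ ≤ b ^ 2 * E * E := by gcongr
      _ = (b * E) ^ 2 := by ring
  have hXb : m0 * X ≤ 4 * b * c * E := by
    refine abs_le_of_sq_le_sq' ?_ (by positivity) |>.2
    refine le_of_mul_le_mul_left ?_ (show 0 < x ^ 2 * m1 by positivity)
    calc x ^ 2 * m1 * (m0 * X) ^ 2 = x ^ 2 * m1 * m0 ^ 2 * X ^ 2 := by ring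
      _ ≤ x ^ 2 * m1 * m0 ^ 2 * (b ^ 2 * E * (S * H)) := by gcongr
      _ = b ^ 2 * E * (m0 ^ 2 * S) * (x ^ 2 * (m1 * H)) := by ring
      _ ≤ b ^ 2 * E * (16 * x ^ 2 * m1 * c ^ 2) * E := by gcongr
      _ = x ^ 2 * m1 * (4 * b * c * E) ^ 2 := by ring
  have h3 : c * E ≤ m0 * X + c * Y := by
    calc c * E ≤ c * (lam * (m0 * N) + Y) := by gcongr
      _ = m0 * (lam * (c * N)) + c * Y := by ring
      _ ≤ m0 * X + c * Y := by gcongr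
  have h4 : x * (c * E) ≤ c * E * (b * (4 * x + 1)) := by
    calc x * (c * E) ≤ x * (m0 * X + c * Y) := by gcongr
      _ = x * (m0 * X) + c * (x * Y) := by ring
      _ ≤ x * (4 * b * c * E) + c * (b * E) := by gcongr
      _ = _ := by ring
  have : 0 < c * E := by positivity
  nlinarith


/-! ### Integrals of radial functions -/

lemma radial_mul_slope [NeZero d] {h : ℝ → ℝ} (hh : Measurable h)
    (hi : Integrable fun τ => Real.exp (growth d * τ) * h τ) (j : ℕ) :
    Integrable (fun p : Space d => h (logGauge p) * slope p ^ j) ∧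
      ∫ p : Space d, h (logGauge p) * slope p ^ j
        = moment d j * ∫ τ, Real.exp (growth d * τ) * h τ := by
  have hhc : Measurable fun τ => (h τ : ℂ) := Complex.measurable_ofReal.comp hh
  constructor
  · have h1 : Integrable (fun p : Space d => (h (logGauge p) : ℂ)) := by
      rw [integrable_logGauge_iff hhc]
      simpa using hi.ofReal (𝕜 := ℂ)
    have h2 : Integrable (fun p : Space d => h (logGauge p)) := by simpa using h1.re
    refine h2.mul_bdd (c := 1) (measurable_slope.pow_const j).aestronglyMeasurable
      (Filter.Eventually.of_forall fun p => ?_)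
    rw [Real.norm_of_nonneg (pow_nonneg (slope_nonneg p) j)]
    exact pow_le_one₀ (slope_nonneg p) (slope_le_one p)
  · have h1 := integral_logGauge_mul_slope (d := d) hhc j
    simp only [← Complex.ofReal_mul, integral_complex_ofReal] at h1
    exact_mod_cast h1

lemma sqZ_div_gauge {p : Space d} (h : 0 < gauge p) :
    sqZ p / gauge p = Real.exp (-(1 / 2) * logGauge p) * slope p := by
  rw [sqZ_eq h, gauge_eq_exp h, mul_div_right_comm, ← Real.exp_sub]
  ring_nf

lemma exp_growth_mul (τ x : ℝ) : Real.exp (growth d * τ) * (Real.exp (-(1 / 2) * τ) * x)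
    = Real.exp (d / 2 * τ) * x := by
  rw [← mul_assoc, ← Real.exp_add, growth]; ring_nf

/-- Integrals against the weight `|z|² / (|z|⁴ + t²)`. -/
lemma radial_weight_mul_slope [NeZero d] {h : ℝ → ℝ} (hh : Measurable h)
    (hi : Integrable fun τ => Real.exp (d / 2 * τ) * h τ) (j : ℕ) :
    Integrable (fun p : Space d => sqZ p / gauge p * (h (logGauge p) * slope p ^ j)) ∧
      ∫ p : Space d, sqZ p / gauge p * (h (logGauge p) * slope p ^ j)
        = moment d (j + 1) * ∫ τ, Real.exp (d / 2 * τ) * h τ := by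
  have hm : Measurable fun τ : ℝ => Real.exp (-(1 / 2) * τ) * h τ :=
    (by fun_prop : Measurable fun τ : ℝ => Real.exp (-(1 / 2) * τ)).mul hh
  have h1 := radial_mul_slope (d := d) hm (by simpa only [exp_growth_mul] using hi) (j + 1)
  have e : (fun p : Space d => Real.exp (-(1 / 2) * logGauge p) * h (logGauge p)
      * slope p ^ (j + 1)) =ᵐ[volume]
        fun p => sqZ p / gauge p * (h (logGauge p) * slope p ^ j) := by
    filter_upwards [ae_gauge_pos] with p hp
    rw [sqZ_div_gauge hp]; ring
  simp only [exp_growth_mul] at h1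
  exact ⟨h1.1.congr e, (integral_congr_ae e).symm.trans h1.2⟩

/-! ### The weighted bound on the potential -/

/-- Cauchy–Schwarz for the splitting fy = (w^{−1/2}f)(w^{1/2}y). -/
lemma weighted_cauchy_schwarz {α : Type*} [MeasurableSpace α] {μ : Measure α} {w : α → ℝ}
    {f y : α → ℂ} {K : ℝ} (hw : AEMeasurable w μ) (hw0 : ∀ᵐ x ∂μ, 0 < w x)
    (hf : AEStronglyMeasurable f μ) (hy : AEStronglyMeasurable y μ) (hK : 0 ≤ K)
    (hfK : ∫⁻ x, ENNReal.ofReal ((w x)⁻¹ * ‖f x‖ ^ 2) ∂μ ≤ ENNReal.ofReal K)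
    (hyi : Integrable (fun x => w x * ‖y x‖ ^ 2) μ) :
    Integrable (fun x => f x * y x) μ ∧
      ‖∫ x, f x * y x ∂μ‖ ^ 2 ≤ K * ∫ x, w x * ‖y x‖ ^ 2 ∂μ := by
  have hF : AEStronglyMeasurable (fun x => √(w x)⁻¹ * ‖f x‖) μ :=
    (hw.inv.sqrt.aestronglyMeasurable).mul hf.norm
  have hG : AEStronglyMeasurable (fun x => √(w x) * ‖y x‖) μ :=
    (hw.sqrt.aestronglyMeasurable).mul hy.norm
  have hF2 : (fun x => (w x)⁻¹ * ‖f x‖ ^ 2) =ᵐ[μ] fun x => (√(w x)⁻¹ * ‖f x‖) ^ 2 := by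
    filter_upwards [hw0] with x hx
    rw [mul_pow, Real.sq_sqrt (inv_nonneg.2 hx.le)]
  have hG2 : (fun x => w x * ‖y x‖ ^ 2) =ᵐ[μ] fun x => (√(w x) * ‖y x‖) ^ 2 := by
    filter_upwards [hw0] with x hx
    rw [mul_pow, Real.sq_sqrt hx.le]
  have hFG : (fun x => √(w x)⁻¹ * ‖f x‖ * (√(w x) * ‖y x‖)) =ᵐ[μ] fun x => ‖f x * y x‖ := by
    filter_upwards [hw0] with x hx
    have : √(w x)⁻¹ * √(w x) = 1 := by
      rw [← Real.sqrt_mul (inv_nonneg.2 hx.le), inv_mul_cancel₀ hx.ne', Real.sqrt_one]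
    rw [norm_mul]
    linear_combination ‖f x‖ * ‖y x‖ * this
  have hn : 0 ≤ᵐ[μ] fun x => (w x)⁻¹ * ‖f x‖ ^ 2 := by
    filter_upwards [hw0] with x hx
    exact mul_nonneg (inv_nonneg.2 hx.le) (sq_nonneg _)
  have hfi : Integrable (fun x => (w x)⁻¹ * ‖f x‖ ^ 2) μ :=
    ⟨hw.inv.aestronglyMeasurable.mul (hf.norm.pow 2),
      (hasFiniteIntegral_iff_ofReal hn).2 (hfK.trans_lt ENNReal.ofReal_lt_top)⟩
  have hFm : MemLp (fun x => √(w x)⁻¹ * ‖f x‖) 2 μ :=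
    (memLp_two_iff_integrable_sq hF).2 (hfi.congr hF2)
  have hGm : MemLp (fun x => √(w x) * ‖y x‖) 2 μ :=
    (memLp_two_iff_integrable_sq hG).2 (hyi.congr hG2)
  have hbound : ∫ x, (w x)⁻¹ * ‖f x‖ ^ 2 ∂μ ≤ K := by
    rw [integral_eq_lintegral_of_nonneg_ae hn hfi.1]
    exact ENNReal.toReal_le_of_le_ofReal hK hfK
  refine ⟨(integrable_norm_iff (hf.mul hy)).1 ((hFm.integrable_mul hGm).congr hFG), ?_⟩
  have h1 := sq_integral_mul_le hFm hGm
  rw [← integral_congr_ae hF2, ← integral_congr_ae hG2, integral_congr_ae hFG] at h1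
  calc ‖∫ x, f x * y x ∂μ‖ ^ 2 ≤ (∫ x, ‖f x * y x‖ ∂μ) ^ 2 := by
        gcongr; exact norm_integral_le_integral_norm _
    _ ≤ _ := h1
    _ ≤ _ := by
      gcongr
      refine integral_nonneg_of_ae ?_
      filter_upwards [hw0] with x hx
      exact mul_nonneg hx.le (sq_nonneg _)

/-- The weight |z|²/G is the reciprocal of the weight ρ⁴/|z|² in the hypothesis on V, and is also
the weight in the Hardy inequality. -/
lemma potential_bound [NeZero d] {V : Space d → ℂ} (hV : AEMeasurable V volume) {b : ℝ} {u : H1 d}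
    (hVb : ∫⁻ p, ENNReal.ofReal (koranyi p ^ 4 / absZ p ^ 2) * ‖V p‖ₑ ^ 2 * ‖u.fn p‖ₑ ^ 2
      ≤ ENNReal.ofReal (b ^ 2) * energy u)
    {y : Space d → ℂ} (hy : AEStronglyMeasurable y volume)
    (hyi : Integrable fun p => sqZ p / gauge p * ‖y p‖ ^ 2) :
    Integrable (fun p => V p * u.fn p * y p) ∧
      ‖∫ p, V p * u.fn p * y p‖ ^ 2
        ≤ b ^ 2 * realEnergy u * ∫ p, sqZ p / gauge p * ‖y p‖ ^ 2 := by
  refine weighted_cauchy_schwarz (w := fun p => sqZ p / gauge p) (f := fun p => V p * u.fn p)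
    (continuous_sqZ.measurable.div continuous_gauge.measurable).aemeasurable ?_
    (hV.aestronglyMeasurable.mul u.memLp_fn.1) hy
    (mul_nonneg (sq_nonneg _) (realEnergy_nonneg u)) ?_ hyi
  · filter_upwards [ae_sqZ_pos] with p hp
    exact div_pos hp (gauge_pos_of_sqZ_pos hp)
  · rw [ENNReal.ofReal_mul (sq_nonneg b), ← energy_eq]
    refine le_trans (le_of_eq ?_) hVb
    congr 1; funext p
    rw [koranyi_pow_four, absZ_sq, inv_div, ENNReal.ofReal_mul
      (div_nonneg (gauge_nonneg p) (sqZ_nonneg p)), norm_mul, mul_pow,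
      ENNReal.ofReal_mul (sq_nonneg _), ENNReal.ofReal_pow (norm_nonneg _),
      ENNReal.ofReal_pow (norm_nonneg _), ofReal_norm, ofReal_norm, mul_assoc]

/-! ### Vanishing of angular averages -/

lemma angular_average [NeZero d] {F : Space d → ℂ} {k : ℝ → ℂ}
    (hi : Integrable fun p => F p * k (logGauge p)) :
    Integrable (fun τ => Real.exp (growth d * τ) * (∫ q, F (polar (τ, q)) ∂(angular d)) * k τ) ∧
      ∫ p, F p * k (logGauge p)
        = ∫ τ, Real.exp (growth d * τ) * (∫ q, F (polar (τ, q)) ∂(angular d)) * k τ := by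
  have e : ∀ᵐ x ∂(radial d).prod (angular d),
      F (polar x) * k (logGauge (polar x)) = F (polar x) * k x.1 := by
    filter_upwards [ae_polar_logGauge] with x hx
    rw [hx]
  have h1 : Integrable (fun x => F (polar x) * k x.1) ((radial d).prod (angular d)) :=
    ((measurePreserving_polar.integrable_comp hi.1).2 hi).congr e
  have h2 := h1.integral_prod_left
  simp only [integral_mul_const] at h2
  constructor
  · rw [radial, integrable_withDensity_iff_integrable_smul' (by fun_prop) (by simp)] at h2
    simpa [ENNReal.toReal_ofReal, Real.exp_nonneg, mul_assoc] using h2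
  · rw [integral_polar hi.1, integral_congr_ae e, integral_prod _ h1]
    simp only [integral_mul_const]
    rw [integral_radial]
    simp only [mul_assoc]

/-- A function that is orthogonal to all test functions of `log (|z|⁴ + t²)` is orthogonal to all
functions of it. -/
lemma integral_mul_logGauge_eq_zero [NeZero d] {F : Space d → ℂ}
    (hFi : ∀ χ : ℝ → ℝ, IsTest χ → Integrable fun p => F p * (χ (logGauge p) : ℂ))
    (h0 : ∀ χ : ℝ → ℝ, IsTest χ → ∫ p, F p * (χ (logGauge p) : ℂ) = 0)
    {k : ℝ → ℂ} (hi : Integrable fun p => F p * k (logGauge p)) :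
    ∫ p, F p * k (logGauge p) = 0 := by
  set f : ℝ → ℂ := fun τ => Real.exp (growth d * τ) * ∫ q, F (polar (τ, q)) ∂(angular d) with hf
  have hχ : ∀ χ : ℝ → ℝ, IsTest χ → Integrable (fun τ => f τ * (χ τ : ℂ)) ∧
      ∫ τ, f τ * (χ τ : ℂ) = 0 := fun χ h => by
    have h1 := angular_average (F := F) (k := fun τ => (χ τ : ℂ))
      (hFi χ h)
    exact ⟨h1.1, h1.2.symm.trans (h0 χ h)⟩
  -- Testing with a bump equal to 1 near τ gives integrability there.
  have hloc : LocallyIntegrable f := by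
    intro τ
    let χ : ContDiffBump τ := ⟨1, 2, by norm_num, by norm_num⟩
    refine ⟨Metric.ball τ 1, Metric.ball_mem_nhds τ one_pos, ?_⟩
    refine (hχ χ ⟨χ.contDiff, χ.hasCompactSupport⟩).1.integrableOn.congr_fun (fun s hs => ?_)
      Metric.isOpen_ball.measurableSet
    simp [χ.one_of_mem_closedBall (Metric.ball_subset_closedBall hs)]
  have hz : ∀ᵐ τ, f τ = 0 := by
    refine ae_eq_zero_of_integral_contDiff_smul_eq_zero hloc fun χ h1 h2 => ?_
    rw [← (hχ χ ⟨h1, h2⟩).2]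
    congr 1; funext τ
    rw [Complex.real_smul, mul_comm]
  rw [(angular_average hi).2]
  refine integral_eq_zero_of_ae ?_
  filter_upwards [hz] with τ hτ
  change f τ * k τ = 0
  rw [hτ, zero_mul]


/-! ### The two identities for a radial eigenfunction -/

lemma FormSubordinate.inFormDomain {V : Space d → ℂ} (h : FormSubordinate V) (ψ : H1 d) :
    InFormDomain V ψ := by
  obtain ⟨a, -, ha⟩ := h
  refine (ha ψ).trans_lt ?_
  rw [energy_eq]
  exact ENNReal.mul_lt_top ENNReal.ofReal_lt_top ENNReal.ofReal_lt_top

lemma form_self (V : Space d → ℂ) (u : H1 d) :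
    form V u u = realEnergy u + ∫ p, V p * u.fn p * conj (u.fn p) := by
  rw [form, realEnergy, ← integral_complex_ofReal]
  congr 2; funext p
  push_cast
  exact Finset.sum_congr rfl fun k _ => Complex.mul_conj' _

/-- The coefficient that eliminates the gradient from the equation. -/
noncomputable def eliminant (p : Space d) : ℝ :=
  moment d 4 * slope p - moment d 2 * slope p ^ 3

lemma measurable_eliminant : Measurable (eliminant : Space d → ℝ) :=
  (measurable_slope.const_mul _).sub ((measurable_slope.pow_const 3).const_mul _)

lemma radialTest_exp_eq {χ : ℝ → ℝ} (j : ℕ) {p : Space d} (hp : 0 < gauge p) :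
    radialTest (j + 1) (fun τ => Real.exp (-((j + 1) / 2) * τ) * χ τ) p
      = slope p ^ (j + 1) * χ (logGauge p) := by
  rw [radialTest_eq _ _ hp, ← mul_assoc (Real.exp _), ← Real.exp_add]
  push_cast
  rw [← add_mul, add_neg_cancel, zero_mul, Real.exp_zero, one_mul]

section

variable [NeZero d] {V : Space d → ℂ} {u : H1 d} {lam : ℂ} {g : ℝ → ℂ} {b : ℝ}

/-- The function s^{j+1}χ(τ) is an admissible test function: it is |z|^{2(j+1)} times a smooth
function of G supported in a compact part of (0, ∞). -/
lemma slope_mul_test_equation (hsub : FormSubordinate V)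
    (hu : OperatorGraph V u fun p => lam * u.fn p) (hg : Measurable g)
    (hug : u.fn =ᵐ[volume] fun p => g (logGauge p)) {χ : ℝ → ℝ} (hχ : IsTest χ) (j : ℕ) :
    -(moment d (j + 2) * (8 * d * pair g (d / 2) (deriv χ)
        + 16 * pair g (d / 2) (deriv (deriv χ))))
      + ∫ p, V p * u.fn p * ((slope p ^ (j + 1) * χ (logGauge p) : ℝ) : ℂ)
      = lam * ∫ p, u.fn p * ((slope p ^ (j + 1) * χ (logGauge p) : ℝ) : ℂ) := by
  have hθ := hχ.mul_left (contDiff_exp_mul (-((j + 1) / 2)))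
  have h := hu.2.2 (H1.ofTest _ (hθ.contDiff_radialTest (j + 1))
    (hθ.hasCompactSupport_radialTest (j + 1))) (hsub.inFormDomain _)
  simp only [form, H1.ofTest, Complex.conj_ofReal] at h
  have e : ∀ᵐ p : Space d,
      radialTest (j + 1) (fun τ => Real.exp (-((j + 1) / 2) * τ) * χ τ) p
        = slope p ^ (j + 1) * χ (logGauge p) := by
    filter_upwards [ae_gauge_pos] with p hp using radialTest_exp_eq j hp
  rw [integral_grad_slope_mul u.weakPair hg hug hχ, integral_congr_ae (g := fun p =>
    V p * u.fn p * ((slope p ^ (j + 1) * χ (logGauge p) : ℝ) : ℂ))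
    (by filter_upwards [e] with p hp; rw [hp]),
    integral_congr_ae (f := fun p => lam * u.fn p * _) (g := fun p =>
    lam * (u.fn p * ((slope p ^ (j + 1) * χ (logGauge p) : ℝ) : ℂ)))
    (by filter_upwards [e] with p hp; rw [hp, mul_assoc]), integral_const_mul] at h
  exact h

lemma integrable_slope_mul_test (u : H1 d) {χ : ℝ → ℝ} (hχ : IsTest χ) (j : ℕ) :
    Integrable fun p => u.fn p * ((slope p ^ (j + 1) * χ (logGauge p) : ℝ) : ℂ) := by
  refine (integrable_mul_radialTest u.weakPair.fn
    (hχ.mul_left (contDiff_exp_mul (-((j + 1) / 2)))) (j + 1)).congr ?_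
  filter_upwards [ae_gauge_pos] with p hp
  rw [radialTest_exp_eq j hp]

lemma integrable_potential_mul_test (hV : AEMeasurable V volume)
    (hVb : ∫⁻ p, ENNReal.ofReal (koranyi p ^ 4 / absZ p ^ 2) * ‖V p‖ₑ ^ 2 * ‖u.fn p‖ₑ ^ 2
      ≤ ENNReal.ofReal (b ^ 2) * energy u) {χ : ℝ → ℝ} (hχ : IsTest χ) (j : ℕ) :
    Integrable fun p => V p * u.fn p * ((slope p ^ j * χ (logGauge p) : ℝ) : ℂ) := by
  have hm : Measurable fun p : Space d => ((slope p ^ j * χ (logGauge p) : ℝ) : ℂ) :=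
    Complex.measurable_ofReal.comp
      ((measurable_slope.pow_const j).mul (hχ.continuous.measurable.comp measurable_logGauge))
  refine (potential_bound hV hVb hm.aestronglyMeasurable ?_).1
  have hχ2 : IsTest fun τ => χ τ * χ τ := hχ.mul_left hχ.1
  refine (radial_weight_mul_slope (d := d) hχ2.continuous.measurable
    (hχ2.mul_left (contDiff_exp_mul (d / 2))).integrable (2 * j)).1.congr
    (Filter.Eventually.of_forall fun p => ?_)
  simp only [Complex.norm_real, Real.norm_eq_abs, sq_abs]
  ring

/-- For j = 0 and j = 2 the gradient terms are m₂ and m₄ times the same functional of χ, so m₄ times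
the first equation minus m₂ times the second contains no gradient. The choice of these j keeps m₂
and m₄ linked by the recurrence. -/
lemma test_equation (hV : AEMeasurable V volume) (hsub : FormSubordinate V)
    (hVb : ∫⁻ p, ENNReal.ofReal (koranyi p ^ 4 / absZ p ^ 2) * ‖V p‖ₑ ^ 2 * ‖u.fn p‖ₑ ^ 2
      ≤ ENNReal.ofReal (b ^ 2) * energy u)
    (hu : OperatorGraph V u fun p => lam * u.fn p) (hg : Measurable g)
    (hug : u.fn =ᵐ[volume] fun p => g (logGauge p)) {χ : ℝ → ℝ} (hχ : IsTest χ) :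
    Integrable (fun p => (V p * u.fn p - lam * u.fn p) * eliminant p * (χ (logGauge p) : ℂ)) ∧
      ∫ p, (V p * u.fn p - lam * u.fn p) * eliminant p * (χ (logGauge p) : ℂ) = 0 := by
  have a0 := integrable_potential_mul_test hV hVb hχ (0 + 1)
  have a2 := integrable_potential_mul_test hV hVb hχ (2 + 1)
  have c0 := integrable_slope_mul_test u hχ 0
  have c2 := integrable_slope_mul_test u hχ 2
  have e0 := slope_mul_test_equation hsub hu hg hug hχ 0
  have e2 := slope_mul_test_equation hsub hu hg hug hχ 2
  have i0 : Integrable fun p =>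
      moment d 4 * (V p * u.fn p * ((slope p ^ (0 + 1) * χ (logGauge p) : ℝ) : ℂ)
        - lam * (u.fn p * ((slope p ^ (0 + 1) * χ (logGauge p) : ℝ) : ℂ))) :=
    (a0.sub (c0.const_mul lam)).const_mul _
  have i2 : Integrable fun p =>
      moment d 2 * (V p * u.fn p * ((slope p ^ (2 + 1) * χ (logGauge p) : ℝ) : ℂ)
        - lam * (u.fn p * ((slope p ^ (2 + 1) * χ (logGauge p) : ℝ) : ℂ))) :=
    (a2.sub (c2.const_mul lam)).const_mul _
  have e : (fun p => (V p * u.fn p - lam * u.fn p) * eliminant p * (χ (logGauge p) : ℂ))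
      = fun p => moment d 4 * (V p * u.fn p * ((slope p ^ (0 + 1) * χ (logGauge p) : ℝ) : ℂ)
          - lam * (u.fn p * ((slope p ^ (0 + 1) * χ (logGauge p) : ℝ) : ℂ)))
        - moment d 2 * (V p * u.fn p * ((slope p ^ (2 + 1) * χ (logGauge p) : ℝ) : ℂ)
          - lam * (u.fn p * ((slope p ^ (2 + 1) * χ (logGauge p) : ℝ) : ℂ))) := by
    funext p
    rw [eliminant]
    push_cast
    ring
  rw [e]
  refine ⟨i0.sub i2, ?_⟩
  rw [integral_sub i0 i2, integral_const_mul, integral_const_mul, integral_sub a0 (c0.const_mul lam),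
    integral_sub a2 (c2.const_mul lam), integral_const_mul, integral_const_mul]
  linear_combination (moment d 4 : ℂ) * e0 - moment d 2 * e2

lemma integral_weight_norm_sq (u : H1 d) (hg : Measurable g)
    (hug : u.fn =ᵐ[volume] fun p => g (logGauge p)) :
    Integrable (fun p => sqZ p / gauge p * ‖conj (u.fn p)‖ ^ 2) ∧
      ∫ p, sqZ p / gauge p * ‖conj (u.fn p)‖ ^ 2
        = moment d 1 * ∫ τ, Real.exp (d / 2 * τ) * ‖g τ‖ ^ 2 := by
  have h := radial_weight_mul_slope (d := d) (hg.norm.pow_const 2) (hardy_radial u hg hug).1 0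
  have e : (fun p => sqZ p / gauge p * (‖g (logGauge p)‖ ^ 2 * slope p ^ 0))
      =ᵐ[volume] fun p => sqZ p / gauge p * ‖conj (u.fn p)‖ ^ 2 := by
    filter_upwards [hug] with p hp
    rw [hp, RCLike.norm_conj, pow_zero, mul_one]
  exact ⟨h.1.congr e, (integral_congr_ae e).symm.trans h.2⟩

/-- The squared factor contributes s², s⁴ and s⁶, and the weight |z|²/G one further power of s,
whence the moments of order 3, 5 and 7. -/
lemma integral_weight_eliminant (u : H1 d) (hg : Measurable g)
    (hug : u.fn =ᵐ[volume] fun p => g (logGauge p)) :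
    Integrable (fun p => sqZ p / gauge p * ‖eliminant p * conj (u.fn p)‖ ^ 2) ∧
      ∫ p, sqZ p / gauge p * ‖eliminant p * conj (u.fn p)‖ ^ 2
        = (moment d 4 ^ 2 * moment d 3 - 2 * moment d 4 * moment d 2 * moment d 5
            + moment d 2 ^ 2 * moment d 7) * ∫ τ, Real.exp (d / 2 * τ) * ‖g τ‖ ^ 2 := by
  have h := fun j => radial_weight_mul_slope (d := d) (hg.norm.pow_const 2)
    (hardy_radial u hg hug).1 j
  have e : (fun p => sqZ p / gauge p * (‖g (logGauge p)‖ ^ 2 * slope p ^ 6) * moment d 2 ^ 2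
      + (moment d 4 ^ 2 * (sqZ p / gauge p * (‖g (logGauge p)‖ ^ 2 * slope p ^ 2))
        + -(2 * moment d 4 * moment d 2)
          * (sqZ p / gauge p * (‖g (logGauge p)‖ ^ 2 * slope p ^ 4))))
      =ᵐ[volume] fun p => sqZ p / gauge p * ‖eliminant p * conj (u.fn p)‖ ^ 2 := by
    filter_upwards [hug] with p hp
    rw [hp, norm_mul, RCLike.norm_conj, Complex.norm_real, mul_pow, Real.norm_eq_abs, sq_abs,
      eliminant]
    ring
  have i6 : Integrable fun p =>
      sqZ p / gauge p * (‖g (logGauge p)‖ ^ 2 * slope p ^ 6) * moment d 2 ^ 2 :=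
    (h 6).1.mul_const _
  refine ⟨(i6.add (((h 2).1.const_mul _).add ((h 4).1.const_mul _))).congr e, ?_⟩
  rw [← integral_congr_ae e, integral_linear_combination i6 (h 2).1 (h 4).1, integral_mul_const,
    (h 6).2, (h 2).2, (h 4).2]
  ring

lemma integral_norm_sq_mul_slope (u : H1 d) (hg : Measurable g)
    (hug : u.fn =ᵐ[volume] fun p => g (logGauge p)) (j : ℕ) :
    Integrable (fun p => u.fn p * conj (u.fn p) * ((slope p ^ j : ℝ) : ℂ)) ∧
      ∫ p, u.fn p * conj (u.fn p) * ((slope p ^ j : ℝ) : ℂ)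
        = ((moment d j * ∫ τ, Real.exp (growth d * τ) * ‖g τ‖ ^ 2 : ℝ) : ℂ) := by
  have h := radial_mul_slope (d := d) (hg.norm.pow_const 2)
    (integrable_exp_mul_norm_sq u.memLp_fn hg hug) j
  have e : (fun p => ((‖g (logGauge p)‖ ^ 2 * slope p ^ j : ℝ) : ℂ))
      =ᵐ[volume] fun p => u.fn p * conj (u.fn p) * ((slope p ^ j : ℝ) : ℂ) := by
    filter_upwards [hug] with p hp
    rw [hp, Complex.mul_conj']
    push_cast; rfl
  refine ⟨h.1.ofReal.congr e, ?_⟩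
  rw [← integral_congr_ae e, integral_complex_ofReal, h.2]

/-- The equation without gradient is paired with the conjugate of g. This is not a test function,
but the orthogonality extends to any function of τ whose pairing is integrable; `potential_bound`
and u ∈ L² give the integrability. -/
lemma eliminated_equation (hV : AEMeasurable V volume) (hsub : FormSubordinate V)
    (hVb : ∫⁻ p, ENNReal.ofReal (koranyi p ^ 4 / absZ p ^ 2) * ‖V p‖ₑ ^ 2 * ‖u.fn p‖ₑ ^ 2
      ≤ ENNReal.ofReal (b ^ 2) * energy u)
    (hu : OperatorGraph V u fun p => lam * u.fn p) (hg : Measurable g)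
    (hug : u.fn =ᵐ[volume] fun p => g (logGauge p)) :
    ∫ p, V p * u.fn p * (eliminant p * conj (u.fn p))
      = lam * (((moment d 4 * moment d 1 - moment d 2 * moment d 3)
          * ∫ τ, Real.exp (growth d * τ) * ‖g τ‖ ^ 2 : ℝ) : ℂ) := by
  have hym : AEStronglyMeasurable (fun p => (eliminant p : ℂ) * conj (u.fn p)) volume :=
    (Complex.measurable_ofReal.comp measurable_eliminant).aestronglyMeasurable.mul
      (Complex.continuous_conj.comp_aestronglyMeasurable u.memLp_fn.1)
  have hi1 := (potential_bound hV hVb hym (integral_weight_eliminant u hg hug).1).1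
  obtain ⟨i1, e1⟩ := integral_norm_sq_mul_slope u hg hug 1
  obtain ⟨i3, e3⟩ := integral_norm_sq_mul_slope u hg hug 3
  have j1 := i1.const_mul (moment d 4 : ℂ)
  have j3 := i3.const_mul (moment d 2 : ℂ)
  have e : (fun p => (V p * u.fn p - lam * u.fn p) * eliminant p * conj (g (logGauge p)))
      =ᵐ[volume] fun p => V p * u.fn p * (eliminant p * conj (u.fn p))
        - lam * (moment d 4 * (u.fn p * conj (u.fn p) * ((slope p ^ 1 : ℝ) : ℂ))
          - moment d 2 * (u.fn p * conj (u.fn p) * ((slope p ^ 3 : ℝ) : ℂ))) := by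
    filter_upwards [hug] with p hp
    rw [← hp, eliminant]
    push_cast; ring
  have j : Integrable fun p =>
      lam * (moment d 4 * (u.fn p * conj (u.fn p) * ((slope p ^ 1 : ℝ) : ℂ))
        - moment d 2 * (u.fn p * conj (u.fn p) * ((slope p ^ 3 : ℝ) : ℂ))) :=
    (j1.sub j3).const_mul lam
  have hi := hi1.sub j
  have h := integral_mul_logGauge_eq_zero
    (F := fun p => (V p * u.fn p - lam * u.fn p) * eliminant p) (k := fun τ => conj (g τ))
    (fun χ hχ => (test_equation hV hsub hVb hu hg hug hχ).1)
    (fun χ hχ => (test_equation hV hsub hVb hu hg hug hχ).2) (hi.congr e.symm)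
  rw [integral_congr_ae e, integral_sub hi1 j, integral_const_mul,
    integral_sub j1 j3, integral_const_mul, integral_const_mul, e1, e3] at h
  push_cast at h ⊢
  linear_combination h

/-- Hardy forces the weighted norm of the profile to vanish, and the weight is positive. -/
lemma fn_ae_eq_zero_of_realEnergy (u : H1 d) (hg : Measurable g)
    (hug : u.fn =ᵐ[volume] fun p => g (logGauge p)) (h : realEnergy u = 0) :
    u.fn =ᵐ[volume] 0 := by
  obtain ⟨hi, hH⟩ := hardy_radial u hg hug
  have hd : (0 : ℝ) < d := by exact_mod_cast NeZero.pos d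
  have h0 : 0 ≤ ∫ τ, Real.exp (d / 2 * τ) * ‖g τ‖ ^ 2 := integral_nonneg fun _ => by positivity
  have hm := moment_pos (d := d) 1
  have hz : ∫ τ, Real.exp (d / 2 * τ) * ‖g τ‖ ^ 2 = 0 := by
    refine le_antisymm ?_ h0
    rw [h, ← mul_assoc] at hH
    exact nonpos_of_mul_nonpos_right hH (by positivity)
  rw [integral_eq_zero_iff_of_nonneg (fun _ => by positivity) hi] at hz
  have hN : ∫ τ, Real.exp (growth d * τ) * ‖g τ‖ ^ 2 = 0 := by
    refine integral_eq_zero_of_ae ?_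
    filter_upwards [hz] with τ hτ
    have : ‖g τ‖ ^ 2 = 0 := by
      rcases mul_eq_zero.1 hτ with h | h
      · exact absurd h (Real.exp_pos _).ne'
      · exact h
    simp [this]
  have h2 := radial_mul_slope (d := d) (hg.norm.pow_const 2)
    (integrable_exp_mul_norm_sq u.memLp_fn hg hug) 0
  rw [hN, mul_zero] at h2
  have h3 := (integral_eq_zero_iff_of_nonneg
    (fun p => mul_nonneg (sq_nonneg _) (pow_nonneg (slope_nonneg p) 0)) h2.1).1 h2.2
  filter_upwards [h3, hug] with p h1 h2
  simpa [h2] using h1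

lemma realEnergy_eq_zero (hV : AEMeasurable V volume) (hsub : FormSubordinate V)
    (hVb : ∫⁻ p, ENNReal.ofReal (koranyi p ^ 4 / absZ p ^ 2) * ‖V p‖ₑ ^ 2 * ‖u.fn p‖ₑ ^ 2
      ≤ ENNReal.ofReal (b ^ 2) * energy u)
    (hb : 0 < b) (hbd : b * (4 * d + 1) < d)
    (hu : OperatorGraph V u fun p => lam * u.fn p) (hg : Measurable g)
    (hug : u.fn =ᵐ[volume] fun p => g (logGauge p)) : realEnergy u = 0 := by
  have hN0 : 0 ≤ ∫ τ, Real.exp (growth d * τ) * ‖g τ‖ ^ 2 := integral_nonneg fun _ => by positivity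
  have hconj : AEStronglyMeasurable (fun p => conj (u.fn p)) volume :=
    Complex.continuous_conj.comp_aestronglyMeasurable u.memLp_fn.1
  have hym : AEStronglyMeasurable (fun p => (eliminant p : ℂ) * conj (u.fn p)) volume :=
    (Complex.measurable_ofReal.comp measurable_eliminant).aestronglyMeasurable.mul hconj
  obtain ⟨iY, eY⟩ := integral_weight_norm_sq u hg hug
  obtain ⟨iX, eX⟩ := integral_weight_eliminant u hg hug
  have hY := (potential_bound hV hVb hconj iY).2
  have hX := (potential_bound hV hVb hym iX).2
  rw [eY] at hY
  rw [eX] at hX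
  refine energy_eq_zero_of_bounds (realEnergy_nonneg u) (x := d) (lam := ‖lam‖)
    (N := ∫ τ, Real.exp (growth d * τ) * ‖g τ‖ ^ 2)
    (by exact_mod_cast NeZero.one_le) hb hbd (moment_pos 1) (moment_pos 0) moment_diff_pos
    moment_inequality (hardy_radial u hg hug).2 (integral_nonneg fun _ => by positivity)
    ?_ hY ?_ hX
  -- The equation tested with u itself; absolute values are taken because λ and V are complex.
  · have h := hu.2.2 u hu.1
    have h0 := (integral_norm_sq_mul_slope u hg hug 0).2
    simp only [pow_zero, Complex.ofReal_one, mul_one] at h0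
    simp only [mul_assoc lam] at h
    rw [form_self, integral_const_mul, h0] at h
    have h1 : (realEnergy u : ℂ)
        = lam * ((moment d 0 * ∫ τ, Real.exp (growth d * τ) * ‖g τ‖ ^ 2 : ℝ) : ℂ)
          - ∫ p, V p * u.fn p * conj (u.fn p) := by linear_combination h
    have h2 := congrArg norm h1
    rw [Complex.norm_of_nonneg (realEnergy_nonneg u)] at h2
    rw [h2]
    refine (norm_sub_le _ _).trans_eq ?_
    rw [norm_mul, Complex.norm_of_nonneg (mul_nonneg (moment_pos 0).le hN0)]
  · rw [eliminated_equation hV hsub hVb hu hg hug, norm_mul,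
      Complex.norm_of_nonneg (mul_nonneg moment_diff_pos.le hN0)]

end

end Heisenberg

theorem theorem2p2 (d : ℕ) (hd : 1 ≤ d)
    (V : Heisenberg.Space d → ℂ) (hV : AEMeasurable V volume)
    (hsub : Heisenberg.FormSubordinate V)
    (b : ℝ) (hb : 0 < b) (hbκ : b < 1 / (d * Heisenberg.kappa d))
    (hVb : ∀ ψ : Heisenberg.H1 d,
      ∫⁻ p, ENNReal.ofReal (Heisenberg.koranyi p ^ 4 / Heisenberg.absZ p ^ 2)
          * ‖V p‖ₑ ^ 2 * ‖ψ.fn p‖ₑ ^ 2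
        ≤ ENNReal.ofReal (b ^ 2) * Heisenberg.energy ψ) :
    ¬ ∃ (lam : ℂ) (u : Heisenberg.H1 d),
      Heisenberg.IsEigenfunction V lam u ∧ Heisenberg.IsRadial u.fn := by
  rintro ⟨lam, u, ⟨hne, hu⟩, hrad⟩
  have : NeZero d := ⟨by omega⟩
  obtain ⟨g, hg, hug⟩ := hrad.exists_measurable u.memLp_fn.1
  exact hne (Heisenberg.fn_ae_eq_zero_of_realEnergy u hg hug
    (Heisenberg.realEnergy_eq_zero hV hsub (hVb u) hb
      (Heisenberg.mul_lt_of_lt_kappa hd hbκ) hu hg hug))
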